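/- Let $M$ be a compact smooth $8$-manifold with a $Spin(7)$-structure, that is, a Riemannian metric $g$ and a $4$-form $\Phi$ such that near every point there is a smooth $g$-orthonormal frame $e_0,\dots,e_7$ with dual coframe (also written $e_i$, with $e_{ijkl}=e_i\wedge e_j\wedge e_k\wedge e_l$) in which \[ \begin{aligned} \Phi={}&-e_{0127}+e_{0236}-e_{0347}-e_{0567}+e_{0146}+e_{0245}-e_{0135}\\ &-e_{3456}-e_{1457}-e_{1256}-e_{1234}-e_{2357}-e_{1367}+e_{2467}. \end{aligned} \] Let $\nabla^g$ be the Levi-Civita connection of $g$ and, with indices referring to an orthonormal frame and repeated indices summed, let $(\delta\Phi)_{klm}=-\nabla^g_j\Phi_{jklm}$ be the codifferential of $\Phi$, let $\theta_a=\frac1{42}(\delta\Phi)_{ijk}\Phi_{ijka}$ be the Lee form, and let $T=\delta\Phi+\frac76\,\theta\lrcorner\Phi$, where $(\theta\lrcorner\Phi)_{klm}=\theta_s\Phi_{sklm}$. Let $\nabla$ be the $Spin(7)$-torsion connection, given by $g(\nabla_XY,Z)=g(\nabla^g_XY,Z)+\frac12T(X,Y,Z)$; it is the unique linear connection with $\nabla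 g=\nabla\Phi=0$ and totally skew-symmetric torsion, and its torsion is $T$. Let $R(X,Y)Z=\nabla_X\nabla_YZ-\nabla_Y\nabla_XZ-\nabla_{[X,Y]}Z$ be its curvature and $Ric(X,Y)=\sum_a g(R(e_a,X)Y,e_a)$ its Ricci tensor. Then the following conditions are equivalent: a) the torsion is closed, $dT=0$; b) $Ric(X,Y)=-\frac76(\nabla_X\theta)(Y)$ for all $X,Y$. If these conditions hold, then the exterior derivative of the Lee form satisfies $d\theta\in\Lambda^2_{21}\cong spin(7)$, where $\Lambda^2_{21}=\{\omega\in\Lambda^2 : \omega_{ij}\Phi_{ijkl}=2\omega_{kl}\}$. -/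

import Mathlib

open scoped Manifold ContDiff Bundle

noncomputable section

namespace Spin7

/-- The model space `ℝ⁸`. -/
abbrev E8 : Type := EuclideanSpace ℝ (Fin 8)

/-! ### The standard 4-form on `ℝ⁸` -/

/-- The monomials of the standard `Spin(7)` 4-form: `(c, ![a, b, c, d])` stands for the term
`c • e_a ∧ e_b ∧ e_c ∧ e_d`. -/
def stdTerms : List (ℤ × (Fin 4 → Fin 8)) :=
  [(-1, ![0, 1, 2, 7]), (1, ![0, 2, 3, 6]), (-1, ![0, 3, 4, 7]), (-1, ![0, 5, 6, 7]),
   (1, ![0, 1, 4, 6]), (1, ![0, 2, 4, 5]), (-1, ![0, 1, 3, 5]),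
   (-1, ![3, 4, 5, 6]), (-1, ![1, 4, 5, 7]), (-1, ![1, 2, 5, 6]), (-1, ![1, 2, 3, 4]),
   (-1, ![2, 3, 5, 7]), (-1, ![1, 3, 6, 7]), (1, ![2, 4, 6, 7])]

/-- The component `Φ_{ijkl}` of the standard 4-form on the standard basis vectors with indices
`J = (i, j, k, l)`; the value of `e_a ∧ e_b ∧ e_c ∧ e_d` on four vectors is the `4 × 4` minor. -/
def stdCoeff (J : Fin 4 → Fin 8) : ℤ :=
  (stdTerms.map fun t =>
    t.1 * Matrix.det (Matrix.of fun r s : Fin 4 => if t.2 r = J s then (1 : ℤ) else 0)).sum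

section Manifold

variable {M : Type*} [TopologicalSpace M] [ChartedSpace E8 M]

/-- Directional derivative of a function along a vector field. -/
def lieD (X : Π x : M, TangentSpace 𝓘(ℝ, E8) x) (f : M → ℝ) (x : M) : ℝ :=
  mvfderiv 𝓘(ℝ, E8) f x (X x)

/-- The Lie bracket of vector fields. -/
def bracket (X Y : Π x : M, TangentSpace 𝓘(ℝ, E8) x) : Π x : M, TangentSpace 𝓘(ℝ, E8) x :=
  VectorField.mlieBracket 𝓘(ℝ, E8) X Y

/-- Exterior derivative of a 1-form, as a function of two vector fields. -/
def d₁ (α : Π x : M, TangentSpace 𝓘(ℝ, E8) x → ℝ)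
    (X Y : Π x : M, TangentSpace 𝓘(ℝ, E8) x) (x : M) : ℝ :=
  lieD X (fun y => α y (Y y)) x - lieD Y (fun y => α y (X y)) x - α x (bracket X Y x)

/-- Exterior derivative of a 3-form, as a function of four vector fields. -/
def d₃ (β : Π x : M, TangentSpace 𝓘(ℝ, E8) x → TangentSpace 𝓘(ℝ, E8) x →
      TangentSpace 𝓘(ℝ, E8) x → ℝ)
    (X Y Z W : Π x : M, TangentSpace 𝓘(ℝ, E8) x) (x : M) : ℝ :=
  lieD X (fun y => β y (Y y) (Z y) (W y)) x - lieD Y (fun y => β y (X y) (Z y) (W y)) x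
    + lieD Z (fun y => β y (X y) (Y y) (W y)) x - lieD W (fun y => β y (X y) (Y y) (Z y)) x
    - β x (bracket X Y x) (Z x) (W x) + β x (bracket X Z x) (Y x) (W x)
    - β x (bracket X W x) (Y x) (Z x) - β x (bracket Y Z x) (X x) (W x)
    + β x (bracket Y W x) (X x) (Z x) - β x (bracket Z W x) (X x) (Y x)

variable [IsManifold 𝓘(ℝ, E8) ∞ M]

/-- A vector field, smooth near `x`, that extends the tangent vector `v` at `x`. The tensors below
are evaluated on tangent vectors through such extensions; they do not depend on the extension. -/
def ext {x : M} (v : TangentSpace 𝓘(ℝ, E8) x) : Π y : M, TangentSpace 𝓘(ℝ, E8) y :=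
  FiberBundle.extend E8 v

/-- Exterior derivative of a 1-form, on tangent vectors. -/
def extD₁ (α : Π x : M, TangentSpace 𝓘(ℝ, E8) x → ℝ) (x : M)
    (u v : TangentSpace 𝓘(ℝ, E8) x) : ℝ :=
  d₁ α (ext u) (ext v) x

/-- Exterior derivative of a 3-form, on tangent vectors. -/
def extD₃ (β : Π x : M, TangentSpace 𝓘(ℝ, E8) x → TangentSpace 𝓘(ℝ, E8) x →
      TangentSpace 𝓘(ℝ, E8) x → ℝ) (x : M)
    (u v w z : TangentSpace 𝓘(ℝ, E8) x) : ℝ :=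
  d₃ β (ext u) (ext v) (ext w) (ext z) x

variable [Bundle.RiemannianBundle (fun x : M => TangentSpace 𝓘(ℝ, E8) x)]

/-- A `Spin(7)`-structure on a Riemannian 8-manifold `(M, g)`: a 4-form `Φ` such that near every
point there is a smooth `g`-orthonormal frame in which `Φ` is the standard 4-form. As the metric
makes these frames orthonormal, it is the metric induced by `Φ`. -/
def IsSpin7Structure (Φ : Π x : M, TangentSpace 𝓘(ℝ, E8) x [⋀^Fin 4]→ₗ[ℝ] ℝ) : Prop :=
  ∀ x : M, ∃ U : Set M, IsOpen U ∧ x ∈ U ∧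
    ∃ e : Fin 8 → Π y : M, TangentSpace 𝓘(ℝ, E8) y,
      IsLocalFrameOn 𝓘(ℝ, E8) E8 ∞ e U ∧
      (∀ y ∈ U, Orthonormal ℝ (fun i => e i y)) ∧
      ∀ y ∈ U, ∀ J : Fin 4 → Fin 8, Φ y (fun r => e (J r) y) = (stdCoeff J : ℝ)

/-- An orthonormal basis of the tangent space at `x`. It is only used in contractions with the
metric, which do not depend on its choice. -/
def onb (x : M) : OrthonormalBasis (Fin 8) ℝ (TangentSpace 𝓘(ℝ, E8) x) :=
  haveI : FiniteDimensional ℝ (TangentSpace 𝓘(ℝ, E8) x) := inferInstanceAs (FiniteDimensional ℝ E8)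
  (stdOrthonormalBasis ℝ (TangentSpace 𝓘(ℝ, E8) x)).reindex
    (finCongr (show Module.finrank ℝ E8 = 8 from finrank_euclideanSpace_fin))

/-! ### The Levi-Civita connection -/

/-- The right-hand side of the Koszul formula for `g(∇ᵍ_X Y, Z)`. -/
def koszul (X Y Z : Π x : M, TangentSpace 𝓘(ℝ, E8) x) (x : M) : ℝ :=
  (1 / 2) * (lieD X (fun y => inner ℝ (Y y) (Z y)) x + lieD Y (fun y => inner ℝ (X y) (Z y)) x
    - lieD Z (fun y => inner ℝ (X y) (Y y)) x + inner ℝ (bracket X Y x) (Z x)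
    - inner ℝ (bracket X Z x) (Y x) - inner ℝ (bracket Y Z x) (X x))

/-- The Levi-Civita connection `∇ᵍ_X Y`. -/
def leviCivita (X Y : Π x : M, TangentSpace 𝓘(ℝ, E8) x) (x : M) : TangentSpace 𝓘(ℝ, E8) x :=
  ∑ i, koszul X Y (ext (onb x i)) x • onb x i

/-- The covariant derivative `(∇ᵍ_X Φ)(Y₀, Y₁, Y₂, Y₃)` of a 4-form. -/
def leviCivitaForm (Φ : Π x : M, TangentSpace 𝓘(ℝ, E8) x [⋀^Fin 4]→ₗ[ℝ] ℝ)
    (X : Π x : M, TangentSpace 𝓘(ℝ, E8) x) (Y : Fin 4 → Π x : M, TangentSpace 𝓘(ℝ, E8) x)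
    (x : M) : ℝ :=
  lieD X (fun y => Φ y (fun r => Y r y)) x
    - ∑ s, Φ x (Function.update (fun r => Y r x) s (leviCivita X (Y s) x))

/-! ### Codifferential, Lee form and torsion -/

/-- The codifferential `δΦ` of a 4-form,
`(δΦ)(u, v, w) = - ∑ₐ (∇ᵍ_{eₐ} Φ)(eₐ, u, v, w)`. -/
def codiff (Φ : Π x : M, TangentSpace 𝓘(ℝ, E8) x [⋀^Fin 4]→ₗ[ℝ] ℝ) (x : M)
    (u v w : TangentSpace 𝓘(ℝ, E8) x) : ℝ :=
  - ∑ a, leviCivitaForm Φ (ext (onb x a)) ![ext (onb x a), ext u, ext v, ext w] x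

/-- The Lee form, `θ_a = (1/42) (δΦ)_{ijk} Φ_{ijka}`. -/
def leeForm (Φ : Π x : M, TangentSpace 𝓘(ℝ, E8) x [⋀^Fin 4]→ₗ[ℝ] ℝ) (x : M)
    (v : TangentSpace 𝓘(ℝ, E8) x) : ℝ :=
  (1 / 42) * ∑ i, ∑ j, ∑ k,
    codiff Φ x (onb x i) (onb x j) (onb x k) * Φ x ![onb x i, onb x j, onb x k, v]

/-- The torsion 3-form, `T = δΦ + (7/6) θ ⌟ Φ`. -/
def torsionForm (Φ : Π x : M, TangentSpace 𝓘(ℝ, E8) x [⋀^Fin 4]→ₗ[ℝ] ℝ) (x : M)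
    (u v w : TangentSpace 𝓘(ℝ, E8) x) : ℝ :=
  codiff Φ x u v w + (7 / 6) * ∑ s, leeForm Φ x (onb x s) * Φ x ![onb x s, u, v, w]

/-! ### The torsion connection and its curvature -/

/-- The `Spin(7)`-torsion connection `∇_X Y`, with `g(∇_X Y, Z) = g(∇ᵍ_X Y, Z) + (1/2) T(X, Y, Z)`:
the metric connection with totally skew-symmetric torsion `T`. -/
def nabla (Φ : Π x : M, TangentSpace 𝓘(ℝ, E8) x [⋀^Fin 4]→ₗ[ℝ] ℝ)
    (X Y : Π x : M, TangentSpace 𝓘(ℝ, E8) x) (x : M) : TangentSpace 𝓘(ℝ, E8) x :=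
  leviCivita X Y x + ∑ i, ((1 / 2) * torsionForm Φ x (X x) (Y x) (onb x i)) • onb x i

/-- The curvature `R(X, Y)Z = ∇_X ∇_Y Z - ∇_Y ∇_X Z - ∇_{[X, Y]} Z` of the torsion connection. -/
def curvature (Φ : Π x : M, TangentSpace 𝓘(ℝ, E8) x [⋀^Fin 4]→ₗ[ℝ] ℝ)
    (X Y Z : Π x : M, TangentSpace 𝓘(ℝ, E8) x) (x : M) : TangentSpace 𝓘(ℝ, E8) x :=
  nabla Φ X (nabla Φ Y Z) x - nabla Φ Y (nabla Φ X Z) x - nabla Φ (bracket X Y) Z x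

/-- The Ricci tensor of the torsion connection, `Ric(u, v) = ∑ₐ g(R(eₐ, u)v, eₐ)`. -/
def ricci (Φ : Π x : M, TangentSpace 𝓘(ℝ, E8) x [⋀^Fin 4]→ₗ[ℝ] ℝ) (x : M)
    (u v : TangentSpace 𝓘(ℝ, E8) x) : ℝ :=
  ∑ a, inner ℝ (curvature Φ (ext (onb x a)) (ext u) (ext v) x) (onb x a)

/-- The covariant derivative `(∇_u θ)(v)` of the Lee form for the torsion connection. -/
def nablaLee (Φ : Π x : M, TangentSpace 𝓘(ℝ, E8) x [⋀^Fin 4]→ₗ[ℝ] ℝ) (x : M)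
    (u v : TangentSpace 𝓘(ℝ, E8) x) : ℝ :=
  lieD (ext u) (fun y => leeForm Φ y (ext v y)) x - leeForm Φ x (nabla Φ (ext u) (ext v) x)

/-- The 2-form `β` at `x` lies in `Λ²₂₁ ≅ spin(7)`: `β_{ij} Φ_{ijkl} = 2 β_{kl}`. -/
def MemLambda21 (Φ : Π x : M, TangentSpace 𝓘(ℝ, E8) x [⋀^Fin 4]→ₗ[ℝ] ℝ) (x : M)
    (β : TangentSpace 𝓘(ℝ, E8) x → TangentSpace 𝓘(ℝ, E8) x → ℝ) : Prop :=
  ∀ u v : TangentSpace 𝓘(ℝ, E8) x,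
    ∑ i, ∑ j, β (onb x i) (onb x j) * Φ x ![onb x i, onb x j, u, v] = 2 * β u v

end Manifold

end Spin7

end

/-! In an orthonormal frame adapted to `Φ` the components of `Φ` are the constants `phi i j k l`.
Hence `δΦ`, `θ` and `T` are algebraic expressions in the Levi-Civita coefficients, and the
contraction identities of `phi` show that the connection matrices of `∇` lie in `spin(7) = Λ²₂₁`
(`mem21_add_torsionArr`).

The curvature `R_{ijkl}` therefore lies in `Λ²₂₁` in its last two indices (`mem21_curvArr`).
Inserting this in the trace gives `2 Ric_{jk} = -R_{jabc} φ_{kabc}`, which involves only the cyclic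
sum of `R` over its last three indices. The Bianchi identity `curvArr_cyclic` says that this cyclic
sum is `½ dT + ∇T`. As `∇Φ = 0`, contracting `∇T` with `φ` gives `7 ∇θ`. The outcome is the
pointwise identity `Ric_{jk} + (7/6) ∇_j θ_k = -(1/12) (dT)_{jabc} φ_{kabc}` (`ricArr_eq`), from
which a) implies b) without compactness.

Conversely, b) says that the contraction `(dT)_{jabc} φ_{kabc}` vanishes. Under `Spin(7)`, `Λ⁴`
splits into pieces of dimension 1, 7, 27 and 35, and the kernel of this contraction is the piece of
dimension 27, which consists of self-dual forms. The self-duality is proved here by solving the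
linear system (`selfDual_of_contr₃_eq_zero`). Up to a positive constant, `∫ |dT|² = ∫ dT ∧ dT = ∫
d(T ∧ dT) = 0` on a compact manifold, so `dT = 0`. The argument is run in charts, with a partition
of unity `ρ_i`: Stokes' theorem for `ρ_i T ∧ dT` relates the integral of `ρ_i |dT|²` to that of
`⟨dρ_i ∧ T, dT⟩`, and the latter terms cancel in the sum because `∑ dρ_i = 0`
(`IsSpin7Structure.energyFn_eq_zero`). Integrals use the Riemannian density, so only a local choice
of orientation is needed.

For the last claim let `dT = 0`. The trace of the Bianchi identity makes the divergence of `T` the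
skew part of `Ric`, hence a multiple of the skew part of `∇θ`. The skew part of `(dT)_{jabc}
φ_{kabc} = 0` then becomes the equation that places `dθ` in `Λ²₂₁`; its terms quadratic in `T` are
handled by `quadratic_torsion_skew`. -/

noncomputable section

namespace Spin7

/-! ### The coefficients of the standard 4-form -/

/-- The value `x` if `a = b`, and `0` otherwise. -/
def gate (a b : Fin 8) (x : ℤ) : ℤ := if a = b then x else 0

/-- The Kronecker symbol. -/
def ind (a b : Fin 8) : ℤ := if a = b then 1 else 0

theorem gate_eq (a b : Fin 8) (x : ℤ) : gate a b x = ind a b * x := by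
  unfold gate ind; split_ifs <;> simp

/-- The `2 × 2` minor of an indicator matrix, expanded. -/
def minor₂ (a b j k : Fin 8) : ℤ := gate a j (gate b k 1) - gate a k (gate b j 1)

/-- The `3 × 3` minor of an indicator matrix, expanded. -/
def minor₃ (a b c j k l : Fin 8) : ℤ :=
  gate a j (minor₂ b c k l) - gate a k (minor₂ b c j l) + gate a l (minor₂ b c j k)

/-- The `4 × 4` minor of an indicator matrix, expanded. -/
def minor₄ (a b c d i j k l : Fin 8) : ℤ :=
  gate a i (minor₃ b c d j k l) - gate a j (minor₃ b c d i k l) + gate a k (minor₃ b c d i j l)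
    - gate a l (minor₃ b c d i j k)

theorem det_indicator (t : Fin 4 → Fin 8) (i j k l : Fin 8) :
    Matrix.det (Matrix.of fun r s : Fin 4 => if t r = ![i, j, k, l] s then (1 : ℤ) else 0)
      = minor₄ (t 0) (t 1) (t 2) (t 3) i j k l := by
  change Matrix.det (Matrix.of fun r s : Fin 4 => ind (t r) (![i, j, k, l] s)) = _
  simp only [minor₄, minor₃, minor₂, gate_eq, Matrix.det_succ_row_zero, Fin.sum_univ_succ]
  simp [Fin.succAbove]
  ring

/-- The labelling of `Fin 8` by the points of the affine space `𝔽₂³` for which the monomials of the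
standard 4-form are the affine planes. -/
def label (i : Fin 8) : ℕ := 8059016 >>> (3 * i.val) % 8

/-- The coefficients of the standard 4-form, in a form suited to evaluation: they vanish off the
affine planes, and the bits of a numeral store the signs. -/
def stdFast (i j k l : Fin 8) : ℤ :=
  if label i ^^^ label j ^^^ label k = label l then
    if i = j then 0 else if i = k then 0 else if j = k then 0 else
    if Nat.testBit
      9022034459589262898323018378082499344992248896358142447308908074342815608149090561843293855432580643991562576914716108309913842714881242349826257996800
      (64 * i.val + 8 * j.val + k.val) then -1 else 1
  else 0

/-- A finite check on 8⁴ quadruples. Expanded minors replace determinants here so that the kernel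
can evaluate both sides cheaply. -/
theorem stdMinor_eq_stdFast : ∀ i j k l : Fin 8,
    -minor₄ 0 1 2 7 i j k l + minor₄ 0 2 3 6 i j k l - minor₄ 0 3 4 7 i j k l
      - minor₄ 0 5 6 7 i j k l + minor₄ 0 1 4 6 i j k l + minor₄ 0 2 4 5 i j k l
      - minor₄ 0 1 3 5 i j k l - minor₄ 3 4 5 6 i j k l - minor₄ 1 4 5 7 i j k l
      - minor₄ 1 2 5 6 i j k l - minor₄ 1 2 3 4 i j k l - minor₄ 2 3 5 7 i j k l
      - minor₄ 1 3 6 7 i j k l + minor₄ 2 4 6 7 i j k l = stdFast i j k l := by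
  decide +kernel

theorem stdCoeff_eq (i j k l : Fin 8) : stdCoeff ![i, j, k, l] = stdFast i j k l := by
  rw [← stdMinor_eq_stdFast]
  simp only [stdCoeff, stdTerms, det_indicator, List.map_cons, List.map_nil, List.sum_cons,
    List.sum_nil, Matrix.cons_val]
  ring

theorem stdFast_swap₀₁ : ∀ i j k l, stdFast j i k l = -stdFast i j k l := by decide +kernel

theorem stdFast_swap₁₂ : ∀ i j k l, stdFast i k j l = -stdFast i j k l := by decide +kernel

theorem stdFast_swap₂₃ : ∀ i j k l, stdFast i j l k = -stdFast i j k l := by decide +kernel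

/-- The basic identity of the `Spin(7)` form, from which all other contractions follow. Only pairs
of increasing triples are enumerated, 56² cases instead of 8⁶; skewness supplies the rest in
`phi_contract`. -/
theorem stdFast_contract : ∀ i j : Fin 8, i < j → ∀ k, j < k → ∀ l m : Fin 8, l < m → ∀ n, m < n →
    stdFast i j k 0 * stdFast l m n 0 + stdFast i j k 1 * stdFast l m n 1
      + stdFast i j k 2 * stdFast l m n 2 + stdFast i j k 3 * stdFast l m n 3
      + stdFast i j k 4 * stdFast l m n 4 + stdFast i j k 5 * stdFast l m n 5
      + stdFast i j k 6 * stdFast l m n 6 + stdFast i j k 7 * stdFast l m n 7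
    = minor₃ i j k l m n
      - (gate i l (stdFast j k m n) + gate i m (stdFast j k n l) + gate i n (stdFast j k l m)
        + gate j l (stdFast k i m n) + gate j m (stdFast k i n l) + gate j n (stdFast k i l m)
        + gate k l (stdFast i j m n) + gate k m (stdFast i j n l) + gate k n (stdFast i j l m)) := by
  decide +kernel

/-- The coefficients of the standard 4-form as real numbers. -/
def phi (i j k l : Fin 8) : ℝ := (stdCoeff ![i, j, k, l] : ℝ)

theorem phi_eq (i j k l : Fin 8) : phi i j k l = (stdFast i j k l : ℝ) := by
  rw [phi, stdCoeff_eq]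

theorem phi_swap₀₁ (i j k l : Fin 8) : phi j i k l = -phi i j k l := by
  simp only [phi_eq]; exact_mod_cast stdFast_swap₀₁ i j k l

theorem phi_swap₁₂ (i j k l : Fin 8) : phi i k j l = -phi i j k l := by
  simp only [phi_eq]; exact_mod_cast stdFast_swap₁₂ i j k l

theorem phi_swap₂₃ (i j k l : Fin 8) : phi i j l k = -phi i j k l := by
  simp only [phi_eq]; exact_mod_cast stdFast_swap₂₃ i j k l

/-- The Kronecker symbol with real values. -/
def kron (i j : Fin 8) : ℝ := if i = j then 1 else 0

theorem kron_self (i : Fin 8) : kron i i = 1 := if_pos rfl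

theorem ind_cast (i j : Fin 8) : (ind i j : ℝ) = kron i j := by simp [ind, kron]

theorem sum_kron_mul (i : Fin 8) (f : Fin 8 → ℝ) : ∑ j, kron i j * f j = f i := by simp [kron]

theorem sum_mul_kron (i : Fin 8) (f : Fin 8 → ℝ) : ∑ j, f j * kron i j = f i := by simp [kron]

theorem sum_kron_mul' (i : Fin 8) (f : Fin 8 → ℝ) : ∑ j, kron j i * f j = f i := by simp [kron]

theorem sum_mul_kron' (i : Fin 8) (f : Fin 8 → ℝ) : ∑ j, f j * kron j i = f i := by simp [kron]

/-- A skew function of three indices that vanishes on increasing triples is zero. -/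
theorem eq_zero_of_skew {F : Fin 8 → Fin 8 → Fin 8 → ℝ} (h₁ : ∀ i j k, F j i k = -F i j k)
    (h₂ : ∀ i j k, F i k j = -F i j k) (h : ∀ i j k, i < j → j < k → F i j k = 0)
    (i j k : Fin 8) : F i j k = 0 := by
  have d₁ (i k) : F i i k = 0 := by linarith [h₁ i i k]
  have d₂ (i k) : F i k k = 0 := by linarith [h₂ i k k]
  have d₃ (i k) : F i k i = 0 := by linarith [h₂ i k i, d₁ i k]
  rcases eq_or_ne i j with rfl | hij
  · exact d₁ i k
  rcases eq_or_ne i k with rfl | hik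
  · exact d₃ i j
  rcases eq_or_ne j k with rfl | hjk
  · exact d₂ i j
  rcases hij.lt_or_gt with hij | hij <;> rcases hjk.lt_or_gt with hjk | hjk <;>
    rcases hik.lt_or_gt with hik | hik
  · exact h i j k hij hjk
  · omega
  · linarith [h₂ i j k, h i k j hik hjk]
  · linarith [h₂ i j k, h₁ i k j, h k i j hik hij]
  · linarith [h₁ i j k, h j i k hij hik]
  · linarith [h₁ i j k, h₂ j i k, h j k i hjk hik]
  · omega
  · linarith [h₁ i j k, h₂ j i k, h₁ j k i, h k j i hjk hij]

theorem kron_mul_cast (i j : Fin 8) (x : ℤ) : ((gate i j x : ℤ) : ℝ) = kron i j * x := by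
  rw [gate_eq, Int.cast_mul, ind_cast]

/-- The contraction of two copies of the standard 4-form over one index. -/
def phiContraction (i j k l m n : Fin 8) : ℝ :=
  kron i l * (kron j m * kron k n - kron j n * kron k m)
    - kron i m * (kron j l * kron k n - kron j n * kron k l)
    + kron i n * (kron j l * kron k m - kron j m * kron k l)
    - (kron i l * phi j k m n + kron i m * phi j k n l + kron i n * phi j k l m
      + kron j l * phi k i m n + kron j m * phi k i n l + kron j n * phi k i l m
      + kron k l * phi i j m n + kron k m * phi i j n l + kron k n * phi i j l m)

theorem phi_contract (i j k l m n : Fin 8) :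
    ∑ a, phi i j k a * phi l m n a = phiContraction i j k l m n := by
  rw [← sub_eq_zero]
  have s₁ := phi_swap₀₁
  have s₂ := phi_swap₁₂
  have s₃ := phi_swap₂₃
  refine eq_zero_of_skew
    (F := fun i j k => ∑ a, phi i j k a * phi l m n a - phiContraction i j k l m n) ?_ ?_ ?_ i j k
  · intro i j k
    simp only [s₁ i j, neg_mul, Finset.sum_neg_distrib, phiContraction]
    rw [s₁ j k m n, s₁ j k n l, s₁ j k l m, s₁ k i m n, s₁ k i n l, s₁ k i l m]
    ring
  · intro i j k
    simp only [s₂ i j k, neg_mul, Finset.sum_neg_distrib, phiContraction]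
    rw [s₁ j k m n, s₁ j k n l, s₁ j k l m, s₁ i j m n, s₁ i j n l, s₁ i j l m,
      s₁ k i m n, s₁ k i n l, s₁ k i l m]
    ring
  · intro i j k hij hjk
    refine eq_zero_of_skew
      (F := fun l m n => ∑ a, phi i j k a * phi l m n a - phiContraction i j k l m n)
      ?_ ?_ ?_ l m n
    · intro l m n
      simp only [s₁ l m, mul_neg, Finset.sum_neg_distrib, phiContraction]
      rw [s₃ j k m l, s₃ k i m l, s₃ i j m l, s₃ j k n l, s₃ k i n l, s₃ i j n l,
        s₃ j k m n, s₃ k i m n, s₃ i j m n]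
      ring
    · intro l m n
      simp only [s₂ l m n, mul_neg, Finset.sum_neg_distrib, phiContraction]
      rw [s₃ j k m l, s₃ k i m l, s₃ i j m l, s₃ j k n l, s₃ k i n l, s₃ i j n l,
        s₃ j k m n, s₃ k i m n, s₃ i j m n]
      ring
    · intro l m n hlm hmn
      have h := congrArg (Int.cast : ℤ → ℝ) (stdFast_contract i j hij k hjk l m hlm n hmn)
      simp only [minor₃, minor₂] at h
      push_cast [kron_mul_cast] at h
      simp only [← phi_eq] at h
      rw [Fin.sum_univ_eight, h, phiContraction]
      ring

/-! ### Iterated contractions of the standard 4-form -/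

theorem sum_pull₂ (f : Fin 8 → Fin 8 → Fin 8 → ℝ) :
    ∑ i, ∑ j, ∑ s, f i j s = ∑ s, ∑ i, ∑ j, f i j s := by
  simp_rw [Finset.sum_comm (f := f _)]
  exact Finset.sum_comm

theorem sum_pull₃ (f : Fin 8 → Fin 8 → Fin 8 → Fin 8 → ℝ) :
    ∑ i, ∑ j, ∑ k, ∑ s, f i j k s = ∑ s, ∑ i, ∑ j, ∑ k, f i j k s := by
  simp_rw [sum_pull₂ (f _)]
  exact Finset.sum_comm

theorem sum_comm₂₂ (f : Fin 8 → Fin 8 → Fin 8 → Fin 8 → ℝ) :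
    ∑ i, ∑ j, ∑ k, ∑ s, f i j k s = ∑ k, ∑ s, ∑ i, ∑ j, f i j k s := by
  rw [sum_pull₃, sum_pull₃]

theorem phi_pair (i j k l : Fin 8) : phi k l i j = phi i j k l := by
  rw [phi_swap₁₂ k i l j, phi_swap₀₁ i k l j, phi_swap₂₃ i k j l, phi_swap₁₂ i j k l]; ring

theorem phi_cyc₃ (i j k l : Fin 8) : phi j k i l = phi i j k l := by
  rw [phi_swap₁₂ j i k l, phi_swap₀₁ i j k l]; ring

theorem phi_cyc₃' (i j k l : Fin 8) : phi i k l j = phi i j k l := by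
  rw [phi_swap₂₃ i k j l, phi_swap₁₂ i j k l]; ring

theorem phi_cyc₄ (i j k l : Fin 8) : phi l i j k = -phi i j k l := by
  rw [phi_swap₀₁ i l j k, ← phi_cyc₃' i l j k]

theorem phi_self₀₁ (i k l : Fin 8) : phi i i k l = 0 := by linarith [phi_swap₀₁ i i k l]

theorem phi_self₁₂ (i k l : Fin 8) : phi k i i l = 0 := by linarith [phi_swap₁₂ k i i l]

theorem phi_self₀₂ (i k l : Fin 8) : phi i k i l = 0 := by
  rw [phi_swap₁₂, phi_self₀₁, neg_zero]

theorem phi_self₁₃ (i k l : Fin 8) : phi k i l i = 0 := by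
  rw [phi_swap₂₃, phi_self₁₂, neg_zero]

theorem phi_self₀₃ (i k l : Fin 8) : phi i k l i = 0 := by
  rw [phi_swap₂₃, phi_self₀₂, neg_zero]

/-- On skew matrices the operator `P α = α_{ab} φ_{abij}` thus satisfies `P² = 12 - 4P`. Its
eigenvalues are 2 and -6, and the eigenspace for 2 is `Λ²₂₁`. -/
theorem phi_contract₂ (i j k l : Fin 8) :
    ∑ a, ∑ b, phi i j a b * phi k l a b
      = 6 * (kron i k * kron j l - kron i l * kron j k) - 4 * phi i j k l := by
  simp only [phi_contract, phiContraction]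
  simp [kron, mul_sub, Finset.sum_add_distrib, Finset.sum_sub_distrib, phi_self₁₂, phi_self₀₂,
    phi_self₁₃, phi_self₀₃]
  rw [phi_swap₀₁ i j k l, phi_swap₂₃ i j k l]
  split_ifs <;> ring

theorem phi_contract₃ (i j : Fin 8) :
    ∑ a, ∑ b, ∑ c, phi i a b c * phi j a b c = 42 * kron i j := by
  simp only [phi_contract₂]
  simp [kron, mul_sub, Finset.sum_sub_distrib, phi_self₁₃]
  split_ifs <;> norm_num

/-- The contraction `T_{abi} φ_{abjk}`. -/
def contr₂ (T : Fin 8 → Fin 8 → Fin 8 → ℝ) (i j k : Fin 8) : ℝ :=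
  ∑ a, ∑ b, T a b i * phi a b j k

/-- The contraction `T_{abc} φ_{iabc}`. -/
def contr₃ (T : Fin 8 → Fin 8 → Fin 8 → ℝ) (i : Fin 8) : ℝ :=
  ∑ a, ∑ b, ∑ c, T a b c * phi i a b c

/-- Both factors `phi` share one index, so `phi_contract` applies. Its Kronecker terms give the
cyclic sum of `Γ`. The remaining terms differ in whether the free index sits in the first slot of
`Γ` or in the skew pair, the latter giving `contr₂`. -/
theorem contr₃_phi_of_skew {Γ : Fin 8 → Fin 8 → Fin 8 → ℝ} (hΓ : ∀ i j k, Γ i k j = -Γ i j k)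
    (i j k : Fin 8) :
    ∑ s, contr₃ Γ s * phi s i j k
      = 2 * (Γ i j k + Γ j k i + Γ k i j)
        - (∑ a, ∑ b, Γ i a b * phi a b j k + ∑ a, ∑ b, Γ j a b * phi a b k i
          + ∑ a, ∑ b, Γ k a b * phi a b i j)
        - 2 * (contr₂ Γ i j k + contr₂ Γ j k i + contr₂ Γ k i j) := by
  have h : ∑ s, contr₃ Γ s * phi s i j k
      = ∑ a, ∑ b, ∑ c, Γ a b c * phiContraction a b c i j k := by
    simp only [contr₃, Finset.sum_mul, ← phi_contract, Finset.mul_sum]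
    rw [← sum_pull₃]
    refine Finset.sum_congr rfl fun a _ => Finset.sum_congr rfl fun b _ =>
      Finset.sum_congr rfl fun c _ => Finset.sum_congr rfl fun s _ => ?_
    rw [phi_cyc₄ a b c s, phi_cyc₄ i j k s]
    ring
  have e₂ (i j k : Fin 8) : ∑ x, ∑ y, Γ x i y * phi y x j k = contr₂ Γ i j k :=
    Finset.sum_congr rfl fun x _ => Finset.sum_congr rfl fun y _ => by
      rw [hΓ x y i, phi_swap₀₁ x y]; ring
  have e₃ (i j k : Fin 8) : ∑ x, ∑ y, Γ x y i * phi x y j k = contr₂ Γ i j k := rfl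
  rw [h]
  simp only [phiContraction]
  simp [kron, mul_sub, mul_add, Finset.sum_add_distrib, Finset.sum_sub_distrib]
  rw [e₂, e₂, e₂, e₃, e₃, e₃, hΓ i j k, hΓ j k i, hΓ k i j]
  ring

theorem contr₂_of_skew {T : Fin 8 → Fin 8 → Fin 8 → ℝ} (h₁ : ∀ i j k, T j i k = -T i j k)
    (h₂ : ∀ i j k, T i k j = -T i j k) (i j k : Fin 8) :
    ∑ a, ∑ b, T i a b * phi a b j k = contr₂ T i j k :=
  Finset.sum_congr rfl fun x _ => Finset.sum_congr rfl fun y _ => by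
    rw [h₁ x i y, h₂ x y i]; ring

/-- For a 3-form it no longer matters which slots are contracted, so the two kinds of terms in
`contr₃_phi_of_skew` merge. The identity is applied below to `T` and to its covariant derivatives.
-/
theorem contr₃_phi {T : Fin 8 → Fin 8 → Fin 8 → ℝ} (h₁ : ∀ i j k, T j i k = -T i j k)
    (h₂ : ∀ i j k, T i k j = -T i j k) (i j k : Fin 8) :
    ∑ s, contr₃ T s * phi s i j k
      = 6 * T i j k - 3 * (contr₂ T i j k + contr₂ T j k i + contr₂ T k i j) := by
  rw [contr₃_phi_of_skew h₂, contr₂_of_skew h₁ h₂, contr₂_of_skew h₁ h₂, contr₂_of_skew h₁ h₂]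
  linear_combination 2 * h₂ j i k - 2 * h₁ i j k + 2 * h₁ i k j - 2 * h₂ i j k

/-! ### The torsion of a metric connection without torsion, in an adapted frame -/

section Torsion

variable (Γ : Fin 8 → Fin 8 → Fin 8 → ℝ)

/-- The trace `Γ_{ppi}`. -/
def trace₁₂ (i : Fin 8) : ℝ := ∑ p, Γ p p i

/-- The codifferential of the standard form for the connection with coefficients `Γ`. -/
def codiffArr (k l m : Fin 8) : ℝ :=
  ∑ p, ∑ s, (Γ p p s * phi s k l m + Γ p k s * phi p s l m + Γ p l s * phi p k s m
    + Γ p m s * phi p k l s)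

/-- The Lee form of the standard form for the connection with coefficients `Γ`. -/
def leeArr (a : Fin 8) : ℝ := (1 / 42) * ∑ i, ∑ j, ∑ k, codiffArr Γ i j k * phi i j k a

/-- The torsion of the standard form for the connection with coefficients `Γ`. -/
def torsionArr (k l m : Fin 8) : ℝ :=
  codiffArr Γ k l m + (7 / 6) * ∑ s, leeArr Γ s * phi s k l m

variable {Γ}

/-- The connection acting on the slot that is traced yields `trace₁₂`; acting on each of the other
three slots it yields one `contr₂`. -/
theorem codiffArr_eq (hΓ : ∀ i j k, Γ i k j = -Γ i j k) (k l m : Fin 8) :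
    codiffArr Γ k l m = ∑ s, trace₁₂ Γ s * phi s k l m
      - (contr₂ Γ k l m + contr₂ Γ l m k + contr₂ Γ m k l) := by
  simp only [codiffArr, Finset.sum_add_distrib]
  have e₁ (k l m : Fin 8) : ∑ p, ∑ s, Γ p k s * phi p s l m = -contr₂ Γ k l m := by
    simp only [contr₂, ← Finset.sum_neg_distrib]
    exact Finset.sum_congr rfl fun x _ => Finset.sum_congr rfl fun y _ => by rw [hΓ x y k]; ring
  have e₂ : ∑ p, ∑ s, Γ p l s * phi p k s m = -contr₂ Γ l m k := by
    rw [← e₁]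
    exact Finset.sum_congr rfl fun x _ => Finset.sum_congr rfl fun y _ => by rw [phi_cyc₃' x k y m]
  have e₃ : ∑ p, ∑ s, Γ p m s * phi p k l s = -contr₂ Γ m k l := by
    rw [← e₁]
    exact Finset.sum_congr rfl fun x _ => Finset.sum_congr rfl fun y _ => by
      rw [phi_cyc₃' x y k l]
  rw [e₁, e₂, e₃, Finset.sum_comm]
  simp only [trace₁₂, Finset.sum_mul]
  ring

/-- The three `contr₂` terms of `codiffArr_eq` contribute equally, as `phi` is invariant under
cyclic permutations of three indices, and each is evaluated by `phi_contract₂`. The constant is `2/7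
= 12/42`. -/
theorem leeArr_eq (hΓ : ∀ i j k, Γ i k j = -Γ i j k) (a : Fin 8) :
    leeArr Γ a = (2 / 7) * (-contr₃ Γ a - 2 * trace₁₂ Γ a) := by
  have e₀ : ∑ i, ∑ j, ∑ k, (∑ s, trace₁₂ Γ s * phi s i j k) * phi i j k a = -42 * trace₁₂ Γ a := by
    have : ∑ s, trace₁₂ Γ s * (-(∑ i, ∑ j, ∑ k, phi s i j k * phi a i j k)) = -42 * trace₁₂ Γ a := by
      simp only [phi_contract₃, mul_neg, Finset.sum_neg_distrib]
      simp [kron]; ring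
    rw [← this]
    simp only [Finset.mul_sum, Finset.sum_mul, ← Finset.sum_neg_distrib, phi_cyc₄ _ _ _ a]
    rw [sum_pull₃]
    refine Finset.sum_congr rfl fun s _ => Finset.sum_congr rfl fun i _ =>
      Finset.sum_congr rfl fun j _ => Finset.sum_congr rfl fun k _ => by ring
  have e₁ : ∑ i, ∑ j, ∑ k, contr₂ Γ i j k * phi i j k a = -6 * trace₁₂ Γ a + 4 * contr₃ Γ a := by
    have : ∑ i, ∑ p, ∑ q, Γ p q i * (∑ j, ∑ k, phi p q j k * phi i a j k)
        = -6 * trace₁₂ Γ a + 4 * contr₃ Γ a := by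
      simp only [phi_contract₂]
      simp [kron, mul_sub, Finset.sum_sub_distrib]
      have t₁ : ∑ x, Γ x a x * 6 = -6 * trace₁₂ Γ a := by
        rw [trace₁₂, Finset.mul_sum]
        exact Finset.sum_congr rfl fun x _ => by rw [hΓ x x a]; ring
      have t₂ : ∑ x, Γ a x x * 6 = 0 :=
        Finset.sum_eq_zero fun x _ => by linarith [hΓ a x x]
      have t₃ : ∑ x, ∑ y, ∑ z, Γ y z x * (4 * phi y z x a) = -4 * contr₃ Γ a := by
        rw [← sum_pull₂]
        simp only [contr₃, Finset.mul_sum]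
        exact Finset.sum_congr rfl fun x _ => Finset.sum_congr rfl fun y _ =>
          Finset.sum_congr rfl fun z _ => by rw [phi_cyc₄ x y z a]; ring
      rw [t₁, t₂, t₃]
      ring
    rw [← this]
    simp only [contr₂, Finset.mul_sum, Finset.sum_mul]
    refine Finset.sum_congr rfl fun i _ => ?_
    rw [sum_comm₂₂]
    refine Finset.sum_congr rfl fun p _ => Finset.sum_congr rfl fun q _ =>
      Finset.sum_congr rfl fun j _ => Finset.sum_congr rfl fun k _ => ?_
    rw [phi_cyc₃' i a j k]
    ring
  have e₂ : ∑ i, ∑ j, ∑ k, contr₂ Γ j k i * phi i j k a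
      = ∑ i, ∑ j, ∑ k, contr₂ Γ i j k * phi i j k a := by
    rw [← sum_pull₂]
    exact Finset.sum_congr rfl fun i _ => Finset.sum_congr rfl fun j _ =>
      Finset.sum_congr rfl fun k _ => by rw [phi_cyc₃ k i j a]
  have e₃ : ∑ i, ∑ j, ∑ k, contr₂ Γ k i j * phi i j k a
      = ∑ i, ∑ j, ∑ k, contr₂ Γ i j k * phi i j k a := by
    rw [sum_pull₂]
    exact Finset.sum_congr rfl fun i _ => Finset.sum_congr rfl fun j _ =>
      Finset.sum_congr rfl fun k _ => by rw [phi_cyc₃ i j k a]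
  simp only [leeArr, codiffArr_eq hΓ, sub_mul, add_mul, Finset.sum_sub_distrib,
    Finset.sum_add_distrib, e₀, e₁, e₂, e₃]
  ring

theorem torsionArr_eq (hΓ : ∀ i j k, Γ i k j = -Γ i j k) (k l m : Fin 8) :
    torsionArr Γ k l m = (1 / 3) * ∑ s, (trace₁₂ Γ s - contr₃ Γ s) * phi s k l m
      - (contr₂ Γ k l m + contr₂ Γ l m k + contr₂ Γ m k l) := by
  simp only [torsionArr, codiffArr_eq hΓ, leeArr_eq hΓ, Finset.mul_sum]
  rw [sub_add_eq_add_sub, ← Finset.sum_add_distrib]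
  congr 1
  exact Finset.sum_congr rfl fun s _ => by ring

/-- Applying `contr₂` to a permuted `contr₂` leaves two factors `phi` with only one common index.
This is the expansion of that product, needed in `contr₂_torsionArr`. -/
theorem sum_mul_phiContraction (hΓ : ∀ i j k, Γ i k j = -Γ i j k) (i j k : Fin 8) :
    ∑ a, ∑ p, ∑ q, Γ p q a * phiContraction i p q j k a
      = -(kron i j * contr₃ Γ k - kron i k * contr₃ Γ j + contr₂ Γ i j k
          + ∑ a, ∑ b, Γ j a b * phi a b i k - ∑ a, ∑ b, Γ k a b * phi a b i j
          - ∑ s, trace₁₂ Γ s * phi s i j k + contr₂ Γ j i k - contr₂ Γ k i j)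
        + (kron i j * trace₁₂ Γ k - kron i k * trace₁₂ Γ j + (Γ j k i - Γ k j i)) := by
  have t₁ (k) : ∑ x, ∑ y, ∑ z, Γ y z x * phi y z k x = contr₃ Γ k := by
    rw [← sum_pull₂]
    exact Finset.sum_congr rfl fun x _ => Finset.sum_congr rfl fun y _ =>
      Finset.sum_congr rfl fun z _ => by rw [phi_swap₂₃ x y z k, phi_cyc₄ x y z k]
  have t₂ (k) : ∑ x, ∑ y, ∑ z, Γ y z x * phi y z x k = -contr₃ Γ k := by
    rw [← t₁, ← Finset.sum_neg_distrib]
    simp only [← Finset.sum_neg_distrib]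
    exact Finset.sum_congr rfl fun x _ => Finset.sum_congr rfl fun y _ =>
      Finset.sum_congr rfl fun z _ => by rw [phi_swap₂₃ y z k x]; ring
  have t₃ : ∑ x, ∑ y, Γ j y x * phi y i k x = ∑ a, ∑ b, Γ j a b * phi a b i k := by
    rw [Finset.sum_comm]
    exact Finset.sum_congr rfl fun x _ => Finset.sum_congr rfl fun y _ => by
      rw [phi_cyc₃' x y i k]
  have t₄ : ∑ x, ∑ y, Γ k y x * phi y i x j = -∑ a, ∑ b, Γ k a b * phi a b i j := by
    rw [Finset.sum_comm]
    simp only [← Finset.sum_neg_distrib]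
    exact Finset.sum_congr rfl fun x _ => Finset.sum_congr rfl fun y _ => by
      rw [phi_swap₁₂ x y i j]; ring
  have t₅ : ∑ x, ∑ y, Γ x y x * phi y i j k = -∑ s, trace₁₂ Γ s * phi s i j k := by
    rw [Finset.sum_comm]
    simp only [trace₁₂, ← Finset.sum_neg_distrib, Finset.sum_mul]
    exact Finset.sum_congr rfl fun x _ => Finset.sum_congr rfl fun y _ => by
      rw [hΓ y y x]; ring
  have t₆ : ∑ x, ∑ y, Γ y j x * phi i y k x = contr₂ Γ j i k := by
    rw [Finset.sum_comm]
    exact Finset.sum_congr rfl fun x _ => Finset.sum_congr rfl fun y _ => by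
      rw [hΓ x y j, phi_swap₀₁ x i k y, phi_cyc₃' x y i k]; ring
  have t₇ : ∑ x, ∑ y, Γ y k x * phi i y x j = -contr₂ Γ k i j := by
    rw [Finset.sum_comm]
    simp only [contr₂, ← Finset.sum_neg_distrib]
    exact Finset.sum_congr rfl fun x _ => Finset.sum_congr rfl fun y _ => by
      rw [hΓ x y k, phi_cyc₃ i x y j]; ring
  have t₈ : ∑ x, ∑ y, Γ y x x * phi i y j k = 0 :=
    Finset.sum_eq_zero fun x _ => Finset.sum_eq_zero fun y _ => by
      rw [show Γ y x x = 0 by linarith [hΓ y x x], zero_mul]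
  have t₉ (k) : ∑ x, Γ k x x = 0 := Finset.sum_eq_zero fun x _ => by linarith [hΓ k x x]
  have t₀ (k) : ∑ x, Γ x k x = -trace₁₂ Γ k := by
    rw [trace₁₂, ← Finset.sum_neg_distrib]
    exact Finset.sum_congr rfl fun x _ => hΓ x x k
  simp only [phiContraction]
  simp [kron, mul_sub, mul_add, Finset.sum_sub_distrib, Finset.sum_add_distrib, t₁, t₂, t₃, t₄, t₅,
    t₆, t₇, t₈, t₉, t₀]
  rw [show ∑ x, ∑ y, Γ x y i * phi x y j k = contr₂ Γ i j k from rfl]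
  split_ifs <;> ring

/-- This is the eigenvalue equation of `Λ²₂₁` for `Γ_i + ½ T_i`, solved for the contraction of `T`.
The weight `7/6` in the torsion is what makes the Kronecker terms in `trace₁₂` and `contr₃` cancel.
-/
theorem contr₂_torsionArr (hΓ : ∀ i j k, Γ i k j = -Γ i j k) (i j k : Fin 8) :
    contr₂ (torsionArr Γ) i j k = 2 * torsionArr Γ i j k + 4 * Γ i j k
      - 2 * ∑ a, ∑ b, Γ i a b * phi a b j k := by
  have e₁ : ∑ a, ∑ b, (∑ s, (trace₁₂ Γ s - contr₃ Γ s) * phi s a b i) * phi a b j k =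
      6 * ((trace₁₂ Γ j - contr₃ Γ j) * kron i k - (trace₁₂ Γ k - contr₃ Γ k) * kron i j)
        - 4 * ∑ s, (trace₁₂ Γ s - contr₃ Γ s) * phi s i j k := by
    trans ∑ s, (trace₁₂ Γ s - contr₃ Γ s) * (∑ a, ∑ b, phi s i a b * phi j k a b)
    · simp only [Finset.mul_sum, Finset.sum_mul]
      rw [sum_pull₂]
      refine Finset.sum_congr rfl fun s _ => Finset.sum_congr rfl fun a _ =>
        Finset.sum_congr rfl fun b _ => ?_
      rw [phi_cyc₃' s i a b, phi_pair j k a b]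
      ring
    · simp only [phi_contract₂, mul_sub, Finset.sum_sub_distrib]
      simp only [kron]
      simp only [mul_left_comm _ (4 : ℝ), ← Finset.mul_sum]
      simp
      split_ifs <;> ring
  have e₂ : ∑ a, ∑ b, contr₂ Γ i a b * phi a b j k =
      6 * (Γ j k i - Γ k j i) - 4 * contr₂ Γ i j k := by
    trans ∑ p, ∑ q, Γ p q i * (∑ a, ∑ b, phi p q a b * phi j k a b)
    · simp only [contr₂, Finset.mul_sum, Finset.sum_mul]
      rw [sum_comm₂₂]
      refine Finset.sum_congr rfl fun p _ => Finset.sum_congr rfl fun q _ =>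
        Finset.sum_congr rfl fun a _ => Finset.sum_congr rfl fun b _ => ?_
      rw [phi_pair j k a b]
      ring
    · simp only [phi_contract₂, mul_sub, Finset.sum_sub_distrib]
      simp only [mul_left_comm _ (4 : ℝ), ← Finset.mul_sum]
      simp [kron, contr₂]
      ring
  have e₃ : ∑ a, ∑ b, contr₂ Γ a b i * phi a b j k =
      -∑ a, ∑ p, ∑ q, Γ p q a * phiContraction i p q j k a := by
    simp only [contr₂, Finset.mul_sum, Finset.sum_mul, ← Finset.sum_neg_distrib, ← phi_contract]
    refine Finset.sum_congr rfl fun a _ => ?_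
    rw [← sum_pull₂]
    refine Finset.sum_congr rfl fun p _ => Finset.sum_congr rfl fun q _ =>
      Finset.sum_congr rfl fun b _ => ?_
    rw [phi_pair j k a b, phi_cyc₄ p q b i]
    ring
  have e₄ : ∑ a, ∑ b, contr₂ Γ b i a * phi a b j k = ∑ a, ∑ b, contr₂ Γ a b i * phi a b j k := by
    rw [Finset.sum_comm]
    simp only [contr₂, Finset.mul_sum, Finset.sum_mul]
    refine Finset.sum_congr rfl fun p _ => Finset.sum_congr rfl fun q _ =>
      Finset.sum_congr rfl fun j _ => Finset.sum_congr rfl fun k _ => ?_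
    rw [phi_swap₂₃ j k q i, phi_swap₀₁ p q]
    ring
  have e₅ : contr₂ (torsionArr Γ) i j k =
      (1 / 3) * (∑ a, ∑ b, (∑ s, (trace₁₂ Γ s - contr₃ Γ s) * phi s a b i) * phi a b j k)
      - ∑ a, ∑ b, contr₂ Γ a b i * phi a b j k - ∑ a, ∑ b, contr₂ Γ b i a * phi a b j k
      - ∑ a, ∑ b, contr₂ Γ i a b * phi a b j k := by
    rw [contr₂]
    simp only [torsionArr_eq hΓ, sub_mul, add_mul, mul_assoc,
      Finset.sum_sub_distrib, Finset.sum_add_distrib, ← Finset.mul_sum]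
    ring
  have e₆ := contr₃_phi_of_skew hΓ i j k
  have e₇ (j i k) : ∑ a, ∑ b, Γ j a b * phi a b i k = -∑ a, ∑ b, Γ j a b * phi a b k i := by
    simp only [← Finset.sum_neg_distrib]
    exact Finset.sum_congr rfl fun x _ => Finset.sum_congr rfl fun y _ => by
      rw [phi_swap₂₃ x y k i]; ring
  have e₈ (j i k) : contr₂ Γ j i k = -contr₂ Γ j k i := by
    simp only [contr₂, ← Finset.sum_neg_distrib]
    exact Finset.sum_congr rfl fun x _ => Finset.sum_congr rfl fun y _ => by
      rw [phi_swap₂₃ x y k i]; ring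
  rw [e₅, e₁, e₂, e₄, e₃, sum_mul_phiContraction hΓ, torsionArr_eq hΓ]
  simp only [sub_mul, Finset.sum_sub_distrib]
  -- The remaining terms `contr₃ Γ s * phi s i j k` are eliminated by `contr₃_phi_of_skew`.
  linear_combination 2 * e₆ - 2 * e₇ j i k - 2 * e₈ j i k + 4 * hΓ k i j

theorem contr₂_swap (Γ : Fin 8 → Fin 8 → Fin 8 → ℝ) (i j k : Fin 8) :
    contr₂ Γ i k j = -contr₂ Γ i j k := by
  simp only [contr₂, ← Finset.sum_neg_distrib]
  exact Finset.sum_congr rfl fun x _ => Finset.sum_congr rfl fun y _ => by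
    rw [phi_swap₂₃ x y j k]; ring

theorem torsionArr_swap₀₁ (hΓ : ∀ i j k, Γ i k j = -Γ i j k) (i j k : Fin 8) :
    torsionArr Γ j i k = -torsionArr Γ i j k := by
  simp only [torsionArr_eq hΓ, phi_swap₁₂ _ i j k, mul_neg, Finset.sum_neg_distrib]
  rw [contr₂_swap Γ j k i, contr₂_swap Γ i j k, contr₂_swap Γ k i j]
  ring

theorem torsionArr_swap₁₂ (hΓ : ∀ i j k, Γ i k j = -Γ i j k) (i j k : Fin 8) :
    torsionArr Γ i k j = -torsionArr Γ i j k := by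
  simp only [torsionArr_eq hΓ, phi_swap₂₃ _ i j k, mul_neg, Finset.sum_neg_distrib]
  rw [contr₂_swap Γ i j k, contr₂_swap Γ k i j, contr₂_swap Γ j k i]
  ring

/-- The codifferential contributes `-42`, the sign coming from moving the free index to the front,
and the Lee term contributes `(7/6) · 42 = 49`. The Lee form can therefore be recovered from `T`
alone. -/
theorem contr₃_torsionArr (i : Fin 8) : contr₃ (torsionArr Γ) i = 7 * leeArr Γ i := by
  have e₁ : contr₃ (codiffArr Γ) i = -42 * leeArr Γ i := by
    rw [leeArr]
    simp only [contr₃, Finset.mul_sum]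
    exact Finset.sum_congr rfl fun a _ => Finset.sum_congr rfl fun b _ =>
      Finset.sum_congr rfl fun c _ => by rw [phi_cyc₄ a b c i]; ring
  have e₂ : ∑ a, ∑ b, ∑ c, (∑ s, leeArr Γ s * phi s a b c) * phi i a b c = 42 * leeArr Γ i := by
    trans ∑ s, leeArr Γ s * ∑ a, ∑ b, ∑ c, phi s a b c * phi i a b c
    · simp only [Finset.mul_sum, Finset.sum_mul]
      rw [sum_pull₃]
      simp only [mul_assoc]
    · simp only [phi_contract₃]
      simp [kron, mul_comm]
  rw [contr₃] at e₁ ⊢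
  simp only [torsionArr, add_mul, mul_assoc, Finset.sum_add_distrib, ← Finset.mul_sum, e₁, e₂]
  ring

end Torsion

/-! ### The subalgebra `spin(7)` -/

/-- The matrix `α` lies in `Λ²₂₁`: `α_{ab} φ_{abij} = 2 α_{ij}`. -/
def Mem21 (α : Fin 8 → Fin 8 → ℝ) : Prop :=
  ∀ i j, ∑ a, ∑ b, α a b * phi a b i j = 2 * α i j

/-- The infinitesimal form of `∇Φ = 0`: adding `½ T` to the Levi-Civita coefficients removes their
`Λ²₇` part. Every later use of `spin(7)` holonomy rests on this. -/
theorem mem21_add_torsionArr {Γ : Fin 8 → Fin 8 → Fin 8 → ℝ} (hΓ : ∀ i j k, Γ i k j = -Γ i j k)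
    (i : Fin 8) : Mem21 fun j k => Γ i j k + (1 / 2) * torsionArr Γ i j k := by
  intro j k
  simp only [add_mul, mul_assoc, Finset.sum_add_distrib, ← Finset.mul_sum]
  rw [contr₂_of_skew (torsionArr_swap₀₁ hΓ) (torsionArr_swap₁₂ hΓ), contr₂_torsionArr hΓ]
  ring

namespace Mem21

variable {α β : Fin 8 → Fin 8 → ℝ}

theorem skew (h : Mem21 α) (i j : Fin 8) : α j i = -α i j := by
  have h₁ := h i j
  have h₂ := h j i
  simp only [phi_swap₂₃ _ _ i j, mul_neg, Finset.sum_neg_distrib] at h₂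
  linarith

theorem add (h : Mem21 α) (h' : Mem21 β) : Mem21 fun i j => α i j + β i j := by
  intro i j
  simp only [add_mul, Finset.sum_add_distrib, h i j, h' i j]
  ring

theorem sub (h : Mem21 α) (h' : Mem21 β) : Mem21 fun i j => α i j - β i j := by
  intro i j
  simp only [sub_mul, Finset.sum_sub_distrib, h i j, h' i j]
  ring

theorem const_mul (h : Mem21 α) (c : ℝ) : Mem21 fun i j => c * α i j := by
  intro i j
  simp only [mul_assoc, ← Finset.mul_sum, h i j]
  ring

theorem sum {α : Fin 8 → Fin 8 → Fin 8 → ℝ} (h : ∀ s, Mem21 (α s)) :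
    Mem21 fun i j => ∑ s, α s i j := by
  intro i j
  simp only [Finset.sum_mul, Finset.mul_sum, ← h _ i j]
  rw [sum_pull₂]

/-- Elements of `Λ²₂₁` annihilate the standard 4-form. -/
theorem stab (h : Mem21 α) (i j k l : Fin 8) :
    ∑ s, (α i s * phi s j k l + α j s * phi i s k l + α k s * phi i j s l
      + α l s * phi i j k s) = 0 := by
  have key (i j k l : Fin 8) : ∑ s, α i s * phi s j k l
      = ∑ s, α j s * phi s i k l + ∑ s, α k s * phi s i l j + ∑ s, α l s * phi s i j k := by
    -- Membership is used backwards: `2 α` is replaced by its contraction with `phi`, which creates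
    -- a product of two `phi` with one common index.
    have e : 2 * ∑ s, α i s * phi s j k l = -∑ a, ∑ b, α a b * phiContraction a b i j k l := by
      simp only [Finset.mul_sum, ← mul_assoc, ← h i _, Finset.sum_mul, ← phi_contract,
        ← Finset.sum_neg_distrib]
      rw [← sum_pull₂]
      refine Finset.sum_congr rfl fun a _ => Finset.sum_congr rfl fun b _ =>
        Finset.sum_congr rfl fun s _ => ?_
      rw [phi_cyc₄ j k l s]
      ring
    have t₂ (j k l) : ∑ x, α x j * phi i x k l = ∑ x, α j x * phi x i k l :=
      Finset.sum_congr rfl fun x _ => by rw [h.skew j x, phi_swap₀₁ x i]; ring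
    have t₃ (k l) : ∑ a, ∑ b, α a b * phi a b k l = 2 * α k l := h k l
    simp only [phiContraction] at e
    simp [kron, mul_sub, mul_add, Finset.sum_add_distrib, Finset.sum_sub_distrib, t₂, t₃] at e
    rw [h.skew k l, h.skew j k, h.skew j l] at e
    split_ifs at e <;> linear_combination (1 / 2) * e
  simp only [Finset.sum_add_distrib]
  have e₁ : ∑ s, α j s * phi i s k l = -∑ s, α j s * phi s i k l := by
    rw [← Finset.sum_neg_distrib]
    exact Finset.sum_congr rfl fun s _ => by rw [phi_swap₀₁ s i]; ring
  have e₂ : ∑ s, α k s * phi i j s l = -∑ s, α k s * phi s i l j := by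
    rw [← Finset.sum_neg_distrib]
    exact Finset.sum_congr rfl fun s _ => by
      rw [phi_swap₂₃ s i j l, phi_cyc₃ s i j l]; ring
  have e₃ : ∑ s, α l s * phi i j k s = -∑ s, α l s * phi s i j k := by
    rw [← Finset.sum_neg_distrib]
    exact Finset.sum_congr rfl fun s _ => by rw [phi_cyc₄ i j k s]; ring
  rw [e₁, e₂, e₃, key i j k l]
  ring

/-- The equation `α · φ = 0` of `stab` is contracted with `β` over two indices. Where `α` acts on
those indices the commutator contracted with `φ` appears; where it acts on the free ones, membership
of `β` gives `2` times the commutator. -/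
theorem commutator (h : Mem21 α) (h' : Mem21 β) :
    Mem21 fun i j => ∑ s, (α i s * β s j - β i s * α s j) := by
  intro k l
  have key : ∑ s, ∑ b, β s b * ∑ a, (α s a * phi a b k l + α b a * phi s a k l
      + α k a * phi s b a l + α l a * phi s b k a) = 0 := by
    simp only [h.stab, mul_zero, Finset.sum_const_zero]
  simp only [Finset.sum_add_distrib, mul_add] at key
  have e₁ : ∑ s, ∑ b, β s b * ∑ a, α s a * phi a b k l
      = -∑ a, ∑ b, (∑ s, α a s * β s b) * phi a b k l := by
    simp only [Finset.mul_sum, Finset.sum_mul, ← Finset.sum_neg_distrib]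
    rw [sum_pull₂, Finset.sum_congr rfl fun a _ => Finset.sum_comm]
    refine Finset.sum_congr rfl fun a _ => Finset.sum_congr rfl fun b _ =>
      Finset.sum_congr rfl fun s _ => by rw [h.skew a s]; ring
  have e₂ : ∑ s, ∑ b, β s b * ∑ a, α b a * phi s a k l
      = ∑ a, ∑ b, (∑ s, β a s * α s b) * phi a b k l := by
    simp only [Finset.mul_sum, Finset.sum_mul]
    refine Finset.sum_congr rfl fun s _ => ?_
    rw [Finset.sum_comm]
    exact Finset.sum_congr rfl fun b _ => Finset.sum_congr rfl fun a _ => by ring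
  have e₃ : ∑ s, ∑ b, β s b * ∑ a, α k a * phi s b a l = 2 * ∑ a, α k a * β a l := by
    simp only [Finset.mul_sum]
    rw [sum_pull₂]
    refine Finset.sum_congr rfl fun a _ => ?_
    rw [mul_left_comm, ← h' a l]
    simp only [Finset.mul_sum]
    exact Finset.sum_congr rfl fun b _ => Finset.sum_congr rfl fun a _ => by ring
  have e₄ : ∑ s, ∑ b, β s b * ∑ a, α l a * phi s b k a = -(2 * ∑ a, β k a * α a l) := by
    simp only [Finset.mul_sum, ← Finset.sum_neg_distrib]
    rw [sum_pull₂]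
    refine Finset.sum_congr rfl fun a _ => ?_
    rw [h.skew l a, ← mul_assoc, ← h' k a]
    simp only [Finset.sum_mul, ← Finset.sum_neg_distrib]
    exact Finset.sum_congr rfl fun b _ => Finset.sum_congr rfl fun a _ => by ring
  rw [e₁, e₂, e₃, e₄] at key
  simp only [Finset.sum_sub_distrib, sub_mul]
  linear_combination -key

end Mem21

/-! ### Curvature and torsion in a frame -/

section Frame

/-- The structure functions `c_{ijk}` of a frame, from the connection coefficients and torsion. -/
def structArr (A T : Fin 8 → Fin 8 → Fin 8 → ℝ) (i j k : Fin 8) : ℝ :=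
  A i j k - A j i k - T i j k

variable (A T : Fin 8 → Fin 8 → Fin 8 → ℝ) (A' T' : Fin 8 → Fin 8 → Fin 8 → Fin 8 → ℝ)

/-- The curvature in a frame; `A' l i j k` stands for the derivative of `A i j k` along the `l`-th
frame vector. -/
def curvArr (i j k l : Fin 8) : ℝ :=
  A' i j k l - A' j i k l
    + ∑ s, (A j k s * A i s l - A i k s * A j s l - structArr A T i j s * A s k l)

/-- The exterior derivative of the torsion in a frame. -/
def extDArr (i j k l : Fin 8) : ℝ :=
  T' i j k l - T' j i k l + T' k i j l - T' l i j k
    - ∑ s, (structArr A T i j s * T s k l - structArr A T i k s * T s j l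
      + structArr A T i l s * T s j k + structArr A T j k s * T s i l
      - structArr A T j l s * T s i k + structArr A T k l s * T s i j)

/-- The covariant derivative of the torsion in a frame. -/
def covArr (i j k l : Fin 8) : ℝ :=
  T' i j k l - ∑ s, (A i j s * T s k l + A i k s * T j s l + A i l s * T j k s)

/-- The Jacobi identity of a frame, in terms of connection coefficients and torsion. -/
def JacobiArr : Prop := ∀ i j k l,
  ∑ s, (structArr A T i j s * structArr A T s k l + structArr A T j k s * structArr A T s i l
      + structArr A T k i s * structArr A T s j l)
    = structArr (A' k) (T' k) i j l + structArr (A' i) (T' i) j k l + structArr (A' j) (T' j) k i l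

variable {A T A' T'}

/-- The usual Bianchi identity is cyclic in the first three indices and follows from one Jacobi
identity. As in the octahedron argument for pair symmetry, the sum of the four such identities, each
omitting one of `i, j, k, l` from the triple, is twice the cyclic sum over the last three indices,
because `R` is skew in both pairs. Hence the factor `1/2` in front of the Jacobi identities. -/
theorem curvArr_cyclic (hA : ∀ i j k, A i k j = -A i j k) (hA' : ∀ l i j k, A' l i k j = -A' l i j k)
    (hT₁ : ∀ i j k, T j i k = -T i j k) (hT₂ : ∀ i j k, T i k j = -T i j k)
    (hT'₁ : ∀ l i j k, T' l j i k = -T' l i j k) (hT'₂ : ∀ l i j k, T' l i k j = -T' l i j k)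
    (hJ : JacobiArr A T A' T') (i j k l : Fin 8) :
    curvArr A T A' i j k l + curvArr A T A' i k l j + curvArr A T A' i l j k
      = (1 / 2) * extDArr A T T' i j k l + covArr A T T' i j k l := by
  have J₁ := hJ j k l i
  have J₂ := hJ i j k l
  have J₃ := hJ i k l j
  have J₄ := hJ i l j k
  suffices h : ∑ s, ((A j k s * A i s l - A i k s * A j s l - structArr A T i j s * A s k l)
      + (A k l s * A i s j - A i l s * A k s j - structArr A T i k s * A s l j)
      + (A l j s * A i s k - A i j s * A l s k - structArr A T i l s * A s j k)
      + (1 / 2) * (structArr A T i j s * T s k l - structArr A T i k s * T s j l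
      + structArr A T i l s * T s j k + structArr A T j k s * T s i l
      - structArr A T j l s * T s i k + structArr A T k l s * T s i j)
      + (A i j s * T s k l + A i k s * T j s l + A i l s * T j k s)
      + (1 / 2) * ((structArr A T j k s * structArr A T s l i + structArr A T k l s * structArr A T s j i
      + structArr A T l j s * structArr A T s k i)
      + (structArr A T i j s * structArr A T s k l + structArr A T j k s * structArr A T s i l
      + structArr A T k i s * structArr A T s j l)
      + (structArr A T i k s * structArr A T s l j + structArr A T k l s * structArr A T s i j
      + structArr A T l i s * structArr A T s k j)
      + (structArr A T i l s * structArr A T s j k + structArr A T l j s * structArr A T s i k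
      + structArr A T j i s * structArr A T s l k))) = 0 by
    simp only [Finset.sum_add_distrib, ← Finset.mul_sum] at h
    simp only [Finset.sum_add_distrib] at J₁ J₂ J₃ J₄
    simp only [curvArr, extDArr, covArr, Finset.sum_add_distrib]
    -- The first derivatives cancel separately, by skewness alone. What remains is quadratic and
    -- vanishes for each value of the summation index `s`.
    have lin : (A' i j k l - A' j i k l) + (A' i k l j - A' k i l j) + (A' i l j k - A' l i j k)
        - (1 / 2) * (T' i j k l - T' j i k l + T' k i j l - T' l i j k) - T' i j k l
        - (1 / 2) * ((structArr (A' l) (T' l) j k i + structArr (A' j) (T' j) k l i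
            + structArr (A' k) (T' k) l j i)
          + (structArr (A' k) (T' k) i j l + structArr (A' i) (T' i) j k l
            + structArr (A' j) (T' j) k i l)
          + (structArr (A' l) (T' l) i k j + structArr (A' i) (T' i) k l j
            + structArr (A' k) (T' k) l i j)
          + (structArr (A' j) (T' j) i l k + structArr (A' i) (T' i) l j k
            + structArr (A' l) (T' l) j i k)) = 0 := by
      simp only [structArr, fun x y => hA' x y i j, fun x y => hA' x y i k, fun x y => hA' x y i l,
        fun x y => hA' x y j k, fun x y => hA' x y j l, fun x y => hA' x y k l,
        fun x => hT'₁ x i j, fun x => hT'₁ x i k, fun x => hT'₁ x i l, fun x => hT'₁ x j k,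
        fun x => hT'₁ x j l, fun x => hT'₁ x k l, fun x y => hT'₂ x y i j,
        fun x y => hT'₂ x y i k, fun x y => hT'₂ x y i l, fun x y => hT'₂ x y j k,
        fun x y => hT'₂ x y j l, fun x y => hT'₂ x y k l]
      ring
    linear_combination h + lin - (1 / 2) * (J₁ + J₂ + J₃ + J₄)
  refine Finset.sum_eq_zero fun s _ => ?_
  simp only [structArr, fun x => hA x i j, fun x => hA x i k, fun x => hA x i l, fun x => hA x i s,
    fun x => hA x j k, fun x => hA x j l, fun x => hA x j s, fun x => hA x k l, fun x => hA x k s,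
    fun x => hA x l s, hT₁ i j, hT₁ i k, hT₁ i l, hT₁ i s, hT₁ j k, hT₁ j l, hT₁ j s, hT₁ k l,
    hT₁ k s, hT₁ l s, fun x => hT₂ x i j, fun x => hT₂ x i k, fun x => hT₂ x i l, fun x => hT₂ x i s,
    fun x => hT₂ x j k, fun x => hT₂ x j l, fun x => hT₂ x j s, fun x => hT₂ x k l,
    fun x => hT₂ x k s, fun x => hT₂ x l s]
  ring

/-- The covariant derivative of the Lee form in a frame. -/
def covLeeArr (A T : Fin 8 → Fin 8 → Fin 8 → ℝ) (T' : Fin 8 → Fin 8 → Fin 8 → Fin 8 → ℝ)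
    (j k : Fin 8) : ℝ :=
  (1 / 7) * (contr₃ (T' j) k - ∑ s, A j k s * contr₃ T s)

/-- Contraction with `φ` commutes with the covariant derivative, since `stab` says that the
connection annihilates `φ`. The factor 7 is built into `covLeeArr`, in accordance with `contr₃ T = 7
θ`. -/
theorem contr₃_covArr (hA : ∀ i, Mem21 (A i)) (j k : Fin 8) :
    contr₃ (covArr A T T' j) k = 7 * covLeeArr A T T' j k := by
  have key : ∑ a, ∑ b, ∑ c, T a b c * ∑ s, (A j k s * phi s a b c + A j a s * phi k s b c
      + A j b s * phi k a s c + A j c s * phi k a b s) = 0 := by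
    simp only [(hA j).stab, mul_zero, Finset.sum_const_zero]
  simp only [Finset.sum_add_distrib, mul_add] at key
  have e₀ : ∑ a, ∑ b, ∑ c, T a b c * ∑ s, A j k s * phi s a b c = ∑ s, A j k s * contr₃ T s := by
    simp only [contr₃, Finset.mul_sum]
    rw [sum_pull₃]
    exact Finset.sum_congr rfl fun s _ => Finset.sum_congr rfl fun a _ =>
      Finset.sum_congr rfl fun b _ => Finset.sum_congr rfl fun c _ => by ring
  have e₁ : ∑ a, ∑ b, ∑ c, T a b c * ∑ s, A j a s * phi k s b c
      = -∑ a, ∑ b, ∑ c, (∑ s, A j a s * T s b c) * phi k a b c := by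
    simp only [Finset.mul_sum, Finset.sum_mul, ← Finset.sum_neg_distrib]
    rw [Finset.sum_congr rfl fun a _ => sum_pull₂ _, Finset.sum_comm,
      Finset.sum_congr rfl fun a _ => (sum_pull₂ _).symm]
    exact Finset.sum_congr rfl fun s _ => Finset.sum_congr rfl fun a _ =>
      Finset.sum_congr rfl fun b _ => Finset.sum_congr rfl fun c _ => by
        rw [(hA j).skew s c]; ring
  have e₂ : ∑ a, ∑ b, ∑ c, T a b c * ∑ s, A j b s * phi k a s c
      = -∑ a, ∑ b, ∑ c, (∑ s, A j b s * T a s c) * phi k a b c := by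
    simp only [Finset.mul_sum, Finset.sum_mul, ← Finset.sum_neg_distrib]
    refine Finset.sum_congr rfl fun a _ => ?_
    rw [Finset.sum_congr rfl fun a _ => Finset.sum_comm, Finset.sum_comm,
      Finset.sum_congr rfl fun a _ => Finset.sum_comm]
    exact Finset.sum_congr rfl fun s _ =>
      Finset.sum_congr rfl fun b _ => Finset.sum_congr rfl fun c _ => by
        rw [(hA j).skew s c]; ring
  have e₃ : ∑ a, ∑ b, ∑ c, T a b c * ∑ s, A j c s * phi k a b s
      = -∑ a, ∑ b, ∑ c, (∑ s, A j c s * T a b s) * phi k a b c := by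
    simp only [Finset.mul_sum, Finset.sum_mul, ← Finset.sum_neg_distrib]
    refine Finset.sum_congr rfl fun a _ => Finset.sum_congr rfl fun b _ => ?_
    rw [Finset.sum_comm]
    exact Finset.sum_congr rfl fun s _ => Finset.sum_congr rfl fun c _ => by
        rw [(hA j).skew s c]; ring
  rw [e₀, e₁, e₂, e₃] at key
  rw [contr₃]
  simp only [covArr, sub_mul, add_mul, Finset.sum_add_distrib, Finset.sum_sub_distrib]
  rw [covLeeArr, contr₃]
  linear_combination key

/-- The curvature matrix is built from derivatives, commutators and combinations of connection
matrices, and `Λ²₂₁` is a linear subspace closed under commutators. -/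
theorem mem21_curvArr (hA : ∀ i, Mem21 (A i)) (hA' : ∀ l i, Mem21 (A' l i)) (i j : Fin 8) :
    Mem21 (curvArr A T A' i j) := by
  have h : curvArr A T A' i j = fun k l => (A' i j k l - A' j i k l)
      + ((∑ s, (A j k s * A i s l - A i k s * A j s l)) - ∑ s, structArr A T i j s * A s k l) := by
    funext k l
    simp only [curvArr, Finset.sum_sub_distrib]
  rw [h]
  exact ((hA' i j).sub (hA' j i)).add (((hA j).commutator (hA i)).sub
    (Mem21.sum fun s => (hA s).const_mul _))

/-- The Ricci tensor in a frame. -/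
def ricArr (A T : Fin 8 → Fin 8 → Fin 8 → ℝ) (A' : Fin 8 → Fin 8 → Fin 8 → Fin 8 → ℝ)
    (j k : Fin 8) : ℝ :=
  ∑ a, curvArr A T A' a j k a

theorem curvArr_swap (hT₁ : ∀ i j k, T j i k = -T i j k) (i j k l : Fin 8) :
    curvArr A T A' j i k l = -curvArr A T A' i j k l := by
  have h : ∑ s, (A i k s * A j s l - A j k s * A i s l - structArr A T j i s * A s k l)
      = -∑ s, (A j k s * A i s l - A i k s * A j s l - structArr A T i j s * A s k l) := by
    rw [← Finset.sum_neg_distrib]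
    exact Finset.sum_congr rfl fun s _ => by simp only [structArr, hT₁ i j s]; ring
  rw [curvArr, h, curvArr]
  ring

/-- Membership in `Λ²₂₁` turns the trace into `2 Ric_{jk} = -R_{jabc} φ_{kabc}`. The full skewness
of `φ` in `a, b, c` allows `R` to be replaced by a third of its cyclic sum, which the Bianchi
identity evaluates. -/
theorem ricArr_eq (hA : ∀ i, Mem21 (A i)) (hA' : ∀ l i, Mem21 (A' l i))
    (hT₁ : ∀ i j k, T j i k = -T i j k) (hT₂ : ∀ i j k, T i k j = -T i j k)
    (hT'₁ : ∀ l i j k, T' l j i k = -T' l i j k) (hT'₂ : ∀ l i j k, T' l i k j = -T' l i j k)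
    (hJ : JacobiArr A T A' T') (j k : Fin 8) :
    ricArr A T A' j k + (7 / 6) * covLeeArr A T T' j k
      = -(1 / 12) * contr₃ (extDArr A T T' j) k := by
  have hS (a b c) := curvArr_cyclic (fun i j k => (hA i).skew j k) (fun l i j k => (hA' l i).skew j k)
    hT₁ hT₂ hT'₁ hT'₂ hJ j a b c
  have e₁ : 2 * ricArr A T A' j k = -contr₃ (curvArr A T A' j) k := by
    rw [ricArr, Finset.mul_sum, contr₃, ← Finset.sum_neg_distrib]
    refine Finset.sum_congr rfl fun a _ => ?_
    rw [← mem21_curvArr hA hA' a j k a]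
    simp only [← Finset.sum_neg_distrib]
    refine Finset.sum_congr rfl fun b _ => Finset.sum_congr rfl fun c _ => ?_
    rw [curvArr_swap hT₁ j a, phi_pair k a b c]
    ring
  have e₂ : 3 * contr₃ (curvArr A T A' j) k
      = (1 / 2) * contr₃ (extDArr A T T' j) k + contr₃ (covArr A T T' j) k := by
    have : contr₃ (fun a b c => curvArr A T A' j a b c + curvArr A T A' j b c a
        + curvArr A T A' j c a b) k = 3 * contr₃ (curvArr A T A' j) k := by
      have c₁ : ∑ a, ∑ b, ∑ c, curvArr A T A' j b c a * phi k a b c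
          = contr₃ (curvArr A T A' j) k := by
        rw [← sum_pull₂]
        exact Finset.sum_congr rfl fun a _ => Finset.sum_congr rfl fun b _ =>
          Finset.sum_congr rfl fun c _ => by rw [phi_cyc₃' k c a b]
      have c₂ : ∑ a, ∑ b, ∑ c, curvArr A T A' j c a b * phi k a b c
          = contr₃ (curvArr A T A' j) k := by
        rw [sum_pull₂]
        exact Finset.sum_congr rfl fun a _ => Finset.sum_congr rfl fun b _ =>
          Finset.sum_congr rfl fun c _ => by rw [phi_cyc₃' k a b c]
      simp only [contr₃, add_mul, Finset.sum_add_distrib] at c₁ c₂ ⊢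
      rw [c₁, c₂]
      ring
    rw [← this]
    simp only [hS, contr₃, add_mul, mul_assoc, Finset.sum_add_distrib, ← Finset.mul_sum]
  rw [contr₃_covArr hA] at e₂
  linear_combination (1 / 2) * e₁ - (1 / 6) * e₂

end Frame

/-! ### The exterior derivative of the Lee form when the torsion is closed -/

section LeeForm

variable {A T : Fin 8 → Fin 8 → Fin 8 → ℝ} {A' T' : Fin 8 → Fin 8 → Fin 8 → Fin 8 → ℝ}

theorem covArr_swap₁₂ (hT₁ : ∀ i j k, T j i k = -T i j k)
    (hT'₁ : ∀ l i j k, T' l j i k = -T' l i j k) (i j k l : Fin 8) :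
    covArr A T T' i k j l = -covArr A T T' i j k l := by
  have h : ∑ s, (A i k s * T s j l + A i j s * T k s l + A i l s * T k j s)
      = -∑ s, (A i j s * T s k l + A i k s * T j s l + A i l s * T j k s) := by
    rw [← Finset.sum_neg_distrib]
    exact Finset.sum_congr rfl fun s _ => by rw [hT₁ j k s, hT₁ j s l, hT₁ s k l]; ring
  rw [covArr, h, hT'₁, covArr]
  ring

theorem covArr_swap₂₃ (hT₂ : ∀ i j k, T i k j = -T i j k)
    (hT'₂ : ∀ l i j k, T' l i k j = -T' l i j k) (i j k l : Fin 8) :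
    covArr A T T' i j l k = -covArr A T T' i j k l := by
  have h : ∑ s, (A i j s * T s l k + A i l s * T j s k + A i k s * T j l s)
      = -∑ s, (A i j s * T s k l + A i k s * T j s l + A i l s * T j k s) := by
    rw [← Finset.sum_neg_distrib]
    exact Finset.sum_congr rfl fun s _ => by rw [hT₂ s k l, hT₂ j k s, hT₂ j s l]; ring
  rw [covArr, h, hT'₂, covArr]
  ring

/-- The formula for `d` in terms of a connection with torsion: skew-symmetrised `∇T` plus a
correction quadratic in `T`, here because the torsion of the connection is `T` itself. -/
theorem extDArr_eq (hT₁ : ∀ i j k, T j i k = -T i j k) (hT₂ : ∀ i j k, T i k j = -T i j k)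
    (i j k l : Fin 8) :
    extDArr A T T' i j k l
      = covArr A T T' i j k l - covArr A T T' j i k l + covArr A T T' k i j l
        - covArr A T T' l i j k
        + 2 * (∑ s, T i j s * T s k l - ∑ s, T i k s * T s j l + ∑ s, T i l s * T s j k) := by
  have h : ∑ s, (structArr A T i j s * T s k l - structArr A T i k s * T s j l
      + structArr A T i l s * T s j k + structArr A T j k s * T s i l
      - structArr A T j l s * T s i k + structArr A T k l s * T s i j)
      = ∑ s, ((A i j s * T s k l + A i k s * T j s l + A i l s * T j k s)
        - (A j i s * T s k l + A j k s * T i s l + A j l s * T i k s)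
        + (A k i s * T s j l + A k j s * T i s l + A k l s * T i j s)
        - (A l i s * T s j k + A l j s * T i s k + A l k s * T i j s)
        - 2 * (T i j s * T s k l - T i k s * T s j l + T i l s * T s j k)) := by
    refine Finset.sum_congr rfl fun s _ => ?_
    have e (a b : Fin 8) : T a b s = T s a b := by rw [hT₂ a s b, hT₁ s a b]; ring
    simp only [structArr, e, fun a b => hT₁ s a b]
    ring
  simp only [extDArr, covArr, h, Finset.sum_add_distrib, Finset.sum_sub_distrib, ← Finset.mul_sum]
  ring

theorem contr₃_extDArr (hA : ∀ i, Mem21 (A i)) (hT₁ : ∀ i j k, T j i k = -T i j k)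
    (hT₂ : ∀ i j k, T i k j = -T i j k)
    (hT'₁ : ∀ l i j k, T' l j i k = -T' l i j k) (hT'₂ : ∀ l i j k, T' l i k j = -T' l i j k)
    (j k : Fin 8) :
    contr₃ (extDArr A T T' j) k = 7 * covLeeArr A T T' j k
      - 3 * ∑ a, contr₂ (covArr A T T' a) j k a + 6 * ∑ a, ∑ s, T j a s * contr₂ T s k a := by
  have hN₁ := covArr_swap₁₂ (A := A) hT₁ hT'₁
  have hN₂ := covArr_swap₂₃ (A := A) hT₂ hT'₂
  have n₁ : ∑ a, ∑ b, ∑ c, covArr A T T' a j b c * phi k a b c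
      = ∑ a, contr₂ (covArr A T T' a) j k a := by
    refine Finset.sum_congr rfl fun a _ => Finset.sum_congr rfl fun b _ =>
      Finset.sum_congr rfl fun c _ => ?_
    rw [phi_pair k a b c, hN₂ a b j c, hN₁ a j b c]; ring
  have n₂ : ∑ a, ∑ b, ∑ c, covArr A T T' b j a c * phi k a b c
      = -∑ a, contr₂ (covArr A T T' a) j k a := by
    rw [← n₁, Finset.sum_comm]
    simp only [← Finset.sum_neg_distrib]
    refine Finset.sum_congr rfl fun a _ => Finset.sum_congr rfl fun b _ =>
      Finset.sum_congr rfl fun c _ => ?_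
    rw [phi_swap₁₂ k a b c]; ring
  have n₃ : ∑ a, ∑ b, ∑ c, covArr A T T' c j a b * phi k a b c
      = ∑ a, contr₂ (covArr A T T' a) j k a := by
    rw [← n₁, sum_pull₂]
    refine Finset.sum_congr rfl fun a _ => Finset.sum_congr rfl fun b _ =>
      Finset.sum_congr rfl fun c _ => ?_
    rw [phi_cyc₃' k a b c]
  have t₁ : ∑ a, ∑ b, ∑ c, (∑ s, T j a s * T s b c) * phi k a b c
      = ∑ a, ∑ s, T j a s * contr₂ T s k a := by
    refine Finset.sum_congr rfl fun a _ => ?_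
    simp only [contr₂, Finset.sum_mul, Finset.mul_sum]
    rw [sum_pull₂]
    refine Finset.sum_congr rfl fun s _ => Finset.sum_congr rfl fun b _ =>
      Finset.sum_congr rfl fun c _ => ?_
    rw [phi_pair k a b c, hT₂ b s c, hT₁ s b c]; ring
  have t₂ : ∑ a, ∑ b, ∑ c, (∑ s, T j b s * T s a c) * phi k a b c
      = -∑ a, ∑ s, T j a s * contr₂ T s k a := by
    rw [← t₁, Finset.sum_comm]
    simp only [← Finset.sum_neg_distrib]
    refine Finset.sum_congr rfl fun a _ => Finset.sum_congr rfl fun b _ =>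
      Finset.sum_congr rfl fun c _ => ?_
    rw [phi_swap₁₂ k a b c]; ring
  have t₃ : ∑ a, ∑ b, ∑ c, (∑ s, T j c s * T s a b) * phi k a b c
      = ∑ a, ∑ s, T j a s * contr₂ T s k a := by
    rw [← t₁, sum_pull₂]
    refine Finset.sum_congr rfl fun a _ => Finset.sum_congr rfl fun b _ =>
      Finset.sum_congr rfl fun c _ => ?_
    rw [phi_cyc₃' k a b c]
  rw [← contr₃_covArr hA]
  simp only [contr₃, extDArr_eq hT₁ hT₂, add_mul, sub_mul, mul_assoc, mul_add, mul_sub,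
    Finset.sum_add_distrib, Finset.sum_sub_distrib, ← Finset.mul_sum]
  rw [n₁, n₂, n₃, t₁, t₂, t₃]
  ring

/-- The trace of the Bianchi identity with its first two indices equal: `R_{aabc}` vanishes and the
two other terms are `Ric_{bc}` and `-Ric_{cb}`. -/
theorem sum_covArr_eq_ricArr_sub (hA : ∀ i, Mem21 (A i)) (hA' : ∀ l i, Mem21 (A' l i))
    (hT₁ : ∀ i j k, T j i k = -T i j k) (hT₂ : ∀ i j k, T i k j = -T i j k)
    (hT'₁ : ∀ l i j k, T' l j i k = -T' l i j k) (hT'₂ : ∀ l i j k, T' l i k j = -T' l i j k)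
    (hJ : JacobiArr A T A' T') (hH : ∀ i j k l, extDArr A T T' i j k l = 0) (b c : Fin 8) :
    ∑ a, covArr A T T' a a b c = ricArr A T A' b c - ricArr A T A' c b := by
  rw [ricArr, ricArr, ← Finset.sum_sub_distrib]
  refine Finset.sum_congr rfl fun a _ => ?_
  have h := curvArr_cyclic (fun i j k => (hA i).skew j k) (fun l i j k => (hA' l i).skew j k)
    hT₁ hT₂ hT'₁ hT'₂ hJ a a b c
  have h₀ := curvArr_swap (A := A) (A' := A') hT₁ a a b c
  have h₁ := (mem21_curvArr (T := T) hA hA' a c).skew a b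
  rw [hH] at h
  linarith

/-- `contr₃_phi`, contracted with `T`, rewrites the quadratic expression as terms symmetric in `j,
k`, which drop out of the difference, and terms containing `contr₃ T`. Thus only the Lee part of the
torsion survives. -/
theorem quadratic_torsion_skew (hT₁ : ∀ i j k, T j i k = -T i j k)
    (hT₂ : ∀ i j k, T i k j = -T i j k) (j k : Fin 8) :
    6 * (∑ a, ∑ s, T j a s * contr₂ T s k a - ∑ a, ∑ s, T k a s * contr₂ T s j a)
      = 2 * (∑ s, T j k s * contr₃ T s)
        - ∑ a, ∑ b, (∑ s, T a b s * contr₃ T s) * phi a b j k := by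
  have cyc := contr₃_phi hT₁ hT₂
  have q (j k : Fin 8) : 6 * ∑ a, ∑ s, T j a s * contr₂ T s k a
      = 6 * ∑ a, ∑ s, T j a s * T s k a - 3 * ∑ a, ∑ s, T j a s * contr₂ T k a s
        - ∑ t, contr₃ T t * contr₂ T j t k := by
    have s₁ : ∑ a, ∑ s, T j a s * contr₂ T a s k = ∑ a, ∑ s, T j a s * contr₂ T s k a := by
      rw [Finset.sum_comm]
      exact Finset.sum_congr rfl fun a _ => Finset.sum_congr rfl fun s _ => by
        rw [hT₂ j a s, contr₂_swap T s k a]; ring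
    have s₂ : ∑ a, ∑ s, T j a s * ∑ t, contr₃ T t * phi t s k a
        = ∑ t, contr₃ T t * contr₂ T j t k := by
      simp only [contr₂, Finset.mul_sum]
      rw [sum_pull₂]
      refine Finset.sum_congr rfl fun t _ => Finset.sum_congr rfl fun a _ =>
        Finset.sum_congr rfl fun s _ => ?_
      rw [hT₂ a j s, hT₁ j a s, phi_swap₀₁ s t k a, phi_swap₂₃ s t a k, phi_swap₁₂ s a t k,
        phi_swap₀₁ a s t k]
      ring
    have s₃ : ∑ a, ∑ s, T j a s * ∑ t, contr₃ T t * phi t s k a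
        = ∑ a, ∑ s, (6 * (T j a s * T s k a) - 3 * (T j a s * contr₂ T s k a)
          - 3 * (T j a s * contr₂ T k a s) - 3 * (T j a s * contr₂ T a s k)) :=
      Finset.sum_congr rfl fun a _ => Finset.sum_congr rfl fun s _ => by rw [cyc s k a]; ring
    simp only [Finset.sum_sub_distrib, ← Finset.mul_sum] at s₃
    linarith
  have sym₁ : ∑ a, ∑ s, T j a s * T s k a = ∑ a, ∑ s, T k a s * T s j a := by
    rw [Finset.sum_comm]
    exact Finset.sum_congr rfl fun a _ => Finset.sum_congr rfl fun s _ => by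
      rw [hT₁ k a s, hT₁ j s a]; ring
  have sym₂ : ∑ a, ∑ s, T j a s * contr₂ T k a s = ∑ a, ∑ s, T k a s * contr₂ T j a s := by
    simp only [contr₂, Finset.mul_sum]
    rw [sum_comm₂₂]
    refine Finset.sum_congr rfl fun a _ => Finset.sum_congr rfl fun s _ =>
      Finset.sum_congr rfl fun b _ => Finset.sum_congr rfl fun c _ => ?_
    rw [phi_pair, hT₂ a k s, hT₁ k a s, hT₂ b j c, hT₁ j b c]; ring
  have lin : ∑ t, contr₃ T t * contr₂ T j t k - ∑ t, contr₃ T t * contr₂ T k t j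
      = -2 * (∑ s, T j k s * contr₃ T s)
        + ∑ a, ∑ b, (∑ s, T a b s * contr₃ T s) * phi a b j k := by
    -- The tensor `contr₃ T ⊗ contr₃ T` is symmetric and `phi` is skew. Expanding the same sum by
    -- `contr₃_phi` then gives a relation among the terms linear in `T`.
    have l₁ : ∑ t, contr₃ T t * ∑ s, contr₃ T s * phi s j t k = 0 := by
      have : ∑ t, contr₃ T t * ∑ s, contr₃ T s * phi s j t k
          = -∑ t, contr₃ T t * ∑ s, contr₃ T s * phi s j t k := by
        simp only [Finset.mul_sum, ← Finset.sum_neg_distrib]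
        rw [Finset.sum_comm]
        refine Finset.sum_congr rfl fun t _ => Finset.sum_congr rfl fun s _ => ?_
        rw [phi_swap₁₂ t s j k, phi_cyc₃ j t s k, phi_swap₁₂ j s t k, phi_swap₀₁ s j t k]; ring
      linarith
    have l₂ : ∑ a, ∑ b, (∑ s, T a b s * contr₃ T s) * phi a b j k
        = -∑ t, contr₃ T t * contr₂ T t k j := by
      simp only [contr₂, Finset.mul_sum, Finset.sum_mul]
      rw [sum_pull₂]
      simp only [← Finset.sum_neg_distrib]
      refine Finset.sum_congr rfl fun t _ => Finset.sum_congr rfl fun a _ =>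
        Finset.sum_congr rfl fun s _ => ?_
      rw [phi_swap₂₃ a s j k]; ring
    have l₃ : ∑ t, contr₃ T t * ∑ s, contr₃ T s * phi s j t k
        = ∑ t, (-6 * (T j k t * contr₃ T t) - 3 * (contr₃ T t * contr₂ T j t k)
          - 3 * (contr₃ T t * contr₂ T t k j) + 3 * (contr₃ T t * contr₂ T k t j)) :=
      Finset.sum_congr rfl fun t _ => by
        rw [cyc j t k, hT₂ j k t, contr₂_swap T k t j]; ring
    simp only [Finset.sum_add_distrib, Finset.sum_sub_distrib, ← Finset.mul_sum] at l₃
    linarith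
  linear_combination q j k - q k j + 6 * sym₁ - 3 * sym₂ - lin

/-- If the torsion is closed then the exterior derivative of the Lee form has values in `Λ²₂₁`. -/
theorem mem21_extD_leeArr (hA : ∀ i, Mem21 (A i)) (hA' : ∀ l i, Mem21 (A' l i))
    (hT₁ : ∀ i j k, T j i k = -T i j k) (hT₂ : ∀ i j k, T i k j = -T i j k)
    (hT'₁ : ∀ l i j k, T' l j i k = -T' l i j k) (hT'₂ : ∀ l i j k, T' l i k j = -T' l i j k)
    (hJ : JacobiArr A T A' T') (hH : ∀ i j k l, extDArr A T T' i j k l = 0) :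
    Mem21 fun j k => covLeeArr A T T' j k - covLeeArr A T T' k j
      + (1 / 7) * ∑ s, T j k s * contr₃ T s := by
  have hN₁ := covArr_swap₁₂ (A := A) hT₁ hT'₁
  have hN₂ := covArr_swap₂₃ (A := A) hT₂ hT'₂
  have hR (j k : Fin 8) : ricArr A T A' j k = -(7 / 6) * covLeeArr A T T' j k := by
    have h := ricArr_eq hA hA' hT₁ hT₂ hT'₁ hT'₂ hJ j k
    have h0 : contr₃ (extDArr A T T' j) k = 0 := by simp [contr₃, hH]
    rw [h0] at h
    linarith
  have hτ (b c : Fin 8) : ∑ a, covArr A T T' a a b c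
      = -(7 / 6) * (covLeeArr A T T' b c - covLeeArr A T T' c b) := by
    rw [sum_covArr_eq_ricArr_sub hA hA' hT₁ hT₂ hT'₁ hT'₂ hJ hH, hR, hR]; ring
  intro j k
  have h₁ : (0 : ℝ) = contr₃ (extDArr A T T' j) k - contr₃ (extDArr A T T' k) j := by
    simp [contr₃, hH]
  rw [contr₃_extDArr hA hT₁ hT₂ hT'₁ hT'₂, contr₃_extDArr hA hT₁ hT₂ hT'₁ hT'₂] at h₁
  have hQ := quadratic_torsion_skew hT₁ hT₂ j k
  -- `contr₃_phi` is applied to the 3-form `∇_a T` at the indices `j, k, a` and summed over `a`.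
  -- This expresses the skew part of the unknown contraction by the divergence of `T` and by `∇θ`,
  -- and `hτ` reduces the divergence to `∇θ` as well.
  have hV : 3 * (∑ a, contr₂ (covArr A T T' a) j k a - ∑ a, contr₂ (covArr A T T' a) k j a)
      = 6 * ∑ a, covArr A T T' a a j k - 7 * ∑ a, ∑ s, covLeeArr A T T' a s * phi s a j k
        - 3 * ∑ b, ∑ c, (∑ a, covArr A T T' a a b c) * phi b c j k := by
    have v₁ : ∑ b, ∑ c, (∑ a, covArr A T T' a a b c) * phi b c j k
        = ∑ a, contr₂ (covArr A T T' a) a j k := by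
      simp only [contr₂, Finset.sum_mul]
      rw [sum_pull₂]
      refine Finset.sum_congr rfl fun t _ => Finset.sum_congr rfl fun a _ =>
        Finset.sum_congr rfl fun s _ => ?_
      rw [hN₂ t a t s, hN₁ t t a s]; ring
    have v₂ : ∑ a, ∑ s, 7 * covLeeArr A T T' a s * phi s j k a
        = ∑ a, (6 * covArr A T T' a a j k - 3 * contr₂ (covArr A T T' a) j k a
          + 3 * contr₂ (covArr A T T' a) k j a - 3 * contr₂ (covArr A T T' a) a j k) := by
      refine Finset.sum_congr rfl fun a _ => ?_
      simp only [← contr₃_covArr hA]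
      rw [contr₃_phi (hN₁ a) (hN₂ a), hN₂ a j a k, hN₁ a a j k,
        contr₂_swap (covArr A T T' a) k j a]
      ring
    have v₃ : ∑ a, ∑ s, 7 * covLeeArr A T T' a s * phi s j k a
        = 7 * ∑ a, ∑ s, covLeeArr A T T' a s * phi s a j k := by
      simp only [Finset.mul_sum]
      refine Finset.sum_congr rfl fun t _ => Finset.sum_congr rfl fun a _ => ?_
      rw [phi_cyc₃' a t j k]; ring
    simp only [Finset.sum_add_distrib, Finset.sum_sub_distrib, ← Finset.mul_sum] at v₂
    linarith
  -- Only the skew part of `∇θ` meets `phi`.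
  have hn : 2 * ∑ a, ∑ s, covLeeArr A T T' a s * phi s a j k
      = -∑ a, ∑ s, (covLeeArr A T T' a s - covLeeArr A T T' s a) * phi a s j k := by
    have w : ∑ a, ∑ s, covLeeArr A T T' s a * phi a s j k
        = ∑ a, ∑ s, covLeeArr A T T' a s * phi s a j k := Finset.sum_comm
    have w' : ∑ a, ∑ s, covLeeArr A T T' a s * phi a s j k
        = -∑ a, ∑ s, covLeeArr A T T' a s * phi s a j k := by
      simp only [← Finset.sum_neg_distrib]
      refine Finset.sum_congr rfl fun t _ => Finset.sum_congr rfl fun a _ => ?_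
      rw [phi_swap₀₁ a t j k]; ring
    simp only [sub_mul, Finset.sum_sub_distrib]
    linarith
  simp only [hτ, mul_assoc, ← Finset.mul_sum] at hV
  simp only [add_mul, mul_assoc, Finset.sum_add_distrib, ← Finset.mul_sum]
  linear_combination (1 / 7) * h₁ - (1 / 7) * hV + (1 / 7) * hQ + (1 / 2) * hn

end LeeForm

/-! ### The kernel of the contraction with the 4-form: the linear system -/

section SelfDual

/-- The contraction of an alternating array with `e_p ∧ e_q ∧ e_r ∧ e_s`, up to a factor `6`. -/
def termContr (G : Fin 8 → Fin 8 → Fin 8 → ℝ) (k p q r s : Fin 8) : ℝ :=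
  (if p = k then G q r s else 0) - (if q = k then G p r s else 0)
    + (if r = k then G p q s else 0) - (if s = k then G p q r else 0)

/-- The contraction of an alternating array with the standard 4-form, monomial by monomial. -/
theorem contr₃_eq_sum_stdTerms {G : Fin 8 → Fin 8 → Fin 8 → ℝ} (h₁ : ∀ i j k, G j i k = -G i j k)
    (h₂ : ∀ i j k, G i k j = -G i j k) (k : Fin 8) :
    contr₃ G k = 6 * (stdTerms.map fun t => (t.1 : ℝ) *
      termContr G k (t.2 0) (t.2 1) (t.2 2) (t.2 3)).sum := by
  have term (p q r s : Fin 8) : ∑ a, ∑ b, ∑ c, G a b c * (minor₄ p q r s k a b c : ℝ)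
      = 6 * termContr G k p q r s := by
    have e (a b c : Fin 8) : G a b c + G b c a + G c a b - G b a c - G a c b - G c b a
        = 6 * G a b c := by
      rw [h₁ a b c, h₂ a b c, h₂ b a c, h₁ a b c, h₁ a c b, h₂ a b c, h₂ c a b, h₁ a c b, h₂ a b c]
      ring
    have m₃ (x y z : Fin 8) : ∑ a, ∑ b, ∑ c, G a b c * (minor₃ x y z a b c : ℝ)
        = 6 * G x y z := by
      simp only [minor₃, minor₂, Int.cast_sub, Int.cast_add, kron_mul_cast, Int.cast_one,
        mul_one, mul_add, mul_sub, Finset.sum_add_distrib, Finset.sum_sub_distrib]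
      simp only [kron, mul_ite, ite_mul, mul_one, mul_zero, one_mul, zero_mul, Finset.sum_ite_eq,
        Finset.sum_ite_irrel, Finset.sum_const_zero, Finset.mem_univ, if_true]
      rw [← e x y z]; ring
    have m₄ (a b c : Fin 8) : minor₄ p q r s k a b c = ind p k * minor₃ q r s a b c
        - ind q k * minor₃ p r s a b c + ind r k * minor₃ p q s a b c
        - ind s k * minor₃ p q r a b c := by
      simp only [minor₄, minor₃, minor₂, gate_eq]; ring
    have f (x : Fin 8) (g : Fin 8 → Fin 8 → Fin 8 → ℤ) :
        ∑ a, ∑ b, ∑ c, G a b c * (ind x k * g a b c : ℝ)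
          = if x = k then ∑ a, ∑ b, ∑ c, G a b c * (g a b c : ℝ) else 0 := by
      unfold ind; split_ifs <;> simp
    simp only [m₄, Int.cast_sub, Int.cast_add, Int.cast_mul, mul_add, mul_sub,
      Finset.sum_add_distrib, Finset.sum_sub_distrib, f, m₃, termContr, mul_ite, mul_zero]
  simp only [contr₃, phi_eq, ← stdMinor_eq_stdFast, Int.cast_add, Int.cast_sub, Int.cast_neg,
    mul_add, mul_sub, mul_neg, Finset.sum_add_distrib, Finset.sum_sub_distrib,
    Finset.sum_neg_distrib, term]
  simp only [stdTerms, List.map_cons, List.map_nil, List.sum_cons, List.sum_nil, Matrix.cons_val,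
    Int.cast_neg, Int.cast_one]
  ring

variable {H : Fin 8 → Fin 8 → Fin 8 → Fin 8 → ℝ}

theorem swap_rules (h₀ : ∀ i j k l, H j i k l = -H i j k l)
    (h₁ : ∀ i j k l, H i k j l = -H i j k l) (h₂ : ∀ i j k l, H i j l k = -H i j k l) :
    (∀ i k l, H i i k l = 0) ∧ (∀ i k l, H k i i l = 0) ∧ (∀ i k l, H k l i i = 0) ∧
    (∀ i j k l, j < i → H i j k l = -H j i k l) ∧ (∀ i j k l, k < j → H i j k l = -H i k j l) ∧
    (∀ i j k l, l < k → H i j k l = -H i j l k) :=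
  ⟨fun i k l => by linarith [h₀ i i k l], fun i k l => by linarith [h₁ k i i l],
    fun i k l => by linarith [h₂ k l i i], fun i j k l _ => h₀ j i k l, fun i j k l _ => h₁ i k j l,
    fun i j k l _ => h₂ i j l k⟩

/-- With indices labelled by `𝔽₂³`, a nonzero `φ_{kabc}` has labels of sum zero. Hence equation `(j,
k)` involves only components of `H` whose labels add up to `label j + label k`, and the linear
system splits into eight blocks. This block, with `j = k`, has the 14 affine planes as unknowns. -/
theorem selfDual_label_0 (h₀ : ∀ i j k l, H j i k l = -H i j k l)
    (h₁ : ∀ i j k l, H i k j l = -H i j k l) (h₂ : ∀ i j k l, H i j l k = -H i j k l)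
    (hE : ∀ j k, contr₃ (H j) k = 0) :
    H 3 4 5 6 = H 0 1 2 7 ∧ H 2 4 6 7 = -H 0 1 3 5 ∧ H 2 3 5 7 = -H 0 1 4 6 ∧
    H 1 4 5 7 = -H 0 2 3 6 ∧ H 1 3 6 7 = -H 0 2 4 5 ∧ H 1 2 5 6 = H 0 3 4 7 ∧
    H 1 2 3 4 = H 0 5 6 7 := by
  obtain ⟨d₀, d₁, d₂, s₀, s₁, s₂⟩ := swap_rules h₀ h₁ h₂
  simp only [fun j => contr₃_eq_sum_stdTerms (h₁ j) (h₂ j)] at hE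
  have e0 := hE 0 0
  have e1 := hE 1 1
  have e2 := hE 2 2
  have e3 := hE 3 3
  have e4 := hE 4 4
  have e5 := hE 5 5
  have e6 := hE 6 6
  have e7 := hE 7 7
  simp [stdTerms, termContr, d₀, d₁, d₂, s₀, s₁, s₂] at e0 e1 e2 e3 e4 e5 e6 e7
  refine ⟨?_, ?_, ?_, ?_, ?_, ?_, ?_⟩ <;> linarith

/-- Each of the seven blocks with nonzero label sum has eight unknowns, forming four complementary
pairs, and eight equations, one for each `j`, with `k` the index whose label is that of `j` plus the
given sum. -/
theorem selfDual_label_1 (h₀ : ∀ i j k l, H j i k l = -H i j k l)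
    (h₁ : ∀ i j k l, H i k j l = -H i j k l) (h₂ : ∀ i j k l, H i j l k = -H i j k l)
    (hE : ∀ j k, contr₃ (H j) k = 0) :
    H 1 5 6 7 = -H 0 2 3 4 ∧ H 1 3 4 7 = -H 0 2 5 6 ∧ H 1 2 4 5 = H 0 3 6 7 ∧
    H 1 2 3 6 = H 0 4 5 7 := by
  obtain ⟨d₀, d₁, d₂, s₀, s₁, s₂⟩ := swap_rules h₀ h₁ h₂
  simp only [fun j => contr₃_eq_sum_stdTerms (h₁ j) (h₂ j)] at hE
  have e0 := hE 0 1
  have e1 := hE 1 0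
  have e2 := hE 2 7
  have e3 := hE 3 5
  have e4 := hE 4 6
  have e5 := hE 5 3
  have e6 := hE 6 4
  have e7 := hE 7 2
  simp [stdTerms, termContr, d₀, d₁, d₂, s₀, s₁, s₂] at e0 e1 e2 e3 e4 e5 e6 e7
  refine ⟨?_, ?_, ?_, ?_⟩ <;> linarith

theorem selfDual_label_2 (h₀ : ∀ i j k l, H j i k l = -H i j k l)
    (h₁ : ∀ i j k l, H i k j l = -H i j k l) (h₂ : ∀ i j k l, H i j l k = -H i j k l)
    (hE : ∀ j k, contr₃ (H j) k = 0) :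
    H 2 5 6 7 = H 0 1 3 4 ∧ H 2 3 4 7 = H 0 1 5 6 ∧ H 1 2 4 6 = -H 0 3 5 7 ∧
    H 1 2 3 5 = -H 0 4 6 7 := by
  obtain ⟨d₀, d₁, d₂, s₀, s₁, s₂⟩ := swap_rules h₀ h₁ h₂
  simp only [fun j => contr₃_eq_sum_stdTerms (h₁ j) (h₂ j)] at hE
  have e0 := hE 0 2
  have e1 := hE 1 7
  have e2 := hE 2 0
  have e3 := hE 3 6
  have e4 := hE 4 5
  have e5 := hE 5 4
  have e6 := hE 6 3
  have e7 := hE 7 1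
  simp [stdTerms, termContr, d₀, d₁, d₂, s₀, s₁, s₂] at e0 e1 e2 e3 e4 e5 e6 e7
  refine ⟨?_, ?_, ?_, ?_⟩ <;> linarith

theorem selfDual_label_3 (h₀ : ∀ i j k l, H j i k l = -H i j k l)
    (h₁ : ∀ i j k l, H i k j l = -H i j k l) (h₂ : ∀ i j k l, H i j l k = -H i j k l)
    (hE : ∀ j k, contr₃ (H j) k = 0) :
    H 2 4 5 7 = H 0 1 3 6 ∧ H 2 3 6 7 = H 0 1 4 5 ∧ H 1 4 6 7 = H 0 2 3 5 ∧
    H 1 3 5 7 = H 0 2 4 6 := by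
  obtain ⟨d₀, d₁, d₂, s₀, s₁, s₂⟩ := swap_rules h₀ h₁ h₂
  simp only [fun j => contr₃_eq_sum_stdTerms (h₁ j) (h₂ j)] at hE
  have e0 := hE 0 7
  have e1 := hE 1 2
  have e2 := hE 2 1
  have e3 := hE 3 4
  have e4 := hE 4 3
  have e5 := hE 5 6
  have e6 := hE 6 5
  have e7 := hE 7 0
  simp [stdTerms, termContr, d₀, d₁, d₂, s₀, s₁, s₂] at e0 e1 e2 e3 e4 e5 e6 e7
  refine ⟨?_, ?_, ?_, ?_⟩ <;> linarith

theorem selfDual_label_4 (h₀ : ∀ i j k l, H j i k l = -H i j k l)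
    (h₁ : ∀ i j k l, H i k j l = -H i j k l) (h₂ : ∀ i j k l, H i j l k = -H i j k l)
    (hE : ∀ j k, contr₃ (H j) k = 0) :
    H 3 5 6 7 = -H 0 1 2 4 ∧ H 2 3 4 5 = H 0 1 6 7 ∧ H 1 3 4 6 = H 0 2 5 7 ∧
    H 1 2 3 7 = -H 0 4 5 6 := by
  obtain ⟨d₀, d₁, d₂, s₀, s₁, s₂⟩ := swap_rules h₀ h₁ h₂
  simp only [fun j => contr₃_eq_sum_stdTerms (h₁ j) (h₂ j)] at hE
  have e0 := hE 0 3
  have e1 := hE 1 5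
  have e2 := hE 2 6
  have e3 := hE 3 0
  have e4 := hE 4 7
  have e5 := hE 5 1
  have e6 := hE 6 2
  have e7 := hE 7 4
  simp [stdTerms, termContr, d₀, d₁, d₂, s₀, s₁, s₂] at e0 e1 e2 e3 e4 e5 e6 e7
  refine ⟨?_, ?_, ?_, ?_⟩ <;> linarith

theorem selfDual_label_5 (h₀ : ∀ i j k l, H j i k l = -H i j k l)
    (h₁ : ∀ i j k l, H i k j l = -H i j k l) (h₂ : ∀ i j k l, H i j l k = -H i j k l)
    (hE : ∀ j k, contr₃ (H j) k = 0) :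
    H 3 4 5 7 = -H 0 1 2 6 ∧ H 2 3 5 6 = H 0 1 4 7 ∧ H 1 4 5 6 = H 0 2 3 7 ∧
    H 1 2 5 7 = -H 0 3 4 6 := by
  obtain ⟨d₀, d₁, d₂, s₀, s₁, s₂⟩ := swap_rules h₀ h₁ h₂
  simp only [fun j => contr₃_eq_sum_stdTerms (h₁ j) (h₂ j)] at hE
  have e0 := hE 0 5
  have e1 := hE 1 3
  have e2 := hE 2 4
  have e3 := hE 3 1
  have e4 := hE 4 2
  have e5 := hE 5 0
  have e6 := hE 6 7
  have e7 := hE 7 6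
  simp [stdTerms, termContr, d₀, d₁, d₂, s₀, s₁, s₂] at e0 e1 e2 e3 e4 e5 e6 e7
  refine ⟨?_, ?_, ?_, ?_⟩ <;> linarith

theorem selfDual_label_6 (h₀ : ∀ i j k l, H j i k l = -H i j k l)
    (h₁ : ∀ i j k l, H i k j l = -H i j k l) (h₂ : ∀ i j k l, H i j l k = -H i j k l)
    (hE : ∀ j k, contr₃ (H j) k = 0) :
    H 3 4 6 7 = H 0 1 2 5 ∧ H 2 4 5 6 = -H 0 1 3 7 ∧ H 1 3 5 6 = -H 0 2 4 7 ∧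
    H 1 2 6 7 = H 0 3 4 5 := by
  obtain ⟨d₀, d₁, d₂, s₀, s₁, s₂⟩ := swap_rules h₀ h₁ h₂
  simp only [fun j => contr₃_eq_sum_stdTerms (h₁ j) (h₂ j)] at hE
  have e0 := hE 0 6
  have e1 := hE 1 4
  have e2 := hE 2 3
  have e3 := hE 3 2
  have e4 := hE 4 1
  have e5 := hE 5 7
  have e6 := hE 6 0
  have e7 := hE 7 5
  simp [stdTerms, termContr, d₀, d₁, d₂, s₀, s₁, s₂] at e0 e1 e2 e3 e4 e5 e6 e7
  refine ⟨?_, ?_, ?_, ?_⟩ <;> linarith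

theorem selfDual_label_7 (h₀ : ∀ i j k l, H j i k l = -H i j k l)
    (h₁ : ∀ i j k l, H i k j l = -H i j k l) (h₂ : ∀ i j k l, H i j l k = -H i j k l)
    (hE : ∀ j k, contr₃ (H j) k = 0) :
    H 4 5 6 7 = H 0 1 2 3 ∧ H 2 3 4 6 = -H 0 1 5 7 ∧ H 1 3 4 5 = -H 0 2 6 7 ∧
    H 1 2 4 7 = H 0 3 5 6 := by
  obtain ⟨d₀, d₁, d₂, s₀, s₁, s₂⟩ := swap_rules h₀ h₁ h₂
  simp only [fun j => contr₃_eq_sum_stdTerms (h₁ j) (h₂ j)] at hE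
  have e0 := hE 0 4
  have e1 := hE 1 6
  have e2 := hE 2 5
  have e3 := hE 3 7
  have e4 := hE 4 0
  have e5 := hE 5 2
  have e6 := hE 6 1
  have e7 := hE 7 3
  simp [stdTerms, termContr, d₀, d₁, d₂, s₀, s₁, s₂] at e0 e1 e2 e3 e4 e5 e6 e7
  refine ⟨?_, ?_, ?_, ?_⟩ <;> linarith

/-- The partitions of `Fin 8` into two increasing quadruples, the first one containing `0`. -/
def quadPairs : List (Fin 8 × Fin 8 × Fin 8 × Fin 8 × Fin 8 × Fin 8 × Fin 8 × Fin 8) :=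
  [(0, 1, 2, 7, 3, 4, 5, 6), (0, 1, 3, 5, 2, 4, 6, 7), (0, 1, 4, 6, 2, 3, 5, 7),
   (0, 2, 3, 6, 1, 4, 5, 7), (0, 2, 4, 5, 1, 3, 6, 7), (0, 3, 4, 7, 1, 2, 5, 6),
   (0, 5, 6, 7, 1, 2, 3, 4), (0, 2, 3, 4, 1, 5, 6, 7), (0, 2, 5, 6, 1, 3, 4, 7),
   (0, 3, 6, 7, 1, 2, 4, 5), (0, 4, 5, 7, 1, 2, 3, 6), (0, 1, 3, 4, 2, 5, 6, 7),
   (0, 1, 5, 6, 2, 3, 4, 7), (0, 3, 5, 7, 1, 2, 4, 6), (0, 4, 6, 7, 1, 2, 3, 5),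
   (0, 1, 3, 6, 2, 4, 5, 7), (0, 1, 4, 5, 2, 3, 6, 7), (0, 2, 3, 5, 1, 4, 6, 7),
   (0, 2, 4, 6, 1, 3, 5, 7), (0, 1, 2, 4, 3, 5, 6, 7), (0, 1, 6, 7, 2, 3, 4, 5),
   (0, 2, 5, 7, 1, 3, 4, 6), (0, 4, 5, 6, 1, 2, 3, 7), (0, 1, 2, 6, 3, 4, 5, 7),
   (0, 1, 4, 7, 2, 3, 5, 6), (0, 2, 3, 7, 1, 4, 5, 6), (0, 3, 4, 6, 1, 2, 5, 7),
   (0, 1, 2, 5, 3, 4, 6, 7), (0, 1, 3, 7, 2, 4, 5, 6), (0, 2, 4, 7, 1, 3, 5, 6),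
   (0, 3, 4, 5, 1, 2, 6, 7), (0, 1, 2, 3, 4, 5, 6, 7), (0, 1, 5, 7, 2, 3, 4, 6),
   (0, 2, 6, 7, 1, 3, 4, 5), (0, 3, 5, 6, 1, 2, 4, 7)]

/-- The relative order of two indices. -/
def orderSign (i j : Fin 8) : ℤ := if i < j then 1 else if j < i then -1 else 0

theorem orderSign_comm (i j : Fin 8) : orderSign j i = -orderSign i j := by
  unfold orderSign; split_ifs <;> first | rfl | omega

/-- The sign of a permutation of `Fin 8`, in terms of its values. -/
def octSign (a b c d p q r s : Fin 8) : ℤ :=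
  (orderSign a b * orderSign a c * orderSign a d * orderSign b c * orderSign b d * orderSign c d)
    * (orderSign p q * orderSign p r * orderSign p s * orderSign q r * orderSign q s
      * orderSign r s)
    * ((orderSign a p * orderSign a q * orderSign a r * orderSign a s)
      * (orderSign b p * orderSign b q * orderSign b r * orderSign b s)
      * (orderSign c p * orderSign c q * orderSign c r * orderSign c s)
      * (orderSign d p * orderSign d q * orderSign d r * orderSign d s))

theorem selfDual_of_mem_quadPairs (h₀ : ∀ i j k l, H j i k l = -H i j k l)
    (h₁ : ∀ i j k l, H i k j l = -H i j k l) (h₂ : ∀ i j k l, H i j l k = -H i j k l)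
    (hE : ∀ j k, contr₃ (H j) k = 0) : ∀ t ∈ quadPairs,
    H t.2.2.2.2.1 t.2.2.2.2.2.1 t.2.2.2.2.2.2.1 t.2.2.2.2.2.2.2
      = (octSign t.1 t.2.1 t.2.2.1 t.2.2.2.1 t.2.2.2.2.1 t.2.2.2.2.2.1 t.2.2.2.2.2.2.1
          t.2.2.2.2.2.2.2 : ℝ) * H t.1 t.2.1 t.2.2.1 t.2.2.2.1 := by
  obtain ⟨c0, c1, c2, c3, c4, c5, c6⟩ := selfDual_label_0 h₀ h₁ h₂ hE
  obtain ⟨c7, c8, c9, c10⟩ := selfDual_label_1 h₀ h₁ h₂ hE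
  obtain ⟨c11, c12, c13, c14⟩ := selfDual_label_2 h₀ h₁ h₂ hE
  obtain ⟨c15, c16, c17, c18⟩ := selfDual_label_3 h₀ h₁ h₂ hE
  obtain ⟨c19, c20, c21, c22⟩ := selfDual_label_4 h₀ h₁ h₂ hE
  obtain ⟨c23, c24, c25, c26⟩ := selfDual_label_5 h₀ h₁ h₂ hE
  obtain ⟨c27, c28, c29, c30⟩ := selfDual_label_6 h₀ h₁ h₂ hE
  obtain ⟨c31, c32, c33, c34⟩ := selfDual_label_7 h₀ h₁ h₂ hE
  simp only [quadPairs, List.forall_mem_cons, List.not_mem_nil, IsEmpty.forall_iff,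
    implies_true, and_true]
  simp only [octSign, orderSign, Fin.reduceLT, if_true, if_false, mul_one, mul_neg, neg_mul,
    neg_neg, Int.cast_one, Int.cast_neg, one_mul]
  exact ⟨c0, c1, c2, c3, c4, c5, c6, c7, c8, c9, c10, c11, c12, c13, c14, c15, c16, c17, c18, c19,
    c20, c21, c22, c23, c24, c25, c26, c27, c28, c29, c30, c31, c32, c33, c34⟩

end SelfDual

/-! ### From increasing quadruples to all permutations -/

section SelfDual

variable {H : Fin 8 → Fin 8 → Fin 8 → Fin 8 → ℝ}
set_option synthInstance.maxHeartbeats 400000 in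
set_option synthInstance.maxSize 1000 in
theorem mem_quadPairs : ∀ a b : Fin 8, a < b → ∀ c, b < c → ∀ d, c < d → ∀ p, p ∉ [a, b, c, d] →
    ∀ q, p < q → q ∉ [a, b, c, d] → ∀ r, q < r → r ∉ [a, b, c, d] →
    ∀ s, r < s → s ∉ [a, b, c, d] →
    (a, b, c, d, p, q, r, s) ∈ quadPairs ∨ (p, q, r, s, a, b, c, d) ∈ quadPairs := by
  decide +kernel

/-- A property of quadruples that is invariant under adjacent transpositions holds if it holds for
increasing quadruples and for those with two equal neighbours. -/
theorem quad_sort {Z : Fin 8 → Fin 8 → Fin 8 → Fin 8 → Prop}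
    (z₀ : ∀ a b c d, Z a b c d → Z b a c d) (z₁ : ∀ a b c d, Z a b c d → Z a c b d)
    (z₂ : ∀ a b c d, Z a b c d → Z a b d c)
    (he : ∀ a b c d, a = b ∨ b = c ∨ c = d → Z a b c d)
    (hs : ∀ a b c d, a < b → b < c → c < d → Z a b c d) (a b c d : Fin 8) : Z a b c d := by
  have perm (τ : Equiv.Perm (Fin 4)) : ∀ f : Fin 4 → Fin 8, Z (f 0) (f 1) (f 2) (f 3) →
      Z (f (τ 0)) (f (τ 1)) (f (τ 2)) (f (τ 3)) := by
    have hτ : τ ∈ Submonoid.closure (Set.range fun i : Fin 3 ↦ Equiv.swap i.castSucc i.succ) := by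
      rw [Equiv.Perm.mclosure_swap_castSucc_succ]; trivial
    induction hτ using Submonoid.closure_induction with
    | mem x hx =>
      obtain ⟨i, rfl⟩ := hx
      intro f hf
      fin_cases i
      · exact z₀ _ _ _ _ hf
      · exact z₁ _ _ _ _ hf
      · exact z₂ _ _ _ _ hf
    | one => exact fun f hf => hf
    | mul x y _ _ hx hy => exact fun f hf => hy (f ∘ x) (hx f hf)
  have hmono := Tuple.monotone_sort ![a, b, c, d]
  set τ := Tuple.sort ![a, b, c, d]
  have key : Z (![a, b, c, d] (τ 0)) (![a, b, c, d] (τ 1)) (![a, b, c, d] (τ 2))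
      (![a, b, c, d] (τ 3)) := by
    have m₀ : ![a, b, c, d] (τ 0) ≤ ![a, b, c, d] (τ 1) := hmono (by decide)
    have m₁ : ![a, b, c, d] (τ 1) ≤ ![a, b, c, d] (τ 2) := hmono (by decide)
    have m₂ : ![a, b, c, d] (τ 2) ≤ ![a, b, c, d] (τ 3) := hmono (by decide)
    rcases m₀.eq_or_lt with m₀ | m₀
    · exact he _ _ _ _ (Or.inl m₀)
    rcases m₁.eq_or_lt with m₁ | m₁
    · exact he _ _ _ _ (Or.inr (Or.inl m₁))
    rcases m₂.eq_or_lt with m₂ | m₂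
    · exact he _ _ _ _ (Or.inr (Or.inr m₂))
    exact hs _ _ _ _ m₀ m₁ m₂
  simpa using perm τ⁻¹ (fun i => ![a, b, c, d] (τ i)) key

/-- The sign counts inversions, and `orderSign` is never zero on distinct values. The grouping in
`octSign` separates the order within each quadruple from the order between the two, which is what
sorting each quadruple separately requires. -/
theorem sign_eq_octSign (σ : Equiv.Perm (Fin 8)) :
    (Equiv.Perm.sign σ : ℤ)
      = octSign (σ 0) (σ 1) (σ 2) (σ 3) (σ 4) (σ 5) (σ 6) (σ 7) := by
  have o (i j : Fin 8) (h : i ≠ j) :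
      ((if σ i < σ j then 1 else -1 : ℤˣ) : ℤ) = orderSign (σ i) (σ j) := by
    have := σ.injective.ne h
    unfold orderSign; split_ifs <;> first | rfl | omega
  have I (i : Fin 8) (s : Finset (Fin 8)) (h : Finset.Ioi i = s) :
      ∏ j ∈ Finset.Ioi i, (if σ i < σ j then 1 else -1 : ℤˣ)
        = ∏ j ∈ s, (if σ i < σ j then 1 else -1 : ℤˣ) := by rw [h]
  rw [Equiv.Perm.sign_eq_prod_prod_Ioi, Fin.prod_univ_eight, I 0 {1, 2, 3, 4, 5, 6, 7} (by decide),
    I 1 {2, 3, 4, 5, 6, 7} (by decide), I 2 {3, 4, 5, 6, 7} (by decide),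
    I 3 {4, 5, 6, 7} (by decide), I 4 {5, 6, 7} (by decide), I 5 {6, 7} (by decide),
    I 6 {7} (by decide), I 7 ∅ (by decide)]
  simp (discharger := decide) only [Finset.prod_insert, Finset.prod_singleton, Finset.prod_empty,
    Units.val_mul, Units.val_one, o, octSign]
  ring

/-- A 4-form in the kernel of the contraction with the standard 4-form is self-dual. -/
theorem selfDual_of_contr₃_eq_zero (h₀ : ∀ i j k l, H j i k l = -H i j k l)
    (h₁ : ∀ i j k l, H i k j l = -H i j k l) (h₂ : ∀ i j k l, H i j l k = -H i j k l)
    (hE : ∀ j k, contr₃ (H j) k = 0) (σ : Equiv.Perm (Fin 8)) :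
    H (σ 4) (σ 5) (σ 6) (σ 7) = ((Equiv.Perm.sign σ : ℤ) : ℝ) * H (σ 0) (σ 1) (σ 2) (σ 3) := by
  -- Both sides change sign under an adjacent transposition inside either quadruple, so `quad_sort`
  -- is applied twice, first to `p, q, r, s` and then to `a, b, c, d`.
  have main (a b c d p q r s : Fin 8) : p ∉ [a, b, c, d] → q ∉ [a, b, c, d] → r ∉ [a, b, c, d] →
      s ∉ [a, b, c, d] → [a, b, c, d].Nodup → [p, q, r, s].Nodup →
      H p q r s = (octSign a b c d p q r s : ℝ) * H a b c d := by
    revert a b c d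
    refine quad_sort (Z := fun p q r s => ∀ a b c d : Fin 8, p ∉ [a, b, c, d] → q ∉ [a, b, c, d] →
      r ∉ [a, b, c, d] → s ∉ [a, b, c, d] → [a, b, c, d].Nodup → [p, q, r, s].Nodup →
      H p q r s = (octSign a b c d p q r s : ℝ) * H a b c d) ?_ ?_ ?_ ?_ ?_ p q r s
    · intro p q r s h a b c d hq hp hr hs hn hm
      have := h a b c d hp hq hr hs hn (by simp only [List.nodup_cons, List.mem_cons] at hm ⊢; grind)
      rw [h₀, this, octSign, octSign, orderSign_comm p q]; push_cast; ring
    · intro p q r s h a b c d hp hr hq hs hn hm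
      have := h a b c d hp hq hr hs hn (by simp only [List.nodup_cons, List.mem_cons] at hm ⊢; grind)
      rw [h₁, this, octSign, octSign, orderSign_comm q r]; push_cast; ring
    · intro p q r s h a b c d hp hq hs hr hn hm
      have := h a b c d hp hq hr hs hn (by simp only [List.nodup_cons, List.mem_cons] at hm ⊢; grind)
      rw [h₂, this, octSign, octSign, orderSign_comm r s]; push_cast; ring
    · intro p q r s h a b c d _ _ _ _ _ hm
      simp only [List.nodup_cons, List.mem_cons] at hm
      grind
    intro p q r s hpq hqr hrs
    refine quad_sort ?_ ?_ ?_ ?_ ?_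
    · intro a b c d h hp hq hr hs hn hm
      have := h (by grind) (by grind) (by grind) (by grind)
        (by simp only [List.nodup_cons, List.mem_cons] at hn ⊢; grind) hm
      rw [this, h₀, octSign, octSign, orderSign_comm a b]; push_cast; ring
    · intro a b c d h hp hq hr hs hn hm
      have := h (by grind) (by grind) (by grind) (by grind)
        (by simp only [List.nodup_cons, List.mem_cons] at hn ⊢; grind) hm
      rw [this, h₁, octSign, octSign, orderSign_comm b c]; push_cast; ring
    · intro a b c d h hp hq hr hs hn hm
      have := h (by grind) (by grind) (by grind) (by grind)
        (by simp only [List.nodup_cons, List.mem_cons] at hn ⊢; grind) hm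
      rw [this, h₂, octSign, octSign, orderSign_comm c d]; push_cast; ring
    · intro a b c d h _ _ _ _ hn _
      simp only [List.nodup_cons, List.mem_cons] at hn
      grind
    intro a b c d hab hbc hcd hp hq hr hs hn hm
    rcases mem_quadPairs a b hab c hbc d hcd p hp q hpq hq r hqr hr s hrs hs with h | h
    · exact selfDual_of_mem_quadPairs h₀ h₁ h₂ hE _ h
    · have e := selfDual_of_mem_quadPairs h₀ h₁ h₂ hE _ h
      have hsq : octSign a b c d p q r s * octSign p q r s a b c d = 1 := by
        have o {i j : Fin 8} (hij : i ≠ j) : orderSign i j ^ 2 = 1 := by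
          unfold orderSign; split_ifs <;> first | rfl | omega
        -- Exchanging the quadruples reverses sixteen comparisons, an even number.
        have comm : octSign p q r s a b c d = octSign a b c d p q r s := by
          simp only [octSign, orderSign_comm a p, orderSign_comm a q, orderSign_comm a
            r, orderSign_comm a s, orderSign_comm b p, orderSign_comm b q,
            orderSign_comm b r, orderSign_comm b s, orderSign_comm c p, orderSign_comm c
            q, orderSign_comm c r, orderSign_comm c s, orderSign_comm d p,
            orderSign_comm d q, orderSign_comm d r, orderSign_comm d s]
          ring
        simp only [List.mem_cons, not_or] at hp hq hr hs
        rw [comm, ← sq, octSign]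
        simp only [mul_pow, o hab.ne, o hbc.ne, o hcd.ne, o (hab.trans hbc).ne,
          o (hbc.trans hcd).ne, o (hab.trans (hbc.trans hcd)).ne, o hpq.ne, o hqr.ne, o hrs.ne,
          o (hpq.trans hqr).ne, o (hqr.trans hrs).ne, o (hpq.trans (hqr.trans hrs)).ne,
          o (Ne.symm hp.1), o (Ne.symm hp.2.1), o (Ne.symm hp.2.2.1), o (Ne.symm hp.2.2.2.1),
          o (Ne.symm hq.1), o (Ne.symm hq.2.1), o (Ne.symm hq.2.2.1), o (Ne.symm hq.2.2.2.1),
          o (Ne.symm hr.1), o (Ne.symm hr.2.1), o (Ne.symm hr.2.2.1), o (Ne.symm hr.2.2.2.1),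
          o (Ne.symm hs.1), o (Ne.symm hs.2.1), o (Ne.symm hs.2.2.1), o (Ne.symm hs.2.2.2.1),
          mul_one]
      rw [e, ← mul_assoc, ← Int.cast_mul, hsq]; simp
  rw [main (σ 0) (σ 1) (σ 2) (σ 3) (σ 4) (σ 5) (σ 6) (σ 7), sign_eq_octSign]
  all_goals simp

end SelfDual

/-! ### Calculus of vector fields -/

section Calculus

open VectorField

variable {M : Type*} [TopologicalSpace M] [ChartedSpace E8 M]

/-- Vector fields, without regularity. -/
abbrev VF (M : Type*) [TopologicalSpace M] [ChartedSpace E8 M] : Type _ :=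
  Π x : M, TangentSpace 𝓘(ℝ, E8) x

/-- Differentiability of a function at a point. -/
abbrev DiffFn (f : M → ℝ) (x : M) : Prop := MDifferentiableAt 𝓘(ℝ, E8) 𝓘(ℝ, ℝ) f x

/-- Smoothness of a function on a set. -/
abbrev SmoothFn (f : M → ℝ) (U : Set M) : Prop := ContMDiffOn 𝓘(ℝ, E8) 𝓘(ℝ, ℝ) ∞ f U

theorem two_le_infty : (2 : WithTop ℕ∞) ≤ ∞ := WithTop.coe_le_coe.2 (le_top : (2 : ℕ∞) ≤ ⊤)

theorem three_le_infty : (3 : WithTop ℕ∞) ≤ ∞ := WithTop.coe_le_coe.2 (le_top : (3 : ℕ∞) ≤ ⊤)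

section Derivative

variable {X : VF M} {f g : M → ℝ} {x : M}

theorem lieD_mul (hf : DiffFn f x) (hg : DiffFn g x) :
    lieD X (fun y => f y * g y) x = f x * lieD X g x + g x * lieD X f x := by
  have := mvfderiv_fun_mul hf hg
  simp [lieD, this]

theorem lieD_add (hf : DiffFn f x) (hg : DiffFn g x) :
    lieD X (fun y => f y + g y) x = lieD X f x + lieD X g x := by
  have := mvfderiv_fun_add hf hg
  simp [lieD, this]

theorem lieD_const (c : ℝ) : lieD X (fun _ => c) x = 0 := by
  rw [lieD, mvfderiv_const]; rfl

theorem lieD_const_mul (hf : DiffFn f x) (c : ℝ) :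
    lieD X (fun y => c * f y) x = c * lieD X f x := by
  rw [lieD_mul mdifferentiableAt_const hf, lieD_const]; ring

theorem lieD_congr (h : f =ᶠ[nhds x] g) : lieD X f x = lieD X g x := by
  have := h.mfderiv_eq (I := 𝓘(ℝ, E8)) (I' := 𝓘(ℝ, ℝ))
  simp only [lieD, mvfderiv]
  rw [this]
  rfl

theorem diffFn_sum {ι : Type*} (s : Finset ι) {F : ι → M → ℝ} (h : ∀ i ∈ s, DiffFn (F i) x) :
    DiffFn (fun y => ∑ i ∈ s, F i y) x := by
  classical
  induction s using Finset.induction_on with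
  | empty => simpa using mdifferentiableAt_const
  | insert a s ha ih =>
    simp only [Finset.sum_insert ha]
    exact (h a (Finset.mem_insert_self a s)).add (ih fun i hi => h i (Finset.mem_insert_of_mem hi))

theorem lieD_sum {ι : Type*} (s : Finset ι) {F : ι → M → ℝ} (h : ∀ i ∈ s, DiffFn (F i) x) :
    lieD X (fun y => ∑ i ∈ s, F i y) x = ∑ i ∈ s, lieD X (F i) x := by
  classical
  induction s using Finset.induction_on with
  | empty => simpa using lieD_const 0
  | insert a s ha ih =>
    have h' := fun i hi => h i (Finset.mem_insert_of_mem hi)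
    simp only [Finset.sum_insert ha]
    rw [lieD_add (h a (Finset.mem_insert_self a s)) (diffFn_sum s h'), ih h']

theorem lieD_eq_sum {ι : Type*} [Fintype ι] {e : ι → VF M} {c : ι → ℝ}
    (h : X x = ∑ i, c i • e i x) :
    lieD X f x = ∑ i, c i * lieD (e i) f x := by
  simp [lieD, h]

theorem SmoothFn.diffFn {U : Set M} (hf : SmoothFn f U) (hU : IsOpen U) (hx : x ∈ U) :
    DiffFn f x :=
  (hf.contMDiffAt (hU.mem_nhds hx)).mdifferentiableAt (by simp)

theorem SmoothFn.sum {ι : Type*} {U : Set M} (s : Finset ι) {F : ι → M → ℝ}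
    (h : ∀ i ∈ s, SmoothFn (F i) U) : SmoothFn (fun y => ∑ i ∈ s, F i y) U := by
  classical
  induction s using Finset.induction_on with
  | empty => simpa using contMDiffOn_const
  | insert a s ha ih =>
    simp only [Finset.sum_insert ha]
    exact (h a (Finset.mem_insert_self a s)).add (ih fun i hi => h i (Finset.mem_insert_of_mem hi))

theorem bracket_swap {Y : VF M} : bracket X Y x = -bracket Y X x := mlieBracket_swap_apply

theorem bracket_congr {Y X' Y' : VF M} (hX : X =ᶠ[nhds x] X') (hY : Y =ᶠ[nhds x] Y') :
    bracket X Y x = bracket X' Y' x := hX.mlieBracket_vectorField_eq hY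

theorem bracket_congr_left {Y X' : VF M} (hX : ∀ᶠ z in nhds x, X z = X' z) :
    bracket X Y x = bracket X' Y x := bracket_congr hX (Filter.EventuallyEq.refl _ Y)

theorem bracket_congr_right {Y Y' : VF M} (hY : ∀ᶠ z in nhds x, Y z = Y' z) :
    bracket X Y x = bracket X Y' x := bracket_congr (Filter.EventuallyEq.refl _ X) hY

end Derivative

variable [IsManifold 𝓘(ℝ, E8) ∞ M]

/-- Differentiability of a vector field at a point. -/
abbrev DiffVF (X : VF M) (x : M) : Prop :=
  MDifferentiableAt 𝓘(ℝ, E8) 𝓘(ℝ, E8).tangent (fun y => (X y : TangentBundle 𝓘(ℝ, E8) M)) x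

/-- Smoothness of a vector field on a set. -/
abbrev SmoothVF (X : VF M) (U : Set M) : Prop :=
  ContMDiffOn 𝓘(ℝ, E8) 𝓘(ℝ, E8).tangent ∞ (fun y => (X y : TangentBundle 𝓘(ℝ, E8) M)) U

section Bracket

variable {X Y Z : VF M} {f : M → ℝ} {x : M} {U : Set M}

theorem SmoothVF.diffVF (hX : SmoothVF X U) (hU : IsOpen U) (hx : x ∈ U) : DiffVF X x :=
  (hX.contMDiffAt (hU.mem_nhds hx)).mdifferentiableAt (by simp)

theorem SmoothVF.bracket (hX : SmoothVF X U) (hY : SmoothVF Y U) (hU : IsOpen U) :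
    SmoothVF (bracket X Y) U := fun y hy =>
  have : IsManifold 𝓘(ℝ, E8) (((⊤ : ℕ∞) : WithTop ℕ∞) + 1) M := ‹IsManifold 𝓘(ℝ, E8) ∞ M›
  have : IsManifold 𝓘(ℝ, E8) (minSmoothness ℝ 2) M :=
    IsManifold.of_le (n := ∞) (by simpa using two_le_infty)
  (ContMDiffAt.mlieBracket_vectorField (m := ⊤) (n := ⊤) (hX.contMDiffAt (hU.mem_nhds hy))
    (hY.contMDiffAt (hU.mem_nhds hy)) (by simp)).contMDiffWithinAt

theorem SmoothVF.smul (hX : SmoothVF X U) (hf : SmoothFn f U) : SmoothVF (fun y => f y • X y) U :=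
  ContMDiffOn.smul_section hf hX

theorem SmoothVF.sum {ι : Type*} (s : Finset ι) {F : ι → VF M}
    (h : ∀ i ∈ s, SmoothVF (F i) U) : SmoothVF (fun y => ∑ i ∈ s, F i y) U :=
  ContMDiffOn.sum_section h

theorem DiffVF.smul (hX : DiffVF X x) (hf : DiffFn f x) : DiffVF (fun y => f y • X y) x :=
  MDifferentiableAt.smul_section hf hX

theorem DiffVF.sum {ι : Type*} (s : Finset ι) {F : ι → VF M}
    (h : ∀ i ∈ s, DiffVF (F i) x) : DiffVF (fun y => ∑ i ∈ s, F i y) x :=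
  MDifferentiableAt.sum_section h

theorem bracket_smul_right (hf : DiffFn f x) (hY : DiffVF Y x) :
    bracket X (fun y => f y • Y y) x = lieD X f x • Y x + f x • bracket X Y x :=
  mlieBracket_smul_right hf hY

theorem bracket_smul_left (hf : DiffFn f x) (hX : DiffVF X x) :
    bracket (fun y => f y • X y) Y x = -lieD Y f x • X x + f x • bracket X Y x := by
  rw [bracket_swap, bracket_smul_right hf hX, bracket_swap (X := X)]
  module

theorem bracket_sum_right {ι : Type*} (s : Finset ι) {F : ι → VF M}
    (h : ∀ i ∈ s, DiffVF (F i) x) :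
    bracket X (fun y => ∑ i ∈ s, F i y) x = ∑ i ∈ s, bracket X (F i) x := by
  classical
  induction s using Finset.induction_on with
  | empty =>
    simp only [Finset.sum_empty]
    exact congrFun mlieBracket_zero_right x
  | insert a s ha ih =>
    have h' := fun i hi => h i (Finset.mem_insert_of_mem hi)
    simp only [Finset.sum_insert ha]
    rw [← ih h']
    exact mlieBracket_add_right (h a (Finset.mem_insert_self a s)) (DiffVF.sum s h')

theorem bracket_sum_left {ι : Type*} (s : Finset ι) {F : ι → VF M}
    (h : ∀ i ∈ s, DiffVF (F i) x) :
    bracket (fun y => ∑ i ∈ s, F i y) X x = ∑ i ∈ s, bracket (F i) X x := by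
  rw [bracket_swap, bracket_sum_right s h, ← Finset.sum_neg_distrib]
  exact Finset.sum_congr rfl fun i _ => bracket_swap.symm

theorem bracket_leibniz (hX : SmoothVF X U) (hY : SmoothVF Y U) (hZ : SmoothVF Z U)
    (hU : IsOpen U) (hx : x ∈ U) :
    bracket X (bracket Y Z) x = bracket (bracket X Y) Z x + bracket Y (bracket X Z) x := by
  have h {X : VF M} (hX : SmoothVF X U) := (hX.contMDiffAt (hU.mem_nhds hx)).of_le
    (show minSmoothness ℝ 2 ≤ ∞ by simpa using two_le_infty)
  have : IsManifold 𝓘(ℝ, E8) (minSmoothness ℝ 3) M :=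
    IsManifold.of_le (n := ∞) (by simpa using three_le_infty)
  exact leibniz_identity_mlieBracket_apply (h hX) (h hY) (h hZ)

/-- In the trivialization centred at `x` the extension is a constant section. -/
theorem smoothVF_ext (v : TangentSpace 𝓘(ℝ, E8) x) : SmoothVF (ext v) (chartAt E8 x).source := by
  set t := trivializationAt E8 (TangentSpace 𝓘(ℝ, E8) : M → Type _) x with ht
  have hb : t.baseSet = (chartAt E8 x).source := TangentBundle.trivializationAt_baseSet x
  intro y hy
  rw [← hb] at hy ⊢
  rw [t.contMDiffWithinAt_section _ hy]
  refine (contMDiffWithinAt_const (c := (t ⟨x, v⟩).2)).congr (fun z hz => ?_) ?_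
  · simp [ext, FiberBundle.extend, ← ht, hz]
  · simp [ext, FiberBundle.extend, ← ht, hy]

theorem ext_self (v : TangentSpace 𝓘(ℝ, E8) x) : ext v x = v := FiberBundle.extend_apply_self _ v

theorem diffVF_ext (v : TangentSpace 𝓘(ℝ, E8) x) : DiffVF (ext v) x :=
  (smoothVF_ext v).diffVF (chartAt E8 x).open_source (mem_chart_source E8 x)

end Bracket

end Calculus

/-! ### Orthonormal frames -/

section Frames

variable {M : Type*} [TopologicalSpace M] [ChartedSpace E8 M] [IsManifold 𝓘(ℝ, E8) ∞ M]
  [Bundle.RiemannianBundle (fun x : M => TangentSpace 𝓘(ℝ, E8) x)]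

/-- A smooth orthonormal frame on an open set. -/
structure OrthoFrame (e : Fin 8 → VF M) (U : Set M) : Prop where
  isOpen : IsOpen U
  smooth (i : Fin 8) : SmoothVF (e i) U
  orthonormal {y : M} (hy : y ∈ U) : Orthonormal ℝ (fun i => e i y)
  span {y : M} (hy : y ∈ U) : ⊤ ≤ Submodule.span ℝ (Set.range fun i => e i y)

/-- The components of a vector in a frame. -/
def comp (e : Fin 8 → VF M) {y : M} (u : TangentSpace 𝓘(ℝ, E8) y) (i : Fin 8) : ℝ :=
  inner ℝ (e i y) u

variable {e : Fin 8 → VF M} {U : Set M} {X Y Z : VF M} {y : M}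

theorem comp_add (u v : TangentSpace 𝓘(ℝ, E8) y) (i : Fin 8) :
    comp e (u + v) i = comp e u i + comp e v i := inner_add_right _ _ _

theorem comp_smul (c : ℝ) (u : TangentSpace 𝓘(ℝ, E8) y) (i : Fin 8) :
    comp e (c • u) i = c * comp e u i := real_inner_smul_right _ _ _

theorem comp_neg (u : TangentSpace 𝓘(ℝ, E8) y) (i : Fin 8) :
    comp e (-u) i = -comp e u i := inner_neg_right _ _

theorem comp_sub (u v : TangentSpace 𝓘(ℝ, E8) y) (i : Fin 8) :
    comp e (u - v) i = comp e u i - comp e v i := inner_sub_right _ _ _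

theorem comp_sum {ι : Type*} (s : Finset ι) (u : ι → TangentSpace 𝓘(ℝ, E8) y) (i : Fin 8) :
    comp e (∑ a ∈ s, u a) i = ∑ a ∈ s, comp e (u a) i := inner_sum _ _ _

/-- The structure functions of a frame. -/
def structFn (e : Fin 8 → VF M) (y : M) (i j k : Fin 8) : ℝ :=
  comp e (bracket (e i) (e j) y) k

/-- The Christoffel symbols of the Levi-Civita connection in an orthonormal frame. -/
def christoffel (e : Fin 8 → VF M) (y : M) (i j k : Fin 8) : ℝ :=
  (1 / 2) * (structFn e y i j k - structFn e y i k j - structFn e y j k i)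

theorem structFn_swap (i j k : Fin 8) : structFn e y j i k = -structFn e y i j k := by
  rw [structFn, bracket_swap, comp_neg, structFn]

theorem christoffel_swap (i j k : Fin 8) : christoffel e y i k j = -christoffel e y i j k := by
  simp only [christoffel, structFn_swap j k]; ring

theorem structFn_eq (i j k : Fin 8) :
    structFn e y i j k = christoffel e y i j k - christoffel e y j i k := by
  simp only [christoffel, structFn_swap i j]; ring

namespace OrthoFrame

section Pointwise

/-- The orthonormal basis given by a frame. -/
def basis (F : OrthoFrame e U) (hy : y ∈ U) : OrthonormalBasis (Fin 8) ℝ (TangentSpace 𝓘(ℝ, E8) y) :=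
  OrthonormalBasis.mk (F.orthonormal hy) (F.span hy)

theorem basis_apply (F : OrthoFrame e U) (hy : y ∈ U) (i : Fin 8) : F.basis hy i = e i y := by simp [basis]

theorem sum_comp (F : OrthoFrame e U) (hy : y ∈ U) (u : TangentSpace 𝓘(ℝ, E8) y) : u = ∑ i, comp e u i • e i y := by
  have h := (F.basis hy).sum_repr' u
  simp only [basis_apply] at h
  exact h.symm

theorem inner_eq (F : OrthoFrame e U) (hy : y ∈ U) (u v : TangentSpace 𝓘(ℝ, E8) y) :
    inner ℝ u v = ∑ i, comp e u i * comp e v i := by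
  rw [← (F.basis hy).sum_inner_mul_inner u v]
  simp only [basis_apply, comp, real_inner_comm]

theorem comp_frame (F : OrthoFrame e U) (hy : y ∈ U) (i j : Fin 8) : comp e (e i y) j = kron i j := by
  have := orthonormal_iff_ite.1 (F.orthonormal hy) j i
  simp only [comp, kron, this, eq_comm]

theorem sum_comp_onb (F : OrthoFrame e U) (hy : y ∈ U) (i j : Fin 8) : ∑ a, comp e (onb y a) i * comp e (onb y a) j = kron i j := by
  rw [← F.comp_frame hy, comp, ← (onb y).sum_inner_mul_inner]
  exact Finset.sum_congr rfl fun a _ => by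
    rw [comp, comp, real_inner_comm (e i y), mul_comm]

end Pointwise

theorem eventually_eq_sum (F : OrthoFrame e U) (hy : y ∈ U) (X : VF M) :
    ∀ᶠ z in nhds y, X z = ∑ i, comp e (X z) i • e i z := by
  filter_upwards [F.isOpen.mem_nhds hy] with z hz using F.sum_comp hz (X z)

theorem diffVF (F : OrthoFrame e U) (hy : y ∈ U) (i : Fin 8) : DiffVF (e i) y := (F.smooth i).diffVF F.isOpen hy

variable [IsContMDiffRiemannianBundle 𝓘(ℝ, E8) ∞ E8 (fun x : M => TangentSpace 𝓘(ℝ, E8) x)]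

set_option synthInstance.maxHeartbeats 200000 in
theorem diffFn_comp (F : OrthoFrame e U) (hy : y ∈ U) (hX : DiffVF X y) (i : Fin 8) :
    DiffFn (fun z => comp e (X z) i) y :=
  MDifferentiableAt.inner_bundle (F.diffVF hy i) hX

theorem smoothFn_comp (F : OrthoFrame e U) {V : Set M} (hV : V ⊆ U) (hX : SmoothVF X V) (i : Fin 8) :
    SmoothFn (fun z => comp e (X z) i) V :=
  ContMDiffOn.inner_bundle ((F.smooth i).mono hV) hX

theorem smoothVF_of_comp (F : OrthoFrame e U) {V : Set M} (hV : V ⊆ U) (h : ∀ i, SmoothFn (fun z => comp e (X z) i) V) :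
    SmoothVF X V :=
  (SmoothVF.sum (U := V) Finset.univ fun i _ => SmoothVF.smul ((F.smooth i).mono hV) (h i)).congr
    fun z hz => congrArg _ (F.sum_comp (hV hz) (X z))

theorem comp_bracket (F : OrthoFrame e U) (hy : y ∈ U) (hX : DiffVF X y) (hY : DiffVF Y y) (k : Fin 8) :
    comp e (bracket X Y y) k
      = lieD X (fun z => comp e (Y z) k) y - lieD Y (fun z => comp e (X z) k) y
        + ∑ i, ∑ j, comp e (X y) i * comp e (Y y) j * structFn e y i j k := by
  have hXc := F.diffFn_comp hy hX
  have hYc := F.diffFn_comp hy hY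
  have hd (f : M → ℝ) (hf : DiffFn f y) (i : Fin 8) : DiffVF (fun z => f z • e i z) y :=
    (F.diffVF hy i).smul hf
  have h₁ (i : Fin 8) : bracket (e i) Y y
      = ∑ j, (lieD (e i) (fun z => comp e (Y z) j) y • e j y
        + comp e (Y y) j • bracket (e i) (e j) y) := by
    rw [bracket_congr_right (F.eventually_eq_sum hy Y),
      bracket_sum_right _ fun j _ => hd _ (hYc j) j]
    exact Finset.sum_congr rfl fun j _ => bracket_smul_right (hYc j) (F.diffVF hy j)
  have h₂ : bracket X Y y = ∑ i, (-lieD Y (fun z => comp e (X z) i) y • e i y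
        + comp e (X y) i • bracket (e i) Y y) := by
    rw [bracket_congr_left (F.eventually_eq_sum hy X),
      bracket_sum_left _ fun j _ => hd _ (hXc j) j]
    exact Finset.sum_congr rfl fun j _ => bracket_smul_left (hXc j) (F.diffVF hy j)
  have hl : lieD X (fun z => comp e (Y z) k) y
      = ∑ i, comp e (X y) i * lieD (e i) (fun z => comp e (Y z) k) y :=
    lieD_eq_sum (F.sum_comp hy (X y))
  rw [h₂, hl]
  simp only [h₁, comp_sum, comp_add, comp_smul, F.comp_frame hy, Finset.sum_add_distrib,
    sum_mul_kron', Finset.mul_sum, mul_add, neg_mul, Finset.sum_neg_distrib, structFn, mul_assoc]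
  ring

/-- `X f` is the component along `e 0` of `[X, f e₀] - f [X, e₀]`, so its smoothness follows from
that of brackets. -/
theorem smoothFn_lieD (F : OrthoFrame e U) {V : Set M} {f : M → ℝ} (hVo : IsOpen V) (hV : V ⊆ U) (hX : SmoothVF X V)
    (hf : SmoothFn f V) : SmoothFn (lieD X f) V := by
  have he : SmoothVF (e 0) V := (F.smooth 0).mono hV
  have h₁ := F.smoothFn_comp hV ((hX.bracket (he.smul hf) hVo)) 0
  have h₂ := F.smoothFn_comp hV (hX.bracket he hVo) 0
  refine (h₁.sub (hf.mul h₂)).congr fun z hz => ?_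
  have := bracket_smul_right (X := X) (hf.diffFn hVo hz) (F.diffVF (hV hz) 0)
  simp only [this, comp_add, comp_smul, F.comp_frame (hV hz), kron_self]
  simp

/-- The Jacobi identity for `X`, `Y` and `f e₀` is expanded by the product rule. After subtracting
`f` times the Jacobi identity for `e₀`, the component along `e₀` is the assertion. -/
theorem lieD_bracket (F : OrthoFrame e U) {V : Set M} {f : M → ℝ} (hVo : IsOpen V) (hV : V ⊆ U) (hX : SmoothVF X V)
    (hY : SmoothVF Y V) (hf : SmoothFn f V) (hy : y ∈ V) :
    lieD (bracket X Y) f y = lieD X (lieD Y f) y - lieD Y (lieD X f) y := by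
  have he : SmoothVF (e 0) V := (F.smooth 0).mono hV
  have ed : DiffVF (e 0) y := F.diffVF (hV hy) 0
  have fd := hf.diffFn hVo hy
  have key := bracket_leibniz hX hY (he.smul hf) hVo hy
  have base := bracket_leibniz hX hY he hVo hy
  -- The two terms of the product rule are indexed by `Bool` so that `bracket_sum_right` applies to
  -- them.
  have ev {X : VF M} : ∀ᶠ z in nhds y, bracket X (fun z => f z • e 0 z) z
      = ∑ b : Bool, (if b then lieD X f z else f z) • (if b then e 0 z else bracket X (e 0) z) := by
    filter_upwards [hVo.mem_nhds hy] with z hz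
    rw [bracket_smul_right (hf.diffFn hVo hz) (F.diffVF (hV hz) 0)]
    simp
  have ex {X Y : VF M} (hX : SmoothVF X V) (hY : SmoothVF Y V) :
      bracket X (bracket Y (fun z => f z • e 0 z)) y
        = lieD X (lieD Y f) y • e 0 y + lieD Y f y • bracket X (e 0) y
          + (lieD X f y • bracket Y (e 0) y + f y • bracket X (bracket Y (e 0)) y) := by
    have d₁ := (F.smoothFn_lieD hVo hV hY hf).diffFn hVo hy
    have d₂ := (hY.bracket he hVo).diffVF hVo hy
    rw [bracket_congr_right ev, bracket_sum_right]
    · simp only [Fintype.sum_bool, if_true, Bool.false_eq_true, if_false]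
      rw [bracket_smul_right d₁ ed, bracket_smul_right fd d₂]
    · rintro (_ | _) _
      · simpa using d₂.smul fd
      · simpa using ed.smul d₁
  rw [ex hX hY, ex hY hX, bracket_smul_right fd ed, base] at key
  have := congrArg (fun u => comp e u 0) key
  simp only [comp_add, comp_smul, F.comp_frame (hV hy), kron_self] at this
  linarith

end OrthoFrame

end Frames

/-! ### The Levi-Civita connection and the torsion in an adapted frame -/

section Connection

variable {M : Type*} [TopologicalSpace M] [ChartedSpace E8 M] [IsManifold 𝓘(ℝ, E8) ∞ M]
  [Bundle.RiemannianBundle (fun x : M => TangentSpace 𝓘(ℝ, E8) x)]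

variable {e : Fin 8 → VF M} {U : Set M} {X Y Z : VF M} {y : M}

namespace OrthoFrame

theorem map_eq_sum (F : OrthoFrame e U) (hy : y ∈ U) {f : TangentSpace 𝓘(ℝ, E8) y → ℝ}
    (hf : IsLinearMap ℝ f) (u : TangentSpace 𝓘(ℝ, E8) y) :
    f u = ∑ i, comp e u i * f (e i y) := by
  have h : hf.mk' f u = ∑ i, comp e u i * hf.mk' f (e i y) := by
    conv_lhs => rw [F.sum_comp hy u]
    simp only [map_sum, map_smul, smul_eq_mul]
  exact h

/-- The basis `onb` is chosen pointwise and has no regularity. This lemma replaces it by a smooth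
frame in every contraction below. -/
theorem trace_eq (F : OrthoFrame e U) (hy : y ∈ U)
    {B : TangentSpace 𝓘(ℝ, E8) y → TangentSpace 𝓘(ℝ, E8) y → ℝ}
    (h₁ : ∀ v, IsLinearMap ℝ fun u => B u v) (h₂ : ∀ u, IsLinearMap ℝ fun v => B u v) :
    ∑ a, B (onb y a) (onb y a) = ∑ p, B (e p y) (e p y) := by
  have h (a : Fin 8) : B (onb y a) (onb y a)
      = ∑ i, ∑ j, comp e (onb y a) i * comp e (onb y a) j * B (e i y) (e j y) := by
    rw [F.map_eq_sum hy (h₁ _)]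
    refine Finset.sum_congr rfl fun i _ => ?_
    rw [F.map_eq_sum hy (h₂ _), Finset.mul_sum]
    exact Finset.sum_congr rfl fun j _ => by ring
  simp only [h]
  rw [← sum_pull₂]
  simp only [← Finset.sum_mul, F.sum_comp_onb hy, sum_kron_mul]

variable [IsContMDiffRiemannianBundle 𝓘(ℝ, E8) ∞ E8 (fun x : M => TangentSpace 𝓘(ℝ, E8) x)]

theorem lieD_inner (F : OrthoFrame e U) (hy : y ∈ U) (hY : DiffVF Y y) (hZ : DiffVF Z y) :
    lieD X (fun z => inner ℝ (Y z) (Z z)) y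
      = ∑ k, (comp e (Y y) k * lieD X (fun z => comp e (Z z) k) y
        + comp e (Z y) k * lieD X (fun z => comp e (Y z) k) y) := by
  have hYc := F.diffFn_comp hy hY
  have hZc := F.diffFn_comp hy hZ
  rw [lieD_congr (g := fun z => ∑ k, comp e (Y z) k * comp e (Z z) k), lieD_sum]
  · exact Finset.sum_congr rfl fun k _ => lieD_mul (hYc k) (hZc k)
  · exact fun k _ => (hYc k).mul (hZc k)
  · filter_upwards [F.isOpen.mem_nhds hy] with z hz using F.inner_eq hz _ _

/-- In an orthonormal frame the metric has constant coefficients. Of the derivatives of components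
only those of `Y` along `X` survive, and the brackets of the frame combine into `christoffel`. -/
theorem koszul_eq (F : OrthoFrame e U) (hy : y ∈ U) (hX : DiffVF X y) (hY : DiffVF Y y)
    (hZ : DiffVF Z y) :
    koszul X Y Z y = ∑ k, comp e (Z y) k * (lieD X (fun z => comp e (Y z) k) y
      + ∑ i, ∑ j, comp e (X y) i * comp e (Y y) j * christoffel e y i j k) := by
  have q₁ : ∑ k, (∑ i, ∑ j, comp e (X y) i * comp e (Z y) j * structFn e y i j k) * comp e (Y y) k
      = ∑ k, comp e (Z y) k * ∑ i, ∑ j, comp e (X y) i * comp e (Y y) j * structFn e y i k j := by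
    simp only [Finset.sum_mul, Finset.mul_sum]
    rw [sum_pull₂]
    refine Finset.sum_congr rfl fun i _ => ?_
    rw [Finset.sum_comm]
    exact Finset.sum_congr rfl fun j _ => Finset.sum_congr rfl fun k _ => by ring
  have q₂ : ∑ k, (∑ i, ∑ j, comp e (Y y) i * comp e (Z y) j * structFn e y i j k) * comp e (X y) k
      = ∑ k, comp e (Z y) k * ∑ i, ∑ j, comp e (X y) i * comp e (Y y) j * structFn e y j k i := by
    simp only [Finset.sum_mul, Finset.mul_sum]
    rw [sum_pull₂]
    exact Finset.sum_congr rfl fun i _ => Finset.sum_congr rfl fun j _ =>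
      Finset.sum_congr rfl fun k _ => by ring
  have r : ∑ k, comp e (Z y) k * ∑ i, ∑ j, comp e (X y) i * comp e (Y y) j * christoffel e y i j k
      = (1 / 2) * (∑ k, (∑ i, ∑ j, comp e (X y) i * comp e (Y y) j * structFn e y i j k)
          * comp e (Z y) k
        - ∑ k, comp e (Z y) k * ∑ i, ∑ j, comp e (X y) i * comp e (Y y) j * structFn e y i k j
        - ∑ k, comp e (Z y) k * ∑ i, ∑ j, comp e (X y) i * comp e (Y y) j * structFn e y j k i) := by
    simp only [Finset.mul_sum, Finset.sum_mul, ← Finset.sum_sub_distrib]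
    exact Finset.sum_congr rfl fun i _ => Finset.sum_congr rfl fun j _ =>
      Finset.sum_congr rfl fun k _ => by rw [christoffel]; ring
  rw [koszul, F.lieD_inner hy hY hZ, F.lieD_inner hy hX hZ, F.lieD_inner hy hX hY,
    F.inner_eq hy, F.inner_eq hy, F.inner_eq hy]
  simp only [F.comp_bracket hy hX hY, F.comp_bracket hy hX hZ, F.comp_bracket hy hY hZ, mul_add,
    add_mul, sub_mul, Finset.sum_add_distrib, Finset.sum_sub_distrib, r, q₁, q₂]
  simp only [mul_comm]
  ring

/-- The components of the Levi-Civita connection. -/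
theorem comp_leviCivita (F : OrthoFrame e U) (hy : y ∈ U) (hX : DiffVF X y) (hY : DiffVF Y y)
    (k : Fin 8) :
    comp e (leviCivita X Y y) k = lieD X (fun z => comp e (Y z) k) y
      + ∑ i, ∑ j, comp e (X y) i * comp e (Y y) j * christoffel e y i j k := by
  simp only [leviCivita, comp_sum, comp_smul, F.koszul_eq hy hX hY (diffVF_ext _), ext_self,
    Finset.sum_mul]
  rw [Finset.sum_comm]
  simp only [mul_right_comm _ _ (comp e (onb y _) k), ← Finset.sum_mul]
  simp only [F.sum_comp_onb hy, sum_kron_mul']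

end OrthoFrame

end Connection

/-! ### Linearity -/

section Linearity

variable {V W : Type*} [AddCommGroup V] [Module ℝ V] [AddCommGroup W] [Module ℝ W]

theorem isLinearMap_add {f g : V → ℝ} (hf : IsLinearMap ℝ f) (hg : IsLinearMap ℝ g) :
    IsLinearMap ℝ fun u => f u + g u := (hf.mk' f + hg.mk' g).isLinear

theorem isLinearMap_const_mul {f : V → ℝ} (hf : IsLinearMap ℝ f) (c : ℝ) :
    IsLinearMap ℝ fun u => c * f u := (c • hf.mk' f).isLinear

theorem isLinearMap_mul_const {f : V → ℝ} (hf : IsLinearMap ℝ f) (c : ℝ) :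
    IsLinearMap ℝ fun u => f u * c := by
  simpa only [mul_comm] using isLinearMap_const_mul hf c

theorem isLinearMap_sum {ι : Type*} (s : Finset ι) {f : ι → V → ℝ}
    (hf : ∀ i, IsLinearMap ℝ (f i)) : IsLinearMap ℝ fun u => ∑ i ∈ s, f i u where
  map_add u v := by simp only [(hf _).map_add, Finset.sum_add_distrib]
  map_smul c u := by simp only [(hf _).map_smul, Finset.smul_sum]

theorem isLinearMap_comp {f : W → ℝ} {g : V → W} (hf : IsLinearMap ℝ f) (hg : IsLinearMap ℝ g) :
    IsLinearMap ℝ fun u => f (g u) := ((hf.mk' f).comp (hg.mk' g)).isLinear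

variable (φ : V [⋀^Fin 4]→ₗ[ℝ] ℝ)

theorem update_vec₀ (u v w z x : V) : Function.update ![u, v, w, z] 0 x = ![x, v, w, z] := by
  ext r; fin_cases r <;> rfl

theorem update_vec₁ (u v w z x : V) : Function.update ![u, v, w, z] 1 x = ![u, x, w, z] := by
  ext r; fin_cases r <;> rfl

theorem update_vec₂ (u v w z x : V) : Function.update ![u, v, w, z] 2 x = ![u, v, x, z] := by
  ext r; fin_cases r <;> rfl

theorem update_vec₃ (u v w z x : V) : Function.update ![u, v, w, z] 3 x = ![u, v, w, x] := by
  ext r; fin_cases r <;> rfl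

theorem isLinearMap_slot₀ (v w z : V) : IsLinearMap ℝ fun u => φ ![u, v, w, z] where
  map_add a b := by simpa only [update_vec₀] using φ.map_update_add ![0, v, w, z] 0 a b
  map_smul c a := by simpa only [update_vec₀] using φ.map_update_smul ![0, v, w, z] 0 c a

theorem isLinearMap_slot₁ (u w z : V) : IsLinearMap ℝ fun v => φ ![u, v, w, z] where
  map_add a b := by simpa only [update_vec₁] using φ.map_update_add ![u, 0, w, z] 1 a b
  map_smul c a := by simpa only [update_vec₁] using φ.map_update_smul ![u, 0, w, z] 1 c a

theorem isLinearMap_slot₂ (u v z : V) : IsLinearMap ℝ fun w => φ ![u, v, w, z] where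
  map_add a b := by simpa only [update_vec₂] using φ.map_update_add ![u, v, 0, z] 2 a b
  map_smul c a := by simpa only [update_vec₂] using φ.map_update_smul ![u, v, 0, z] 2 c a

theorem isLinearMap_slot₃ (u v w : V) : IsLinearMap ℝ fun z => φ ![u, v, w, z] where
  map_add a b := by simpa only [update_vec₃] using φ.map_update_add ![u, v, w, 0] 3 a b
  map_smul c a := by simpa only [update_vec₃] using φ.map_update_smul ![u, v, w, 0] 3 c a

theorem isLinearMap_slot₀_comp {g : W → V} (v w z : V) (hg : IsLinearMap ℝ g) :
    IsLinearMap ℝ fun x => φ ![g x, v, w, z] :=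
  isLinearMap_comp (f := fun x => φ ![x, v, w, z]) (isLinearMap_slot₀ φ v w z) hg

theorem isLinearMap_slot₁_comp {g : W → V} (u w z : V) (hg : IsLinearMap ℝ g) :
    IsLinearMap ℝ fun x => φ ![u, g x, w, z] :=
  isLinearMap_comp (f := fun x => φ ![u, x, w, z]) (isLinearMap_slot₁ φ u w z) hg

theorem isLinearMap_slot₂_comp {g : W → V} (u v z : V) (hg : IsLinearMap ℝ g) :
    IsLinearMap ℝ fun x => φ ![u, v, g x, z] :=
  isLinearMap_comp (f := fun x => φ ![u, v, x, z]) (isLinearMap_slot₂ φ u v z) hg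

theorem isLinearMap_slot₃_comp {g : W → V} (u v w : V) (hg : IsLinearMap ℝ g) :
    IsLinearMap ℝ fun x => φ ![u, v, w, g x] :=
  isLinearMap_comp (f := fun x => φ ![u, v, w, x]) (isLinearMap_slot₃ φ u v w) hg

end Linearity

/-! ### The codifferential in an adapted frame -/

section Torsion

variable {M : Type*} [TopologicalSpace M] [ChartedSpace E8 M] [IsManifold 𝓘(ℝ, E8) ∞ M]
  [Bundle.RiemannianBundle (fun x : M => TangentSpace 𝓘(ℝ, E8) x)]

variable {e : Fin 8 → VF M} {U : Set M} {X Y Z : VF M} {y : M}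
  {Φ : Π x : M, TangentSpace 𝓘(ℝ, E8) x [⋀^Fin 4]→ₗ[ℝ] ℝ}

theorem isLinearMap_compFn (e : Fin 8 → VF M) (y : M) (i : Fin 8) :
    IsLinearMap ℝ fun u : TangentSpace 𝓘(ℝ, E8) y => comp e u i :=
  ⟨fun u v => comp_add u v i, fun c u => comp_smul c u i⟩

/-- The connection part of the Levi-Civita connection in a frame. -/
def christoffelVec (e : Fin 8 → VF M) {y : M} (u v : TangentSpace 𝓘(ℝ, E8) y) :
    TangentSpace 𝓘(ℝ, E8) y :=
  ∑ k, (∑ i, ∑ j, comp e u i * comp e v j * christoffel e y i j k) • e k y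

theorem isLinearMap_christoffelVec₁ (v : TangentSpace 𝓘(ℝ, E8) y) :
    IsLinearMap ℝ fun u => christoffelVec e u v where
  map_add a b := by
    simp only [christoffelVec, comp_add, add_mul, Finset.sum_add_distrib, add_smul]
  map_smul c u := by
    simp only [christoffelVec, comp_smul, mul_assoc, ← Finset.mul_sum, Finset.smul_sum, mul_smul]

theorem isLinearMap_christoffelVec₂ (u : TangentSpace 𝓘(ℝ, E8) y) :
    IsLinearMap ℝ fun v => christoffelVec e u v where
  map_add a b := by
    simp only [christoffelVec, comp_add, add_mul, mul_add, Finset.sum_add_distrib, add_smul]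
  map_smul c u := by
    simp only [christoffelVec, comp_smul, mul_assoc, mul_left_comm _ c, ← Finset.mul_sum,
      Finset.smul_sum, mul_smul]

theorem OrthoFrame.comp_christoffelVec (F : OrthoFrame e U) (hy : y ∈ U)
    (u v : TangentSpace 𝓘(ℝ, E8) y) (k : Fin 8) :
    comp e (christoffelVec e u v) k
      = ∑ i, ∑ j, comp e u i * comp e v j * christoffel e y i j k := by
  simp only [christoffelVec, comp_sum, comp_smul, F.comp_frame hy, sum_mul_kron']

/-- A smooth orthonormal frame in which `Φ` is the standard 4-form. -/
structure AdaptedFrame (Φ : Π x : M, TangentSpace 𝓘(ℝ, E8) x [⋀^Fin 4]→ₗ[ℝ] ℝ)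
    (e : Fin 8 → VF M) (U : Set M) : Prop extends OrthoFrame e U where
  form_eq {y : M} (hy : y ∈ U) (J : Fin 4 → Fin 8) :
    Φ y (fun r => e (J r) y) = (stdCoeff J : ℝ)

theorem IsSpin7Structure.exists_adaptedFrame (hΦ : IsSpin7Structure Φ) (x : M) :
    ∃ (e : Fin 8 → VF M) (U : Set M), x ∈ U ∧ AdaptedFrame Φ e U := by
  obtain ⟨U, hU, hx, e, he, ho, hf⟩ := hΦ x
  exact ⟨e, U, hx, ⟨hU, he.contMDiffOn, fun hy => ho _ hy, fun hy => he.generating hy⟩,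
    fun hy => hf _ hy⟩

namespace AdaptedFrame

theorem form_frame (F : AdaptedFrame Φ e U) (hy : y ∈ U) (i j k l : Fin 8) :
    Φ y ![e i y, e j y, e k y, e l y] = phi i j k l := by
  rw [phi, ← F.form_eq hy]
  congr 1
  ext r; fin_cases r <;> rfl

theorem form_eq_sum (F : AdaptedFrame Φ e U) (hy : y ∈ U)
    (v : Fin 4 → TangentSpace 𝓘(ℝ, E8) y) :
    Φ y v = ∑ J : Fin 4 → Fin 8, (∏ r, comp e (v r) (J r)) * (stdCoeff J : ℝ) := by
  have hv : v = fun r => ∑ i, comp e (v r) i • e i y := funext fun r => F.sum_comp hy (v r)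
  have h := (Φ y).toMultilinearMap.map_sum (fun r i => comp e (v r) i • e i y)
  conv_lhs => rw [hv]
  refine h.trans (Finset.sum_congr rfl fun J _ => ?_)
  rw [← F.form_eq hy]
  exact (Φ y).toMultilinearMap.map_smul_univ (fun r => comp e (v r) (J r)) (fun r => e (J r) y)

theorem lieD_prod {f : Fin 4 → M → ℝ} (hf : ∀ r, DiffFn (f r) y) :
    DiffFn (fun z => ∏ r, f r z) y ∧ lieD X (fun z => ∏ r, f r z) y
      = ∑ s, ∏ r, Function.update (fun r => f r y) s (lieD X (f s) y) r := by
  simp only [Fin.prod_univ_four, Fin.sum_univ_four]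
  have h₁ : DiffFn (fun z => f 0 z * f 1 z) y := (hf 0).mul (hf 1)
  have h₂ : DiffFn (fun z => f 0 z * f 1 z * f 2 z) y := h₁.mul (hf 2)
  refine ⟨h₂.mul (hf 3), ?_⟩
  rw [lieD_mul h₂ (hf 3), lieD_mul h₁ (hf 2), lieD_mul (hf 0) (hf 1)]
  simp [Function.update_apply]
  ring

variable [IsContMDiffRiemannianBundle 𝓘(ℝ, E8) ∞ E8 (fun x : M => TangentSpace 𝓘(ℝ, E8) x)]

/-- The coefficients of `Φ` in the frame are constant, so the derivatives of the components of the
arguments cancel and only the Christoffel terms remain. In particular the value depends on the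
vector fields only through their values at `y`. -/
theorem leviCivitaForm_eq (F : AdaptedFrame Φ e U) (hy : y ∈ U) (hX : DiffVF X y)
    {Y : Fin 4 → VF M} (hY : ∀ r, DiffVF (Y r) y) :
    leviCivitaForm Φ X Y y
      = -∑ s, Φ y (Function.update (fun r => Y r y) s (christoffelVec e (X y) (Y s y))) := by
  have hc (r : Fin 4) (i : Fin 8) := F.diffFn_comp hy (hY r) i
  have hp (J : Fin 4 → Fin 8) := lieD_prod (X := X) (f := fun r z => comp e (Y r z) (J r))
    fun r => hc r (J r)
  have h₁ : lieD X (fun z => Φ z (fun r => Y r z)) y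
      = ∑ s, ∑ J : Fin 4 → Fin 8, (∏ r, Function.update (fun r => comp e (Y r y) (J r)) s
          (lieD X (fun z => comp e (Y s z) (J s)) y) r) * (stdCoeff J : ℝ) := by
    rw [Finset.sum_comm, lieD_congr (g := fun z => ∑ J : Fin 4 → Fin 8, (stdCoeff J : ℝ) *
      ∏ r, comp e (Y r z) (J r)), lieD_sum]
    · refine Finset.sum_congr rfl fun J _ => ?_
      rw [lieD_const_mul (hp J).1, (hp J).2, mul_comm, Finset.sum_mul]
    · exact fun J _ => mdifferentiableAt_const.mul (hp J).1
    · filter_upwards [F.isOpen.mem_nhds hy] with z hz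
      rw [F.form_eq_sum hz]
      simp only [mul_comm]
  have h₂ (s : Fin 4) (u : TangentSpace 𝓘(ℝ, E8) y) :
      Φ y (Function.update (fun r => Y r y) s u)
        = ∑ J : Fin 4 → Fin 8, (∏ r, Function.update (fun r => comp e (Y r y) (J r)) s
          (comp e u (J s)) r) * (stdCoeff J : ℝ) := by
    rw [F.form_eq_sum hy]
    refine Finset.sum_congr rfl fun J _ => ?_
    congr 1
    refine Finset.prod_congr rfl fun r _ => ?_
    by_cases h : r = s
    · subst h; simp
    · simp [h]
  have h₃ (s : Fin 4) (a b : ℝ) (f : Fin 4 → ℝ) :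
      ∏ r, Function.update f s (a + b) r
        = ∏ r, Function.update f s a r + ∏ r, Function.update f s b r := by
    simp only [Finset.prod_update_of_mem (Finset.mem_univ s), add_mul]
  rw [leviCivitaForm, h₁]
  simp only [h₂, F.comp_leviCivita hy hX (hY _), F.comp_christoffelVec hy, h₃, add_mul,
    Finset.sum_add_distrib]
  ring

theorem codiff_eq (F : AdaptedFrame Φ e U) (hy : y ∈ U) (u v w : TangentSpace 𝓘(ℝ, E8) y) :
    codiff Φ y u v w = ∑ p, (Φ y ![christoffelVec e (e p y) (e p y), u, v, w]
      + Φ y ![e p y, christoffelVec e (e p y) u, v, w]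
      + Φ y ![e p y, u, christoffelVec e (e p y) v, w]
      + Φ y ![e p y, u, v, christoffelVec e (e p y) w]) := by
  have h₁ (a : TangentSpace 𝓘(ℝ, E8) y) :
      leviCivitaForm Φ (ext a) ![ext a, ext u, ext v, ext w] y
        = -(Φ y ![christoffelVec e a a, u, v, w] + Φ y ![a, christoffelVec e a u, v, w]
          + Φ y ![a, u, christoffelVec e a v, w] + Φ y ![a, u, v, christoffelVec e a w]) := by
    have hv : (fun r => (![ext a, ext u, ext v, ext w] : Fin 4 → VF M) r y) = ![a, u, v, w] := by
      ext r; fin_cases r <;> simp [ext_self]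
    rw [F.leviCivitaForm_eq hy (diffVF_ext a), hv, Fin.sum_univ_four]
    · simp only [update_vec₀, update_vec₁, update_vec₂, update_vec₃, Matrix.cons_val, ext_self]
    · intro r; fin_cases r <;> exact diffVF_ext _
  rw [codiff]
  simp only [h₁, Finset.sum_neg_distrib, neg_neg]
  refine F.trace_eq hy (B := fun a b => Φ y ![christoffelVec e a b, u, v, w]
    + Φ y ![b, christoffelVec e a u, v, w] + Φ y ![b, u, christoffelVec e a v, w]
    + Φ y ![b, u, v, christoffelVec e a w]) (fun b => ?_) (fun a => ?_)
  · exact isLinearMap_add (isLinearMap_add (isLinearMap_add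
      (isLinearMap_slot₀_comp _ _ _ _ (isLinearMap_christoffelVec₁ _))
      (isLinearMap_slot₁_comp _ _ _ _ (isLinearMap_christoffelVec₁ _)))
      (isLinearMap_slot₂_comp _ _ _ _ (isLinearMap_christoffelVec₁ _)))
      (isLinearMap_slot₃_comp _ _ _ _ (isLinearMap_christoffelVec₁ _))
  · exact isLinearMap_add (isLinearMap_add (isLinearMap_add
      (isLinearMap_slot₀_comp _ _ _ _ (isLinearMap_christoffelVec₂ _))
      (isLinearMap_slot₀ _ _ _ _)) (isLinearMap_slot₀ _ _ _ _)) (isLinearMap_slot₀ _ _ _ _)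

theorem isLinearMap_codiff₀ (F : AdaptedFrame Φ e U) (hy : y ∈ U)
    (v w : TangentSpace 𝓘(ℝ, E8) y) : IsLinearMap ℝ fun u => codiff Φ y u v w := by
  simp only [F.codiff_eq hy]
  exact isLinearMap_sum _ fun p => isLinearMap_add (isLinearMap_add (isLinearMap_add
    (isLinearMap_slot₁ _ _ _ _)
    (isLinearMap_slot₁_comp _ _ _ _ (isLinearMap_christoffelVec₂ _)))
    (isLinearMap_slot₁ _ _ _ _)) (isLinearMap_slot₁ _ _ _ _)

theorem isLinearMap_codiff₁ (F : AdaptedFrame Φ e U) (hy : y ∈ U)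
    (u w : TangentSpace 𝓘(ℝ, E8) y) : IsLinearMap ℝ fun v => codiff Φ y u v w := by
  simp only [F.codiff_eq hy]
  exact isLinearMap_sum _ fun p => isLinearMap_add (isLinearMap_add (isLinearMap_add
    (isLinearMap_slot₂ _ _ _ _) (isLinearMap_slot₂ _ _ _ _))
    (isLinearMap_slot₂_comp _ _ _ _ (isLinearMap_christoffelVec₂ _)))
    (isLinearMap_slot₂ _ _ _ _)

theorem isLinearMap_codiff₂ (F : AdaptedFrame Φ e U) (hy : y ∈ U)
    (u v : TangentSpace 𝓘(ℝ, E8) y) : IsLinearMap ℝ fun w => codiff Φ y u v w := by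
  simp only [F.codiff_eq hy]
  exact isLinearMap_sum _ fun p => isLinearMap_add (isLinearMap_add (isLinearMap_add
    (isLinearMap_slot₃ _ _ _ _) (isLinearMap_slot₃ _ _ _ _)) (isLinearMap_slot₃ _ _ _ _))
    (isLinearMap_slot₃_comp _ _ _ _ (isLinearMap_christoffelVec₂ _))

theorem codiff_frame (F : AdaptedFrame Φ e U) (hy : y ∈ U) (k l m : Fin 8) :
    codiff Φ y (e k y) (e l y) (e m y) = codiffArr (christoffel e y) k l m := by
  have g (p k s : Fin 8) : comp e (christoffelVec e (e p y) (e k y)) s = christoffel e y p k s := by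
    simp only [F.comp_christoffelVec hy, F.comp_frame hy, mul_assoc, ← Finset.mul_sum,
      sum_kron_mul]
  rw [F.codiff_eq hy, codiffArr]
  refine Finset.sum_congr rfl fun p _ => ?_
  rw [F.map_eq_sum hy (isLinearMap_slot₀ (Φ y) _ _ _),
    F.map_eq_sum hy (isLinearMap_slot₁ (Φ y) _ _ _) (christoffelVec e (e p y) (e k y)),
    F.map_eq_sum hy (isLinearMap_slot₂ (Φ y) _ _ _) (christoffelVec e (e p y) (e l y)),
    F.map_eq_sum hy (isLinearMap_slot₃ (Φ y) _ _ _) (christoffelVec e (e p y) (e m y))]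
  simp only [g, F.form_frame hy, Finset.sum_add_distrib]

end AdaptedFrame

end Torsion

/-! ### The Lee form, the torsion and the torsion connection in an adapted frame -/

section Nabla

variable {M : Type*} [TopologicalSpace M] [ChartedSpace E8 M] [IsManifold 𝓘(ℝ, E8) ∞ M]
  [Bundle.RiemannianBundle (fun x : M => TangentSpace 𝓘(ℝ, E8) x)]

variable {e : Fin 8 → VF M} {U : Set M} {X Y Z : VF M} {y : M}
  {Φ : Π x : M, TangentSpace 𝓘(ℝ, E8) x [⋀^Fin 4]→ₗ[ℝ] ℝ}

/-- The components of the torsion in an adapted frame. -/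
def torsionFn (e : Fin 8 → VF M) (y : M) : Fin 8 → Fin 8 → Fin 8 → ℝ :=
  torsionArr (christoffel e y)

/-- The connection coefficients of the torsion connection in an adapted frame. -/
def connFn (e : Fin 8 → VF M) (y : M) (i j k : Fin 8) : ℝ :=
  christoffel e y i j k + (1 / 2) * torsionFn e y i j k

theorem mem21_connFn (e : Fin 8 → VF M) (y : M) (i : Fin 8) : Mem21 (connFn e y i) :=
  mem21_add_torsionArr (fun i j k => christoffel_swap i j k) i

theorem torsionFn_swap₀₁ (i j k : Fin 8) : torsionFn e y j i k = -torsionFn e y i j k :=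
  torsionArr_swap₀₁ (fun i j k => christoffel_swap i j k) i j k

theorem torsionFn_swap₁₂ (i j k : Fin 8) : torsionFn e y i k j = -torsionFn e y i j k :=
  torsionArr_swap₁₂ (fun i j k => christoffel_swap i j k) i j k

/-- The torsion of the connection is `T`: the `½ T` added to each of the two coefficients is exactly
what `structArr` subtracts. -/
theorem structArr_connFn (i j k : Fin 8) :
    structArr (connFn e y) (torsionFn e y) i j k = structFn e y i j k := by
  rw [structArr, structFn_eq, connFn, connFn, torsionFn_swap₀₁ i j k]; ring

theorem OrthoFrame.map₃_eq_sum (F : OrthoFrame e U) (hy : y ∈ U)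
    {f : TangentSpace 𝓘(ℝ, E8) y → TangentSpace 𝓘(ℝ, E8) y → TangentSpace 𝓘(ℝ, E8) y → ℝ}
    (h₀ : ∀ v w, IsLinearMap ℝ fun u => f u v w) (h₁ : ∀ u w, IsLinearMap ℝ fun v => f u v w)
    (h₂ : ∀ u v, IsLinearMap ℝ fun w => f u v w) (u v w : TangentSpace 𝓘(ℝ, E8) y) :
    f u v w = ∑ i, ∑ j, ∑ k, comp e u i * comp e v j * comp e w k
      * f (e i y) (e j y) (e k y) := by
  rw [F.map_eq_sum hy (h₀ v w)]
  refine Finset.sum_congr rfl fun i _ => ?_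
  rw [F.map_eq_sum hy (h₁ _ w), Finset.mul_sum]
  refine Finset.sum_congr rfl fun j _ => ?_
  rw [F.map_eq_sum hy (h₂ _ _), Finset.mul_sum, Finset.mul_sum]
  exact Finset.sum_congr rfl fun k _ => by ring

namespace AdaptedFrame

variable [IsContMDiffRiemannianBundle 𝓘(ℝ, E8) ∞ E8 (fun x : M => TangentSpace 𝓘(ℝ, E8) x)]

theorem leeForm_eq_sum_frame (F : AdaptedFrame Φ e U) (hy : y ∈ U) (v : TangentSpace 𝓘(ℝ, E8) y) :
    leeForm Φ y v = (1 / 42) * ∑ i, ∑ j, ∑ k,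
      codiffArr (christoffel e y) i j k * Φ y ![e i y, e j y, e k y, v] := by
  rw [leeForm]
  congr 1
  have h₂ (a b : TangentSpace 𝓘(ℝ, E8) y) :
      ∑ k, codiff Φ y a b (onb y k) * Φ y ![a, b, onb y k, v]
        = ∑ k, codiff Φ y a b (e k y) * Φ y ![a, b, e k y, v] :=
    F.trace_eq hy (B := fun c c' => codiff Φ y a b c * Φ y ![a, b, c', v])
      (fun c' => isLinearMap_mul_const (F.isLinearMap_codiff₂ hy a b) _)
      (fun c => isLinearMap_const_mul (isLinearMap_slot₂ _ _ _ _) _)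
  have h₁ (a : TangentSpace 𝓘(ℝ, E8) y) :
      ∑ j, ∑ k, codiff Φ y a (onb y j) (e k y) * Φ y ![a, onb y j, e k y, v]
        = ∑ j, ∑ k, codiff Φ y a (e j y) (e k y) * Φ y ![a, e j y, e k y, v] :=
    F.trace_eq hy (B := fun b b' => ∑ k, codiff Φ y a b (e k y) * Φ y ![a, b', e k y, v])
      (fun c' => isLinearMap_sum _ fun k => isLinearMap_mul_const (F.isLinearMap_codiff₁ hy a _) _)
      (fun c => isLinearMap_sum _ fun k => isLinearMap_const_mul (isLinearMap_slot₁ _ _ _ _) _)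
  have h₀ : ∑ i, ∑ j, ∑ k, codiff Φ y (onb y i) (e j y) (e k y) * Φ y ![onb y i, e j y, e k y, v]
        = ∑ i, ∑ j, ∑ k, codiff Φ y (e i y) (e j y) (e k y) * Φ y ![e i y, e j y, e k y, v] :=
    F.trace_eq hy (B := fun b b' => ∑ j, ∑ k, codiff Φ y b (e j y) (e k y)
        * Φ y ![b', e j y, e k y, v])
      (fun c' => isLinearMap_sum _ fun j => isLinearMap_sum _ fun k =>
        isLinearMap_mul_const (F.isLinearMap_codiff₀ hy _ _) _)
      (fun c => isLinearMap_sum _ fun j => isLinearMap_sum _ fun k =>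
        isLinearMap_const_mul (isLinearMap_slot₀ _ _ _ _) _)
  simp only [h₂, h₁, h₀, F.codiff_frame hy]

theorem isLinearMap_leeForm (F : AdaptedFrame Φ e U) (hy : y ∈ U) :
    IsLinearMap ℝ fun v => leeForm Φ y v := by
  simp only [F.leeForm_eq_sum_frame hy]
  exact isLinearMap_const_mul (isLinearMap_sum _ fun i => isLinearMap_sum _ fun j =>
    isLinearMap_sum _ fun k => isLinearMap_const_mul (isLinearMap_slot₃ _ _ _ _) _) _

theorem leeForm_frame (F : AdaptedFrame Φ e U) (hy : y ∈ U) (a : Fin 8) :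
    leeForm Φ y (e a y) = leeArr (christoffel e y) a := by
  simp only [F.leeForm_eq_sum_frame hy, F.form_frame hy, leeArr]

theorem leeForm_eq (F : AdaptedFrame Φ e U) (hy : y ∈ U) (v : TangentSpace 𝓘(ℝ, E8) y) :
    leeForm Φ y v = ∑ a, comp e v a * leeArr (christoffel e y) a := by
  rw [F.map_eq_sum hy (F.isLinearMap_leeForm hy)]
  simp only [F.leeForm_frame hy]

theorem torsionForm_eq_frame (F : AdaptedFrame Φ e U) (hy : y ∈ U)
    (u v w : TangentSpace 𝓘(ℝ, E8) y) :
    torsionForm Φ y u v w = codiff Φ y u v w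
      + (7 / 6) * ∑ s, leeArr (christoffel e y) s * Φ y ![e s y, u, v, w] := by
  rw [torsionForm, F.trace_eq hy (B := fun a b => leeForm Φ y a * Φ y ![b, u, v, w])
      (fun _ => isLinearMap_mul_const (F.isLinearMap_leeForm hy) _)
      (fun _ => isLinearMap_const_mul (isLinearMap_slot₀ _ _ _ _) _)]
  simp only [F.leeForm_frame hy]

theorem isLinearMap_torsionForm₀ (F : AdaptedFrame Φ e U) (hy : y ∈ U)
    (v w : TangentSpace 𝓘(ℝ, E8) y) : IsLinearMap ℝ fun u => torsionForm Φ y u v w := by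
  simp only [F.torsionForm_eq_frame hy]
  exact isLinearMap_add (F.isLinearMap_codiff₀ hy _ _) (isLinearMap_const_mul
    (isLinearMap_sum _ fun s => isLinearMap_const_mul (isLinearMap_slot₁ _ _ _ _) _) _)

theorem isLinearMap_torsionForm₁ (F : AdaptedFrame Φ e U) (hy : y ∈ U)
    (u w : TangentSpace 𝓘(ℝ, E8) y) : IsLinearMap ℝ fun v => torsionForm Φ y u v w := by
  simp only [F.torsionForm_eq_frame hy]
  exact isLinearMap_add (F.isLinearMap_codiff₁ hy _ _) (isLinearMap_const_mul
    (isLinearMap_sum _ fun s => isLinearMap_const_mul (isLinearMap_slot₂ _ _ _ _) _) _)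

theorem isLinearMap_torsionForm₂ (F : AdaptedFrame Φ e U) (hy : y ∈ U)
    (u v : TangentSpace 𝓘(ℝ, E8) y) : IsLinearMap ℝ fun w => torsionForm Φ y u v w := by
  simp only [F.torsionForm_eq_frame hy]
  exact isLinearMap_add (F.isLinearMap_codiff₂ hy _ _) (isLinearMap_const_mul
    (isLinearMap_sum _ fun s => isLinearMap_const_mul (isLinearMap_slot₃ _ _ _ _) _) _)

theorem torsionForm_frame (F : AdaptedFrame Φ e U) (hy : y ∈ U) (k l m : Fin 8) :
    torsionForm Φ y (e k y) (e l y) (e m y) = torsionFn e y k l m := by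
  simp only [F.torsionForm_eq_frame hy, F.codiff_frame hy, F.form_frame hy, torsionFn, torsionArr]

theorem torsionForm_eq (F : AdaptedFrame Φ e U) (hy : y ∈ U) (u v w : TangentSpace 𝓘(ℝ, E8) y) :
    torsionForm Φ y u v w = ∑ i, ∑ j, ∑ k, comp e u i * comp e v j * comp e w k
      * torsionFn e y i j k := by
  rw [F.map₃_eq_sum hy (F.isLinearMap_torsionForm₀ hy) (F.isLinearMap_torsionForm₁ hy)
    (F.isLinearMap_torsionForm₂ hy)]
  simp only [F.torsionForm_frame hy]

theorem torsionForm_swap₀₁ (F : AdaptedFrame Φ e U) (hy : y ∈ U)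
    (u v w : TangentSpace 𝓘(ℝ, E8) y) : torsionForm Φ y v u w = -torsionForm Φ y u v w := by
  rw [F.torsionForm_eq hy, F.torsionForm_eq hy, Finset.sum_comm]
  simp only [← Finset.sum_neg_distrib]
  exact Finset.sum_congr rfl fun i _ => Finset.sum_congr rfl fun j _ =>
    Finset.sum_congr rfl fun k _ => by rw [torsionFn_swap₀₁ i j k]; ring

theorem torsionForm_swap₁₂ (F : AdaptedFrame Φ e U) (hy : y ∈ U)
    (u v w : TangentSpace 𝓘(ℝ, E8) y) : torsionForm Φ y u w v = -torsionForm Φ y u v w := by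
  rw [F.torsionForm_eq hy, F.torsionForm_eq hy]
  simp only [← Finset.sum_neg_distrib]
  refine Finset.sum_congr rfl fun i _ => ?_
  rw [Finset.sum_comm]
  exact Finset.sum_congr rfl fun j _ =>
    Finset.sum_congr rfl fun k _ => by rw [torsionFn_swap₁₂ i j k]; ring

theorem contr₃_torsionFn (e : Fin 8 → VF M) (y : M) (i : Fin 8) :
    contr₃ (torsionFn e y) i = 7 * leeArr (christoffel e y) i := contr₃_torsionArr i

/-- The components of the torsion connection. -/
theorem comp_nabla (F : AdaptedFrame Φ e U) (hy : y ∈ U) (hX : DiffVF X y) (hY : DiffVF Y y)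
    (k : Fin 8) :
    comp e (nabla Φ X Y y) k = lieD X (fun z => comp e (Y z) k) y
      + ∑ i, ∑ j, comp e (X y) i * comp e (Y y) j * connFn e y i j k := by
  have h₁ : ∑ a, (1 / 2) * torsionForm Φ y (X y) (Y y) (onb y a) * comp e (onb y a) k
      = ∑ i, ∑ j, comp e (X y) i * comp e (Y y) j * ((1 / 2) * torsionFn e y i j k) := by
    rw [F.trace_eq hy (B := fun a b => (1 / 2) * torsionForm Φ y (X y) (Y y) a * comp e b k)
      (fun _ => isLinearMap_mul_const (isLinearMap_const_mul (F.isLinearMap_torsionForm₂ hy _ _) _) _)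
      (fun _ => isLinearMap_const_mul (isLinearMap_compFn e y k) _)]
    simp only [F.comp_frame hy, sum_mul_kron']
    simp only [F.torsionForm_eq hy (X y) (Y y) (e k y), F.comp_frame hy, mul_assoc,
      ← Finset.mul_sum, sum_kron_mul]
    simp only [Finset.mul_sum]
    exact Finset.sum_congr rfl fun i _ => Finset.sum_congr rfl fun j _ => by ring
  rw [nabla, comp_add, F.comp_leviCivita hy hX hY, comp_sum]
  simp only [comp_smul, h₁, connFn, mul_add, Finset.sum_add_distrib, add_assoc]

end AdaptedFrame

end Nabla

/-! ### Derivatives of the frame components and the Jacobi identity -/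

section Curvature

variable {M : Type*} [TopologicalSpace M] [ChartedSpace E8 M] [IsManifold 𝓘(ℝ, E8) ∞ M]
  [Bundle.RiemannianBundle (fun x : M => TangentSpace 𝓘(ℝ, E8) x)]

variable {e : Fin 8 → VF M} {U : Set M} {X Y Z : VF M} {x y : M}
  {Φ : Π x : M, TangentSpace 𝓘(ℝ, E8) x [⋀^Fin 4]→ₗ[ℝ] ℝ}

/-- The derivatives of the torsion components along the frame. -/
def torsionDer (e : Fin 8 → VF M) (y : M) (l i j k : Fin 8) : ℝ :=
  lieD (e l) (fun z => torsionFn e z i j k) y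

/-- The derivatives of the connection coefficients along the frame. -/
def connDer (e : Fin 8 → VF M) (y : M) (l i j k : Fin 8) : ℝ :=
  lieD (e l) (fun z => connFn e z i j k) y

theorem SmoothFn.const_mul {f : M → ℝ} (hf : SmoothFn f U) (c : ℝ) :
    SmoothFn (fun z => c * f z) U := contMDiffOn_const.mul hf

theorem SmoothFn.mul_const {f : M → ℝ} (hf : SmoothFn f U) (c : ℝ) :
    SmoothFn (fun z => f z * c) U := ContMDiffOn.mul hf contMDiffOn_const

theorem lieD_neg {f : M → ℝ} (hf : DiffFn f x) : lieD X (fun z => -f z) x = -lieD X f x := by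
  simpa using lieD_const_mul (X := X) hf (-1)

theorem lieD_sub {f g : M → ℝ} (hf : DiffFn f x) (hg : DiffFn g x) :
    lieD X (fun z => f z - g z) x = lieD X f x - lieD X g x := by
  have hn : DiffFn (fun z => -g z) x := hg.neg
  simp only [sub_eq_add_neg]
  rw [lieD_add hf hn, lieD_neg hg]

namespace OrthoFrame

variable [IsContMDiffRiemannianBundle 𝓘(ℝ, E8) ∞ E8 (fun x : M => TangentSpace 𝓘(ℝ, E8) x)]

theorem smoothFn_structFn (F : OrthoFrame e U) (i j k : Fin 8) :
    SmoothFn (fun z => structFn e z i j k) U :=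
  F.smoothFn_comp Set.Subset.rfl ((F.smooth i).bracket (F.smooth j) F.isOpen) k

theorem smoothFn_christoffel (F : OrthoFrame e U) (i j k : Fin 8) :
    SmoothFn (fun z => christoffel e z i j k) U :=
  SmoothFn.const_mul (((F.smoothFn_structFn i j k).sub (F.smoothFn_structFn i k j)).sub
    (F.smoothFn_structFn j k i)) _

theorem smoothFn_codiffArr (F : OrthoFrame e U) (k l m : Fin 8) :
    SmoothFn (fun z => codiffArr (christoffel e z) k l m) U :=
  SmoothFn.sum _ fun _ _ => SmoothFn.sum _ fun _ _ =>
    ((((F.smoothFn_christoffel _ _ _).mul_const _).add ((F.smoothFn_christoffel _ _ _).mul_const _)).add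
    ((F.smoothFn_christoffel _ _ _).mul_const _)).add ((F.smoothFn_christoffel _ _ _).mul_const _)

theorem smoothFn_leeArr (F : OrthoFrame e U) (a : Fin 8) :
    SmoothFn (fun z => leeArr (christoffel e z) a) U :=
  SmoothFn.const_mul (SmoothFn.sum _ fun _ _ => SmoothFn.sum _ fun _ _ => SmoothFn.sum _ fun _ _ =>
    (F.smoothFn_codiffArr _ _ _).mul_const _) _

theorem smoothFn_torsionFn (F : OrthoFrame e U) (i j k : Fin 8) :
    SmoothFn (fun z => torsionFn e z i j k) U :=
  (F.smoothFn_codiffArr i j k).add (SmoothFn.const_mul (SmoothFn.sum _ fun _ _ =>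
    (F.smoothFn_leeArr _).mul_const _) _)

theorem smoothFn_connFn (F : OrthoFrame e U) (i j k : Fin 8) :
    SmoothFn (fun z => connFn e z i j k) U :=
  (F.smoothFn_christoffel i j k).add ((F.smoothFn_torsionFn i j k).const_mul _)

theorem torsionDer_swap₀₁ (F : OrthoFrame e U) (hx : x ∈ U) (l i j k : Fin 8) :
    torsionDer e x l j i k = -torsionDer e x l i j k := by
  rw [torsionDer, torsionDer, ← lieD_neg ((F.smoothFn_torsionFn i j k).diffFn F.isOpen hx)]
  simp only [torsionFn_swap₀₁ i j k]

theorem torsionDer_swap₁₂ (F : OrthoFrame e U) (hx : x ∈ U) (l i j k : Fin 8) :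
    torsionDer e x l i k j = -torsionDer e x l i j k := by
  rw [torsionDer, torsionDer, ← lieD_neg ((F.smoothFn_torsionFn i j k).diffFn F.isOpen hx)]
  simp only [torsionFn_swap₁₂ i j k]

/-- `Mem21` is a system of linear equations with constant coefficients, so it passes to derivatives.
-/
theorem mem21_connDer (F : OrthoFrame e U) (hx : x ∈ U) (l i : Fin 8) :
    Mem21 (connDer e x l i) := by
  intro j k
  have hd (i j k : Fin 8) := (F.smoothFn_connFn i j k).diffFn F.isOpen hx
  have h : ∀ z, ∑ a, ∑ b, phi a b j k * connFn e z i a b = 2 * connFn e z i j k := fun z => by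
    simpa only [mul_comm] using mem21_connFn e z i j k
  have h' : lieD (e l) (fun z => ∑ a, ∑ b, phi a b j k * connFn e z i a b) x
      = lieD (e l) (fun z => 2 * connFn e z i j k) x := by simp only [h]
  rw [lieD_const_mul (hd i j k), lieD_sum] at h'
  · rw [connDer, ← h']
    refine Finset.sum_congr rfl fun a _ => ?_
    rw [lieD_sum]
    · refine Finset.sum_congr rfl fun b _ => ?_
      rw [lieD_const_mul (hd i a b), connDer, mul_comm]
    · exact fun b _ => mdifferentiableAt_const.mul (hd i a b)
  · exact fun a _ => diffFn_sum _ fun b _ => mdifferentiableAt_const.mul (hd i a b)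

theorem lieD_structFn (F : OrthoFrame e U) (hx : x ∈ U) (l i j k : Fin 8) :
    lieD (e l) (fun z => structFn e z i j k) x
      = structArr (connDer e x l) (torsionDer e x l) i j k := by
  have hd (i j k : Fin 8) := (F.smoothFn_connFn i j k).diffFn F.isOpen hx
  simp only [← structArr_connFn]
  rw [structArr, connDer, connDer, torsionDer, ← lieD_sub (hd i j k) (hd j i k), ← lieD_sub]
  · rfl
  · exact (hd i j k).sub (hd j i k)
  · exact (F.smoothFn_torsionFn i j k).diffFn F.isOpen hx

/-- The Jacobi identity for three frame fields, in components. The derivatives on the right are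
those of the structure functions, expressed by `connDer` and `torsionDer`. -/
theorem jacobiArr (F : OrthoFrame e U) (hx : x ∈ U) :
    JacobiArr (connFn e x) (torsionFn e x) (connDer e x) (torsionDer e x) := by
  intro i j k l
  have hb (i j : Fin 8) : SmoothVF (bracket (e i) (e j)) U :=
    (F.smooth i).bracket (F.smooth j) F.isOpen
  have hc (X : VF M) (i l : Fin 8) : lieD X (fun z => comp e (e i z) l) x = 0 := by
    rw [lieD_congr (g := fun _ => kron i l), lieD_const]
    filter_upwards [F.isOpen.mem_nhds hx] with z hz using F.comp_frame hz i l
  have h₁ (i j k l : Fin 8) : comp e (bracket (e i) (bracket (e j) (e k)) x) l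
      = lieD (e i) (fun z => structFn e z j k l) x + ∑ s, structFn e x j k s * structFn e x i s l := by
    rw [F.comp_bracket hx (F.diffVF hx i) ((hb j k).diffVF F.isOpen hx), hc, sub_zero]
    simp only [F.comp_frame hx, mul_assoc, ← Finset.mul_sum, sum_kron_mul]
    rfl
  have h₂ (i j k l : Fin 8) : comp e (bracket (bracket (e i) (e j)) (e k) x) l
      = -lieD (e k) (fun z => structFn e z i j l) x
        - ∑ s, structFn e x i j s * structFn e x k s l := by
    rw [bracket_swap, comp_neg, h₁]; ring
  have key := congrArg (fun u => comp e u l)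
    (bracket_leibniz (F.smooth i) (F.smooth j) (F.smooth k) F.isOpen hx)
  simp only [comp_add] at key
  rw [h₁, h₁, h₂, F.lieD_structFn hx, F.lieD_structFn hx, F.lieD_structFn hx] at key
  have s₁ : structArr (connDer e x j) (torsionDer e x j) k i l
      = -structArr (connDer e x j) (torsionDer e x j) i k l := by
    simp only [structArr, F.torsionDer_swap₀₁ hx j i k l]; ring
  have t₁ : ∑ s, structFn e x j k s * structFn e x s i l
      = -∑ s, structFn e x j k s * structFn e x i s l := by
    rw [← Finset.sum_neg_distrib]
    exact Finset.sum_congr rfl fun s _ => by rw [structFn_swap i s l]; ring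
  have t₂ : ∑ s, structFn e x k i s * structFn e x s j l
      = ∑ s, structFn e x i k s * structFn e x j s l :=
    Finset.sum_congr rfl fun s _ => by rw [structFn_swap j s l, structFn_swap i k s]; ring
  have t₃ : ∑ s, structFn e x i j s * structFn e x s k l
      = -∑ s, structFn e x i j s * structFn e x k s l := by
    rw [← Finset.sum_neg_distrib]
    exact Finset.sum_congr rfl fun s _ => by rw [structFn_swap k s l]; ring
  simp only [structArr_connFn, Finset.sum_add_distrib]
  rw [s₁, t₁, t₂, t₃]
  linarith

end OrthoFrame

end Curvature

/-! ### Curvature, Ricci tensor and derivatives of the Lee form in components -/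

section CurvatureFormula

/-- The algebra behind tensoriality of the curvature. `XY`, `YX`, `XZ` and `YZ` stand for the
derivatives of the components of the second field along the first. They all cancel; second
derivatives of `Z` are disposed of by `lieD_bracket` where this is used. -/
theorem curvature_sum_identity (A c : Fin 8 → Fin 8 → Fin 8 → ℝ)
    (A' : Fin 8 → Fin 8 → Fin 8 → Fin 8 → ℝ) (X Y Z XY YX XZ YZ : Fin 8 → ℝ) (k : Fin 8) :
    (∑ i, ∑ j, (XY i * Z j * A i j k + Y i * XZ j * A i j k + Y i * Z j * ∑ a, X a * A' a i j k)
      + ∑ i, ∑ s, X i * (YZ s + ∑ b, ∑ j, Y b * Z j * A b j s) * A i s k)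
    - (∑ i, ∑ j, (YX i * Z j * A i j k + X i * YZ j * A i j k + X i * Z j * ∑ a, Y a * A' a i j k)
      + ∑ i, ∑ s, Y i * (XZ s + ∑ b, ∑ j, X b * Z j * A b j s) * A i s k)
    - ∑ i, ∑ j, (XY i - YX i + ∑ a, ∑ b, X a * Y b * c a b i) * Z j * A i j k
    = ∑ a, ∑ b, ∑ j, X a * Y b * Z j * (A' a b j k - A' b a j k
      + ∑ s, (A b j s * A a s k - A a j s * A b s k - c a b s * A s j k)) := by
  have p₁ : ∑ i, ∑ j, Y i * Z j * ∑ a, X a * A' a i j k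
      = ∑ a, ∑ b, ∑ j, X a * Y b * Z j * A' a b j k := by
    simp only [Finset.mul_sum]
    rw [sum_pull₂]
    exact Finset.sum_congr rfl fun a _ => Finset.sum_congr rfl fun b _ =>
      Finset.sum_congr rfl fun j _ => by ring
  have p₂ : ∑ i, ∑ j, X i * Z j * ∑ a, Y a * A' a i j k
      = ∑ a, ∑ b, ∑ j, X a * Y b * Z j * A' b a j k := by
    simp only [Finset.mul_sum]
    refine Finset.sum_congr rfl fun a _ => ?_
    rw [Finset.sum_comm]
    exact Finset.sum_congr rfl fun b _ => Finset.sum_congr rfl fun j _ => by ring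
  have q₁ : ∑ i, ∑ s, X i * (∑ b, ∑ j, Y b * Z j * A b j s) * A i s k
      = ∑ a, ∑ b, ∑ j, X a * Y b * Z j * ∑ s, A b j s * A a s k := by
    simp only [Finset.mul_sum, Finset.sum_mul]
    refine Finset.sum_congr rfl fun a _ => ?_
    rw [← sum_pull₂]
    exact Finset.sum_congr rfl fun b _ => Finset.sum_congr rfl fun j _ =>
      Finset.sum_congr rfl fun s _ => by ring
  have q₂ : ∑ i, ∑ s, Y i * (∑ b, ∑ j, X b * Z j * A b j s) * A i s k
      = ∑ a, ∑ b, ∑ j, X a * Y b * Z j * ∑ s, A a j s * A b s k := by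
    simp only [Finset.mul_sum, Finset.sum_mul]
    rw [Finset.sum_congr rfl fun i _ => (sum_pull₂ _).symm, Finset.sum_comm]
    exact Finset.sum_congr rfl fun a _ => Finset.sum_congr rfl fun b _ =>
      Finset.sum_congr rfl fun j _ => Finset.sum_congr rfl fun s _ => by ring
  have r : ∑ i, ∑ j, (∑ a, ∑ b, X a * Y b * c a b i) * Z j * A i j k
      = ∑ a, ∑ b, ∑ j, X a * Y b * Z j * ∑ s, c a b s * A s j k := by
    simp only [Finset.mul_sum, Finset.sum_mul]
    rw [sum_comm₂₂]
    refine Finset.sum_congr rfl fun a _ => Finset.sum_congr rfl fun b _ => ?_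
    rw [Finset.sum_comm]
    exact Finset.sum_congr rfl fun j _ => Finset.sum_congr rfl fun s _ => by ring
  simp only [mul_add, mul_sub, add_mul, sub_mul, Finset.sum_add_distrib, Finset.sum_sub_distrib,
    ← Finset.mul_sum]
  simp only [mul_add, mul_sub, add_mul, sub_mul, Finset.sum_add_distrib, Finset.sum_sub_distrib,
    p₁, p₂, q₁, q₂, r]
  ring

variable {M : Type*} [TopologicalSpace M] [ChartedSpace E8 M] [IsManifold 𝓘(ℝ, E8) ∞ M]
  [Bundle.RiemannianBundle (fun x : M => TangentSpace 𝓘(ℝ, E8) x)]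

variable {e : Fin 8 → VF M} {U V : Set M} {X Y Z : VF M} {x y : M}
  {Φ : Π x : M, TangentSpace 𝓘(ℝ, E8) x [⋀^Fin 4]→ₗ[ℝ] ℝ}

namespace AdaptedFrame

variable [IsContMDiffRiemannianBundle 𝓘(ℝ, E8) ∞ E8 (fun x : M => TangentSpace 𝓘(ℝ, E8) x)]

theorem smoothFn_comp_nabla (F : AdaptedFrame Φ e U) (hVo : IsOpen V) (hV : V ⊆ U)
    (hX : SmoothVF X V) (hY : SmoothVF Y V) (k : Fin 8) :
    SmoothFn (fun z => comp e (nabla Φ X Y z) k) V := by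
  have h : SmoothFn (fun z => lieD X (fun w => comp e (Y w) k) z
      + ∑ i, ∑ j, comp e (X z) i * comp e (Y z) j * connFn e z i j k) V :=
    (F.smoothFn_lieD hVo hV hX (F.smoothFn_comp hV hY k)).add
      (SmoothFn.sum _ fun i _ => SmoothFn.sum _ fun j _ =>
        ((F.smoothFn_comp hV hX i).mul (F.smoothFn_comp hV hY j)).mul
          ((F.smoothFn_connFn i j k).mono hV))
  exact h.congr fun z hz => F.comp_nabla (hV hz) (hX.diffVF hVo hz) (hY.diffVF hVo hz) k

theorem comp_nabla_nabla (F : AdaptedFrame Φ e U) (hVo : IsOpen V) (hV : V ⊆ U)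
    (hX : SmoothVF X V) (hY : SmoothVF Y V) (hZ : SmoothVF Z V) (hx : x ∈ V) (k : Fin 8) :
    comp e (nabla Φ X (nabla Φ Y Z) x) k = lieD X (lieD Y fun z => comp e (Z z) k) x
      + (∑ i, ∑ j, (lieD X (fun z => comp e (Y z) i) x * comp e (Z x) j * connFn e x i j k
          + comp e (Y x) i * lieD X (fun z => comp e (Z z) j) x * connFn e x i j k
          + comp e (Y x) i * comp e (Z x) j * ∑ a, comp e (X x) a * connDer e x a i j k)
        + ∑ i, ∑ s, comp e (X x) i * (lieD Y (fun z => comp e (Z z) s) x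
          + ∑ b, ∑ j, comp e (Y x) b * comp e (Z x) j * connFn e x b j s) * connFn e x i s k) := by
  have hN : SmoothVF (nabla Φ Y Z) V :=
    F.smoothVF_of_comp hV (F.smoothFn_comp_nabla hVo hV hY hZ)
  have dY := F.diffFn_comp (hV hx) (hY.diffVF hVo hx)
  have dZ := F.diffFn_comp (hV hx) (hZ.diffVF hVo hx)
  have dA (i j : Fin 8) := (F.smoothFn_connFn i j k).diffFn F.isOpen (hV hx)
  have dYZ (i j : Fin 8) : DiffFn (fun z => comp e (Y z) i * comp e (Z z) j) x :=
    (dY i).mul (dZ j)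
  have dYZA (i j : Fin 8) :
      DiffFn (fun z => comp e (Y z) i * comp e (Z z) j * connFn e z i j k) x :=
    (dYZ i j).mul (dA i j)
  have h : lieD X (fun z => comp e (nabla Φ Y Z z) k) x
      = lieD X (lieD Y fun z => comp e (Z z) k) x
        + ∑ i, ∑ j, (lieD X (fun z => comp e (Y z) i) x * comp e (Z x) j * connFn e x i j k
          + comp e (Y x) i * lieD X (fun z => comp e (Z z) j) x * connFn e x i j k
          + comp e (Y x) i * comp e (Z x) j * ∑ a, comp e (X x) a * connDer e x a i j k) := by
    rw [lieD_congr (g := fun z => lieD Y (fun w => comp e (Z w) k) z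
      + ∑ i, ∑ j, comp e (Y z) i * comp e (Z z) j * connFn e z i j k), lieD_add, lieD_sum]
    · congr 1
      refine Finset.sum_congr rfl fun i _ => ?_
      rw [lieD_sum _ fun j _ => dYZA i j]
      refine Finset.sum_congr rfl fun j _ => ?_
      rw [lieD_mul (dYZ i j) (dA i j), lieD_mul (dY i) (dZ j),
        lieD_eq_sum (f := fun z => connFn e z i j k) (F.sum_comp (hV hx) (X x))]
      simp only [connDer]
      ring
    · exact fun i _ => diffFn_sum _ fun j _ => dYZA i j
    · exact (F.smoothFn_lieD hVo hV hY (F.smoothFn_comp hV hZ k)).diffFn hVo hx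
    · exact diffFn_sum _ fun i _ => diffFn_sum _ fun j _ => dYZA i j
    · filter_upwards [hVo.mem_nhds hx] with z hz using
        F.comp_nabla (hV hz) (hY.diffVF hVo hz) (hZ.diffVF hVo hz) k
  rw [F.comp_nabla (hV hx) (hX.diffVF hVo hx) (hN.diffVF hVo hx), h]
  simp only [F.comp_nabla (hV hx) (hY.diffVF hVo hx) (hZ.diffVF hVo hx), add_assoc]

/-- The components of the curvature of the torsion connection. -/
theorem comp_curvature (F : AdaptedFrame Φ e U) (hVo : IsOpen V) (hV : V ⊆ U)
    (hX : SmoothVF X V) (hY : SmoothVF Y V) (hZ : SmoothVF Z V) (hx : x ∈ V) (k : Fin 8) :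
    comp e (curvature Φ X Y Z x) k = ∑ a, ∑ b, ∑ j, comp e (X x) a * comp e (Y x) b
      * comp e (Z x) j * curvArr (connFn e x) (torsionFn e x) (connDer e x) a b j k := by
  simp only [curvArr, structArr_connFn]
  rw [← curvature_sum_identity, curvature, comp_sub, comp_sub,
    F.comp_nabla_nabla hVo hV hX hY hZ hx, F.comp_nabla_nabla hVo hV hY hX hZ hx,
    F.comp_nabla (hV hx) ((hX.bracket hY hVo).diffVF hVo hx) (hZ.diffVF hVo hx),
    F.lieD_bracket hVo hV hX hY (F.smoothFn_comp hV hZ k) hx]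
  simp only [F.comp_bracket (hV hx) (hX.diffVF hVo hx) (hY.diffVF hVo hx)]
  ring

theorem ricci_eq (F : AdaptedFrame Φ e U) (hx : x ∈ U) (u v : TangentSpace 𝓘(ℝ, E8) x) :
    ricci Φ x u v = ∑ j, ∑ k, comp e u j * comp e v k
      * ricArr (connFn e x) (torsionFn e x) (connDer e x) j k := by
  -- `ext` is known to be smooth only on the source of the chart at `x`, hence the intersection.
  have hVo := F.isOpen.inter (chartAt E8 x).open_source
  have hs (w : TangentSpace 𝓘(ℝ, E8) x) : SmoothVF (ext w) (U ∩ (chartAt E8 x).source) :=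
    (smoothVF_ext w).mono Set.inter_subset_right
  have hc (w : TangentSpace 𝓘(ℝ, E8) x) :
      inner ℝ (curvature Φ (ext w) (ext u) (ext v) x) w
        = ∑ l, (∑ a, ∑ b, ∑ j, comp e w a * comp e u b
      * comp e v j * curvArr (connFn e x) (torsionFn e x) (connDer e x) a b j l) * comp e w l := by
    rw [F.inner_eq hx]
    simp only [F.comp_curvature hVo Set.inter_subset_left (hs w) (hs u) (hs v)
      ⟨hx, mem_chart_source E8 x⟩, ext_self]
  rw [ricci]
  simp only [hc]
  rw [F.trace_eq hx (B := fun w w' => ∑ l, (∑ a, ∑ b, ∑ j, comp e w a * comp e u b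
      * comp e v j * curvArr (connFn e x) (torsionFn e x) (connDer e x) a b j l) * comp e w' l)]
  · simp only [F.comp_frame hx, sum_mul_kron, mul_assoc, ← Finset.mul_sum, sum_kron_mul, ricArr]
    simp only [Finset.mul_sum]
    rw [← sum_pull₂]
  · exact fun w => isLinearMap_sum _ fun l => isLinearMap_mul_const (isLinearMap_sum _ fun a =>
      isLinearMap_sum _ fun b => isLinearMap_sum _ fun j => isLinearMap_mul_const
        (isLinearMap_mul_const (isLinearMap_mul_const (isLinearMap_compFn e x a) _) _) _) _
  · exact fun w => isLinearMap_sum _ fun l => isLinearMap_const_mul (isLinearMap_compFn e x l) _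

theorem contr₃_torsionDer (F : AdaptedFrame Φ e U) (hx : x ∈ U) (l i : Fin 8) :
    contr₃ (torsionDer e x l) i = 7 * lieD (e l) (fun z => leeArr (christoffel e z) i) x := by
  have hd (i j k : Fin 8) := (F.smoothFn_torsionFn i j k).diffFn F.isOpen hx
  have hm (a b c : Fin 8) : DiffFn (fun z => phi i a b c * torsionFn e z a b c) x :=
    mdifferentiableAt_const.mul (hd a b c)
  rw [← lieD_const_mul ((F.smoothFn_leeArr i).diffFn F.isOpen hx)]
  simp only [← contr₃_torsionFn, contr₃, mul_comm _ (phi _ _ _ _)]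
  rw [lieD_sum _ fun a _ => diffFn_sum _ fun b _ => diffFn_sum _ fun c _ => hm a b c]
  refine Finset.sum_congr rfl fun a _ => ?_
  rw [lieD_sum _ fun b _ => diffFn_sum _ fun c _ => hm a b c]
  refine Finset.sum_congr rfl fun b _ => ?_
  rw [lieD_sum _ fun c _ => hm a b c]
  exact Finset.sum_congr rfl fun c _ => by rw [lieD_const_mul (hd a b c), torsionDer]

theorem covLeeArr_eq (F : AdaptedFrame Φ e U) (hx : x ∈ U) (j k : Fin 8) :
    covLeeArr (connFn e x) (torsionFn e x) (torsionDer e x) j k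
      = lieD (e j) (fun z => leeArr (christoffel e z) k) x
        - ∑ s, connFn e x j k s * leeArr (christoffel e x) s := by
  simp only [covLeeArr, F.contr₃_torsionDer hx, contr₃_torsionFn, mul_left_comm _ (7 : ℝ),
    ← Finset.mul_sum]
  ring

theorem lieD_leeForm (F : AdaptedFrame Φ e U) (hx : x ∈ U) (hY : DiffVF Y x) :
    lieD X (fun z => leeForm Φ z (Y z)) x
      = ∑ a, lieD X (fun z => comp e (Y z) a) x * leeArr (christoffel e x) a
        + ∑ j, ∑ k, comp e (X x) j * comp e (Y x) k
          * lieD (e j) (fun z => leeArr (christoffel e z) k) x := by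
  have dY := F.diffFn_comp hx hY
  have dL (a : Fin 8) := (F.smoothFn_leeArr a).diffFn F.isOpen hx
  have dP (a : Fin 8) : DiffFn (fun z => comp e (Y z) a * leeArr (christoffel e z) a) x :=
    (dY a).mul (dL a)
  rw [lieD_congr (g := fun z => ∑ a, comp e (Y z) a * leeArr (christoffel e z) a),
    lieD_sum _ fun a _ => dP a]
  · rw [Finset.sum_comm, ← Finset.sum_add_distrib]
    refine Finset.sum_congr rfl fun a _ => ?_
    rw [lieD_mul (dY a) (dL a), lieD_eq_sum (f := fun z => leeArr (christoffel e z) a)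
      (F.sum_comp hx (X x)), Finset.mul_sum, add_comm, mul_comm]
    exact congrArg _ (Finset.sum_congr rfl fun j _ => by ring)
  · filter_upwards [F.isOpen.mem_nhds hx] with z hz using F.leeForm_eq hz _

theorem nablaLee_eq (F : AdaptedFrame Φ e U) (hx : x ∈ U) (u v : TangentSpace 𝓘(ℝ, E8) x) :
    nablaLee Φ x u v = ∑ j, ∑ k, comp e u j * comp e v k
      * covLeeArr (connFn e x) (torsionFn e x) (torsionDer e x) j k := by
  have h : ∑ a, (∑ i, ∑ j, comp e u i * comp e v j * connFn e x i j a) * leeArr (christoffel e x) a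
      = ∑ j, ∑ k, comp e u j * comp e v k * ∑ s, connFn e x j k s * leeArr (christoffel e x) s := by
    simp only [Finset.sum_mul, Finset.mul_sum]
    rw [← sum_pull₂]
    exact Finset.sum_congr rfl fun i _ => Finset.sum_congr rfl fun j _ =>
      Finset.sum_congr rfl fun k _ => by ring
  rw [nablaLee, F.lieD_leeForm hx (diffVF_ext v), F.leeForm_eq hx]
  simp only [F.comp_nabla hx (diffVF_ext u) (diffVF_ext v), ext_self, add_mul,
    Finset.sum_add_distrib, h, F.covLeeArr_eq hx, mul_sub, Finset.sum_sub_distrib]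
  ring

/-- `dθ` is the skew part of `∇θ` plus the torsion term `T_{jks} θ_s`, where `θ` is written as
`contr₃ T / 7`. This is the expression that `mem21_extD_leeArr` puts in `Λ²₂₁`. -/
theorem extD₁_leeForm_eq (F : AdaptedFrame Φ e U) (hx : x ∈ U) (u v : TangentSpace 𝓘(ℝ, E8) x) :
    extD₁ (leeForm Φ) x u v = ∑ j, ∑ k, comp e u j * comp e v k
      * (covLeeArr (connFn e x) (torsionFn e x) (torsionDer e x) j k
        - covLeeArr (connFn e x) (torsionFn e x) (torsionDer e x) k j
        + (1 / 7) * ∑ s, torsionFn e x j k s * contr₃ (torsionFn e x) s) := by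
  have h₁ : ∑ a, (∑ i, ∑ j, comp e u i * comp e v j * structFn e x i j a)
        * leeArr (christoffel e x) a
      = ∑ j, ∑ k, comp e u j * comp e v k
        * ∑ s, structFn e x j k s * leeArr (christoffel e x) s := by
    simp only [Finset.sum_mul, Finset.mul_sum]
    rw [← sum_pull₂]
    exact Finset.sum_congr rfl fun i _ => Finset.sum_congr rfl fun j _ =>
      Finset.sum_congr rfl fun k _ => by ring
  have h₂ : ∑ j, ∑ k, comp e v j * comp e u k * lieD (e j) (fun z => leeArr (christoffel e z) k) x
      = ∑ j, ∑ k, comp e u j * comp e v k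
        * lieD (e k) (fun z => leeArr (christoffel e z) j) x := by
    rw [Finset.sum_comm]
    exact Finset.sum_congr rfl fun i _ => Finset.sum_congr rfl fun j _ => by ring
  have h₃ (j k : Fin 8) : covLeeArr (connFn e x) (torsionFn e x) (torsionDer e x) j k
        - covLeeArr (connFn e x) (torsionFn e x) (torsionDer e x) k j
        + (1 / 7) * ∑ s, torsionFn e x j k s * contr₃ (torsionFn e x) s
      = lieD (e j) (fun z => leeArr (christoffel e z) k) x
        - lieD (e k) (fun z => leeArr (christoffel e z) j) x
        - ∑ s, structFn e x j k s * leeArr (christoffel e x) s := by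
    simp only [F.covLeeArr_eq hx, ← structArr_connFn, structArr, contr₃_torsionFn, sub_mul,
      Finset.sum_sub_distrib, mul_left_comm _ (7 : ℝ), ← Finset.mul_sum]
    ring
  rw [extD₁, d₁, F.lieD_leeForm hx (diffVF_ext v), F.lieD_leeForm hx (diffVF_ext u),
    F.leeForm_eq hx]
  simp only [F.comp_bracket hx (diffVF_ext u) (diffVF_ext v), ext_self, h₃, mul_sub, add_mul,
    sub_mul, Finset.sum_add_distrib, Finset.sum_sub_distrib, h₁, h₂]
  ring

end AdaptedFrame

end CurvatureFormula

/-! ### Tensoriality of the exterior derivative of the torsion -/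

section ExteriorDerivative

variable {M : Type*} [TopologicalSpace M] [ChartedSpace E8 M] [IsManifold 𝓘(ℝ, E8) ∞ M]
  [Bundle.RiemannianBundle (fun x : M => TangentSpace 𝓘(ℝ, E8) x)]

variable {e : Fin 8 → VF M} {U V : Set M} {X Y Z W : VF M} {x y : M}
  {Φ : Π x : M, TangentSpace 𝓘(ℝ, E8) x [⋀^Fin 4]→ₗ[ℝ] ℝ}

theorem diffFn_congr {f g : M → ℝ} (hg : DiffFn g x) (h : ∀ᶠ z in nhds x, f z = g z) :
    DiffFn f x := hg.congr_of_eventuallyEq h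

namespace AdaptedFrame

variable [IsContMDiffRiemannianBundle 𝓘(ℝ, E8) ∞ E8 (fun x : M => TangentSpace 𝓘(ℝ, E8) x)]

theorem diffFn_torsionForm (F : AdaptedFrame Φ e U) (hx : x ∈ U) (hX : DiffVF X x)
    (hY : DiffVF Y x) (hZ : DiffVF Z x) :
    DiffFn (fun z => torsionForm Φ z (X z) (Y z) (Z z)) x := by
  refine diffFn_congr (g := fun z => ∑ i, ∑ j, ∑ k, comp e (X z) i * comp e (Y z) j * comp e (Z z) k
    * torsionFn e z i j k) ?_ ?_
  · exact diffFn_sum _ fun i _ => diffFn_sum _ fun j _ => diffFn_sum _ fun k _ =>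
      (((F.diffFn_comp hx hX i).mul (F.diffFn_comp hx hY j)).mul (F.diffFn_comp hx hZ k)).mul
        ((F.smoothFn_torsionFn i j k).diffFn F.isOpen hx)
  · filter_upwards [F.isOpen.mem_nhds hx] with z hz using F.torsionForm_eq hz _ _ _

theorem smoothFn_torsionForm (F : AdaptedFrame Φ e U) (hV : V ⊆ U) (hX : SmoothVF X V)
    (hY : SmoothVF Y V) (hZ : SmoothVF Z V) :
    SmoothFn (fun z => torsionForm Φ z (X z) (Y z) (Z z)) V := by
  have h : SmoothFn (fun z => ∑ i, ∑ j, ∑ k, comp e (X z) i * comp e (Y z) j * comp e (Z z) k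
      * torsionFn e z i j k) V :=
    SmoothFn.sum _ fun i _ => SmoothFn.sum _ fun j _ => SmoothFn.sum _ fun k _ =>
      (((F.smoothFn_comp hV hX i).mul (F.smoothFn_comp hV hY j)).mul (F.smoothFn_comp hV hZ k)).mul
        ((F.smoothFn_torsionFn i j k).mono hV)
  exact h.congr fun z hz => F.torsionForm_eq (hV hz) _ _ _

theorem lieD_torsionForm_swap₀₁ (F : AdaptedFrame Φ e U) (hx : x ∈ U) (hX : DiffVF X x)
    (hY : DiffVF Y x) (hZ : DiffVF Z x) :
    lieD W (fun z => torsionForm Φ z (Y z) (X z) (Z z)) x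
      = -lieD W (fun z => torsionForm Φ z (X z) (Y z) (Z z)) x := by
  rw [← lieD_neg (F.diffFn_torsionForm hx hX hY hZ)]
  refine lieD_congr ?_
  filter_upwards [F.isOpen.mem_nhds hx] with z hz using F.torsionForm_swap₀₁ hz _ _ _

theorem lieD_torsionForm_swap₁₂ (F : AdaptedFrame Φ e U) (hx : x ∈ U) (hX : DiffVF X x)
    (hY : DiffVF Y x) (hZ : DiffVF Z x) :
    lieD W (fun z => torsionForm Φ z (X z) (Z z) (Y z)) x
      = -lieD W (fun z => torsionForm Φ z (X z) (Y z) (Z z)) x := by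
  rw [← lieD_neg (F.diffFn_torsionForm hx hX hY hZ)]
  refine lieD_congr ?_
  filter_upwards [F.isOpen.mem_nhds hx] with z hz using F.torsionForm_swap₁₂ hz _ _ _

theorem d₃_swap₀₁ (F : AdaptedFrame Φ e U) (hx : x ∈ U) (hX : DiffVF X x) (hY : DiffVF Y x)
    (hZ : DiffVF Z x) (hW : DiffVF W x) :
    d₃ (torsionForm Φ) Y X Z W x = -d₃ (torsionForm Φ) X Y Z W x := by
  have n (u v w : TangentSpace 𝓘(ℝ, E8) x) : torsionForm Φ x (-u) v w = -torsionForm Φ x u v w :=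
    (F.isLinearMap_torsionForm₀ hx v w).map_neg u
  rw [d₃, d₃, F.lieD_torsionForm_swap₀₁ hx hX hY hW, F.lieD_torsionForm_swap₀₁ hx hX hY hZ,
    bracket_swap (X := Y) (Y := X), n, F.torsionForm_swap₁₂ hx _ (X x) (Y x)]
  ring

theorem d₃_swap₁₂ (F : AdaptedFrame Φ e U) (hx : x ∈ U) (hX : DiffVF X x) (hY : DiffVF Y x)
    (hZ : DiffVF Z x) (hW : DiffVF W x) :
    d₃ (torsionForm Φ) X Z Y W x = -d₃ (torsionForm Φ) X Y Z W x := by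
  have n (u v w : TangentSpace 𝓘(ℝ, E8) x) : torsionForm Φ x (-u) v w = -torsionForm Φ x u v w :=
    (F.isLinearMap_torsionForm₀ hx v w).map_neg u
  rw [d₃, d₃, F.lieD_torsionForm_swap₀₁ hx hY hZ hW, F.lieD_torsionForm_swap₁₂ hx hX hY hZ,
    bracket_swap (X := Z) (Y := Y), n, F.torsionForm_swap₁₂ hx _ (Y x) (Z x)]
  ring

theorem d₃_swap₂₃ (F : AdaptedFrame Φ e U) (hx : x ∈ U) (hX : DiffVF X x) (hY : DiffVF Y x)
    (hZ : DiffVF Z x) (hW : DiffVF W x) :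
    d₃ (torsionForm Φ) X Y W Z x = -d₃ (torsionForm Φ) X Y Z W x := by
  have n (u v w : TangentSpace 𝓘(ℝ, E8) x) : torsionForm Φ x (-u) v w = -torsionForm Φ x u v w :=
    (F.isLinearMap_torsionForm₀ hx v w).map_neg u
  rw [d₃, d₃, F.lieD_torsionForm_swap₁₂ hx hY hZ hW, F.lieD_torsionForm_swap₁₂ hx hX hZ hW,
    bracket_swap (X := W) (Y := Z), n, F.torsionForm_swap₁₂ hx _ (Z x) (W x)]
  ring

/-- The derivatives of the factor `f` produced by the Lie derivatives cancel those produced by the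
brackets. Tensoriality in the first slot is enough, because `d₃` is skew and the other slots can be
moved to the front. -/
theorem tensorialAt_d₃ (F : AdaptedFrame Φ e U) (hx : x ∈ U) (hY : DiffVF Y x)
    (hZ : DiffVF Z x) (hW : DiffVF W x) :
    TensorialAt 𝓘(ℝ, E8) E8 (fun X : VF M => d₃ (torsionForm Φ) X Y Z W x) x where
  smul {f X} hf hX := by
    have h₀ := F.isLinearMap_torsionForm₀ hx
    have hs (A B : VF M) (z : M) (hz : z ∈ U) : torsionForm Φ z (f z • X z) (A z) (B z)
        = f z * torsionForm Φ z (X z) (A z) (B z) :=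
      (F.isLinearMap_torsionForm₀ hz _ _).map_smul _ _
    have hs₁ (A : VF M) (u : TangentSpace 𝓘(ℝ, E8) x) : torsionForm Φ x u (f x • X x) (A x)
        = f x * torsionForm Φ x u (X x) (A x) :=
      (F.isLinearMap_torsionForm₁ hx _ _).map_smul _ _
    have hl {A B C : VF M} (hA : DiffVF A x) (hB : DiffVF B x) :
        lieD C (fun z => torsionForm Φ z ((f • X) z) (A z) (B z)) x
          = f x * lieD C (fun z => torsionForm Φ z (X z) (A z) (B z)) x
            + torsionForm Φ x (X x) (A x) (B x) * lieD C f x := by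
      rw [← lieD_mul hf (F.diffFn_torsionForm hx hX hA hB)]
      refine lieD_congr ?_
      filter_upwards [F.isOpen.mem_nhds hx] with z hz using hs A B z hz
    have hb (A B C : VF M) : torsionForm Φ x (bracket (f • X) A x) (B x) (C x)
        = f x * torsionForm Φ x (bracket X A x) (B x) (C x)
          - lieD A f x * torsionForm Φ x (X x) (B x) (C x) := by
      have : bracket (f • X) A x = -lieD A f x • X x + f x • bracket X A x :=
        bracket_smul_left hf hX
      rw [this, (h₀ _ _).map_add, (h₀ _ _).map_smul, (h₀ _ _).map_smul]
      simp only [smul_eq_mul]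
      ring
    have hd (g : M → ℝ) : lieD (f • X) g x = f x * lieD X g x := by
      simp [lieD]
    have hx' : (f • X) x = f x • X x := rfl
    simp only [d₃]
    rw [hl hZ hW, hl hY hW, hl hY hZ, hb, hb, hb, hd, hx', hs₁, hs₁, hs₁, smul_eq_mul]
    ring
  add {X X'} hX hX' := by
    have h₀ := F.isLinearMap_torsionForm₀ hx
    have hl {A B C : VF M} (hA : DiffVF A x) (hB : DiffVF B x) :
        lieD C (fun z => torsionForm Φ z ((X + X') z) (A z) (B z)) x
          = lieD C (fun z => torsionForm Φ z (X z) (A z) (B z)) x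
            + lieD C (fun z => torsionForm Φ z (X' z) (A z) (B z)) x := by
      rw [← lieD_add (F.diffFn_torsionForm hx hX hA hB) (F.diffFn_torsionForm hx hX' hA hB)]
      refine lieD_congr ?_
      filter_upwards [F.isOpen.mem_nhds hx] with z hz
        using (F.isLinearMap_torsionForm₀ hz _ _).map_add _ _
    have hb (A B C : VF M) : torsionForm Φ x (bracket (X + X') A x) (B x) (C x)
        = torsionForm Φ x (bracket X A x) (B x) (C x)
          + torsionForm Φ x (bracket X' A x) (B x) (C x) := by
      have : bracket (X + X') A x = bracket X A x + bracket X' A x :=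
        VectorField.mlieBracket_add_left hX hX'
      rw [this, (h₀ _ _).map_add]
    have hs₁ (A : VF M) (u : TangentSpace 𝓘(ℝ, E8) x) : torsionForm Φ x u (X x + X' x) (A x)
        = torsionForm Φ x u (X x) (A x) + torsionForm Φ x u (X' x) (A x) :=
      (F.isLinearMap_torsionForm₁ hx _ _).map_add _ _
    have hd (g : M → ℝ) : lieD (X + X') g x = lieD X g x + lieD X' g x := by
      simp [lieD]
    have hx' : (X + X') x = X x + X' x := rfl
    simp only [d₃]
    rw [hl hZ hW, hl hY hW, hl hY hZ, hb, hb, hb, hd, hx', hs₁, hs₁, hs₁]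
    ring

theorem d₃_eq_sum₀ (F : AdaptedFrame Φ e U) (hx : x ∈ U) (hX : DiffVF X x) (hY : DiffVF Y x)
    (hZ : DiffVF Z x) (hW : DiffVF W x) :
    d₃ (torsionForm Φ) X Y Z W x
      = ∑ i, comp e (X x) i * d₃ (torsionForm Φ) (e i) Y Z W x := by
  have h := F.tensorialAt_d₃ hx hY hZ hW
  have hm : IsLinearMap ℝ (fun u : TangentSpace 𝓘(ℝ, E8) x => TensorialAt.mkHom _ x h u) :=
    ⟨map_add _, map_smul _⟩
  have := F.map_eq_sum hx hm (X x)
  simp only [TensorialAt.mkHom_apply h hX, TensorialAt.mkHom_apply h (F.diffVF hx _)] at this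
  exact this

theorem d₃_frame (F : AdaptedFrame Φ e U) (hx : x ∈ U) (i j k l : Fin 8) :
    d₃ (torsionForm Φ) (e i) (e j) (e k) (e l) x
      = extDArr (connFn e x) (torsionFn e x) (torsionDer e x) i j k l := by
  have hl (a i j k : Fin 8) :
      lieD (e a) (fun z => torsionForm Φ z (e i z) (e j z) (e k z)) x = torsionDer e x a i j k := by
    refine lieD_congr ?_
    filter_upwards [F.isOpen.mem_nhds hx] with z hz using F.torsionForm_frame hz i j k
  have hb (a b i j : Fin 8) : torsionForm Φ x (bracket (e a) (e b) x) (e i x) (e j x)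
      = ∑ s, structArr (connFn e x) (torsionFn e x) a b s * torsionFn e x s i j := by
    rw [F.map_eq_sum hx (F.isLinearMap_torsionForm₀ hx (e i x) (e j x))]
    simp only [F.torsionForm_frame hx, structArr_connFn]
    rfl
  simp only [d₃, extDArr, hl, hb, Finset.sum_add_distrib, Finset.sum_sub_distrib]
  ring

/-- The components of the exterior derivative of the torsion form in a frame. -/
theorem d₃_eq_sum (F : AdaptedFrame Φ e U) (hx : x ∈ U) (hX : DiffVF X x) (hY : DiffVF Y x)
    (hZ : DiffVF Z x) (hW : DiffVF W x) :
    d₃ (torsionForm Φ) X Y Z W x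
      = ∑ i, ∑ j, ∑ k, ∑ l, comp e (X x) i * comp e (Y x) j * comp e (Z x) k * comp e (W x) l
        * extDArr (connFn e x) (torsionFn e x) (torsionDer e x) i j k l := by
  have D := F.diffVF hx
  have h₁ (i : Fin 8) : d₃ (torsionForm Φ) (e i) Y Z W x
      = ∑ j, comp e (Y x) j * d₃ (torsionForm Φ) (e i) (e j) Z W x := by
    rw [F.d₃_swap₀₁ hx hY (D i) hZ hW, F.d₃_eq_sum₀ hx hY (D i) hZ hW, ← Finset.sum_neg_distrib]
    exact Finset.sum_congr rfl fun j _ => by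
      rw [F.d₃_swap₀₁ hx (D i) (D j) hZ hW, mul_neg, neg_neg]
  have h₂ (i j : Fin 8) : d₃ (torsionForm Φ) (e i) (e j) Z W x
      = ∑ k, comp e (Z x) k * d₃ (torsionForm Φ) (e i) (e j) (e k) W x := by
    rw [F.d₃_swap₁₂ hx (D i) hZ (D j) hW, F.d₃_swap₀₁ hx hZ (D i) (D j) hW,
      F.d₃_eq_sum₀ hx hZ (D i) (D j) hW, neg_neg]
    exact Finset.sum_congr rfl fun k _ => by
      rw [F.d₃_swap₁₂ hx (D i) (D k) (D j) hW, F.d₃_swap₀₁ hx (D k) (D i) (D j) hW, neg_neg]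
  have h₃ (i j k : Fin 8) : d₃ (torsionForm Φ) (e i) (e j) (e k) W x
      = ∑ l, comp e (W x) l * d₃ (torsionForm Φ) (e i) (e j) (e k) (e l) x := by
    rw [F.d₃_swap₂₃ hx (D i) (D j) hW (D k), F.d₃_swap₁₂ hx (D i) hW (D j) (D k),
      F.d₃_swap₀₁ hx hW (D i) (D j) (D k), F.d₃_eq_sum₀ hx hW (D i) (D j) (D k), neg_neg,
      ← Finset.sum_neg_distrib]
    exact Finset.sum_congr rfl fun l _ => by
      rw [F.d₃_swap₂₃ hx (D i) (D j) (D l) (D k), F.d₃_swap₁₂ hx (D i) (D l) (D j) (D k),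
        F.d₃_swap₀₁ hx (D l) (D i) (D j) (D k), neg_neg, mul_neg]
  rw [F.d₃_eq_sum₀ hx hX hY hZ hW]
  simp only [h₁, h₂, h₃, F.d₃_frame hx, Finset.mul_sum, mul_assoc]

theorem extD₃_eq (F : AdaptedFrame Φ e U) (hx : x ∈ U) (u v w z : TangentSpace 𝓘(ℝ, E8) x) :
    extD₃ (torsionForm Φ) x u v w z
      = ∑ i, ∑ j, ∑ k, ∑ l, comp e u i * comp e v j * comp e w k * comp e z l
        * extDArr (connFn e x) (torsionFn e x) (torsionDer e x) i j k l := by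
  rw [extD₃, F.d₃_eq_sum hx (diffVF_ext u) (diffVF_ext v) (diffVF_ext w) (diffVF_ext z)]
  simp only [ext_self]

end AdaptedFrame

end ExteriorDerivative

/-! ### The pointwise consequences: a) implies b), and the position of the exterior derivative of
the Lee form -/

section Closed

variable {M : Type*} [TopologicalSpace M] [ChartedSpace E8 M] [IsManifold 𝓘(ℝ, E8) ∞ M]
  [Bundle.RiemannianBundle (fun x : M => TangentSpace 𝓘(ℝ, E8) x)]

variable {e : Fin 8 → VF M} {U V : Set M} {X Y Z W : VF M} {x y : M}
  {Φ : Π x : M, TangentSpace 𝓘(ℝ, E8) x [⋀^Fin 4]→ₗ[ℝ] ℝ}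

/-- The components of the exterior derivative of the torsion in a frame. -/
def extDFn (e : Fin 8 → VF M) (y : M) : Fin 8 → Fin 8 → Fin 8 → Fin 8 → ℝ :=
  extDArr (connFn e y) (torsionFn e y) (torsionDer e y)

theorem OrthoFrame.sum_comp_frame₂ (F : OrthoFrame e U) (hx : x ∈ U) (i j : Fin 8)
    (B : Fin 8 → Fin 8 → ℝ) :
    ∑ a, ∑ b, comp e (e i x) a * comp e (e j x) b * B a b = B i j := by
  simp only [F.comp_frame hx, mul_assoc, ← Finset.mul_sum, sum_kron_mul]

theorem OrthoFrame.sum_comp_frame₄ (F : OrthoFrame e U) (hx : x ∈ U) (i j k l : Fin 8)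
    (B : Fin 8 → Fin 8 → Fin 8 → Fin 8 → ℝ) :
    ∑ a, ∑ b, ∑ c, ∑ d, comp e (e i x) a * comp e (e j x) b * comp e (e k x) c * comp e (e l x) d
      * B a b c d = B i j k l := by
  simp only [F.comp_frame hx, mul_assoc, ← Finset.mul_sum, sum_kron_mul]

namespace AdaptedFrame

variable [IsContMDiffRiemannianBundle 𝓘(ℝ, E8) ∞ E8 (fun x : M => TangentSpace 𝓘(ℝ, E8) x)]

theorem smoothFn_extDFn (F : AdaptedFrame Φ e U) (i j k l : Fin 8) :
    SmoothFn (fun z => extDFn e z i j k l) U := by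
  have ht (l i j k : Fin 8) : SmoothFn (fun z => torsionDer e z l i j k) U :=
    F.smoothFn_lieD F.isOpen subset_rfl (F.smooth l) (F.smoothFn_torsionFn i j k)
  have hp (a b s i j : Fin 8) : SmoothFn (fun z => structFn e z a b s * torsionFn e z s i j) U :=
    (F.smoothFn_structFn a b s).mul (F.smoothFn_torsionFn s i j)
  simp only [extDFn, extDArr, structArr_connFn]
  exact ((((ht i j k l).sub (ht j i k l)).add (ht k i j l)).sub (ht l i j k)).sub
    (SmoothFn.sum _ fun s _ => (((((hp i j s k l).sub (hp i k s j l)).add (hp i l s j k)).add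
      (hp j k s i l)).sub (hp j l s i k)).add (hp k l s i j))

theorem extDFn_swap₀₁ (F : AdaptedFrame Φ e U) (hx : x ∈ U) (i j k l : Fin 8) :
    extDFn e x j i k l = -extDFn e x i j k l := by
  have D := F.diffVF hx
  simpa only [extDFn, F.d₃_frame hx] using F.d₃_swap₀₁ hx (D i) (D j) (D k) (D l)

theorem extDFn_swap₁₂ (F : AdaptedFrame Φ e U) (hx : x ∈ U) (i j k l : Fin 8) :
    extDFn e x i k j l = -extDFn e x i j k l := by
  have D := F.diffVF hx
  simpa only [extDFn, F.d₃_frame hx] using F.d₃_swap₁₂ hx (D i) (D j) (D k) (D l)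

theorem extDFn_swap₂₃ (F : AdaptedFrame Φ e U) (hx : x ∈ U) (i j k l : Fin 8) :
    extDFn e x i j l k = -extDFn e x i j k l := by
  have D := F.diffVF hx
  simpa only [extDFn, F.d₃_frame hx] using F.d₃_swap₂₃ hx (D i) (D j) (D k) (D l)

theorem extD₃_frame (F : AdaptedFrame Φ e U) (hx : x ∈ U) (i j k l : Fin 8) :
    extD₃ (torsionForm Φ) x (e i x) (e j x) (e k x) (e l x) = extDFn e x i j k l := by
  rw [F.extD₃_eq hx, F.sum_comp_frame₄ hx, extDFn]

/-- The Ricci tensor of the torsion connection differs from the derivative of the Lee form by a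
contraction of the exterior derivative of the torsion. -/
theorem ricci_add_nablaLee (F : AdaptedFrame Φ e U) (hx : x ∈ U)
    (u v : TangentSpace 𝓘(ℝ, E8) x) :
    ricci Φ x u v + (7 / 6) * nablaLee Φ x u v
      = ∑ j, ∑ k, comp e u j * comp e v k * (-(1 / 12) * contr₃ (extDFn e x j) k) := by
  rw [F.ricci_eq hx, F.nablaLee_eq hx]
  simp only [Finset.mul_sum, ← Finset.sum_add_distrib]
  refine Finset.sum_congr rfl fun j _ => Finset.sum_congr rfl fun k _ => ?_
  rw [extDFn, ← ricArr_eq (mem21_connFn e x) (F.mem21_connDer hx) torsionFn_swap₀₁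
    torsionFn_swap₁₂ (F.torsionDer_swap₀₁ hx) (F.torsionDer_swap₁₂ hx) (F.jacobiArr hx) j k]
  ring

theorem extDFn_eq_zero (F : AdaptedFrame Φ e U) (hx : x ∈ U)
    (h : ∀ u v w z : TangentSpace 𝓘(ℝ, E8) x, extD₃ (torsionForm Φ) x u v w z = 0)
    (i j k l : Fin 8) : extDFn e x i j k l = 0 := by
  rw [← F.extD₃_frame hx, h]

theorem contr₃_extDFn_eq_zero (F : AdaptedFrame Φ e U) (hx : x ∈ U)
    (h : ∀ u v : TangentSpace 𝓘(ℝ, E8) x, ricci Φ x u v = -(7 / 6) * nablaLee Φ x u v)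
    (j k : Fin 8) : contr₃ (extDFn e x j) k = 0 := by
  have := F.ricci_add_nablaLee hx (e j x) (e k x)
  rw [h, F.sum_comp_frame₂ hx] at this
  linarith

end AdaptedFrame

variable [IsContMDiffRiemannianBundle 𝓘(ℝ, E8) ∞ E8 (fun x : M => TangentSpace 𝓘(ℝ, E8) x)]

theorem IsSpin7Structure.ricci_eq_of_closed (hΦ : IsSpin7Structure Φ)
    (h : ∀ u v w z : TangentSpace 𝓘(ℝ, E8) x, extD₃ (torsionForm Φ) x u v w z = 0)
    (u v : TangentSpace 𝓘(ℝ, E8) x) : ricci Φ x u v = -(7 / 6) * nablaLee Φ x u v := by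
  obtain ⟨e, U, hx, F⟩ := hΦ.exists_adaptedFrame x
  have := F.ricci_add_nablaLee hx u v
  simp only [contr₃, F.extDFn_eq_zero hx h, zero_mul, Finset.sum_const_zero, mul_zero] at this
  linarith

theorem IsSpin7Structure.memLambda21_of_closed (hΦ : IsSpin7Structure Φ)
    (h : ∀ u v w z : TangentSpace 𝓘(ℝ, E8) x, extD₃ (torsionForm Φ) x u v w z = 0) :
    MemLambda21 Φ x (extD₁ (leeForm Φ) x) := by
  obtain ⟨e, U, hx, F⟩ := hΦ.exists_adaptedFrame x
  have hM := mem21_extD_leeArr (mem21_connFn e x) (F.mem21_connDer hx) torsionFn_swap₀₁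
    torsionFn_swap₁₂ (F.torsionDer_swap₀₁ hx) (F.torsionDer_swap₁₂ hx) (F.jacobiArr hx)
    (F.extDFn_eq_zero hx h)
  have hβ := F.extD₁_leeForm_eq hx
  -- From here on only bilinearity and `Mem21` of the components matter; the rest transfers the
  -- contraction from the frame to `onb`.
  generalize hB : (fun j k => covLeeArr (connFn e x) (torsionFn e x) (torsionDer e x) j k
        - covLeeArr (connFn e x) (torsionFn e x) (torsionDer e x) k j
        + (1 / 7) * ∑ s, torsionFn e x j k s * contr₃ (torsionFn e x) s) = B at hM
  have hβ' (u v : TangentSpace 𝓘(ℝ, E8) x) :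
      extD₁ (leeForm Φ) x u v = ∑ j, ∑ k, comp e u j * comp e v k * B j k := by
    rw [hβ, ← hB]
  have L₀ (v : TangentSpace 𝓘(ℝ, E8) x) : IsLinearMap ℝ fun u => extD₁ (leeForm Φ) x u v := by
    simp only [hβ']
    exact isLinearMap_sum _ fun j => isLinearMap_sum _ fun k => isLinearMap_mul_const
      (isLinearMap_mul_const (isLinearMap_compFn e x j) _) _
  have L₁ (u : TangentSpace 𝓘(ℝ, E8) x) : IsLinearMap ℝ fun v => extD₁ (leeForm Φ) x u v := by
    simp only [hβ']
    exact isLinearMap_sum _ fun j => isLinearMap_sum _ fun k => isLinearMap_mul_const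
      (isLinearMap_const_mul (isLinearMap_compFn e x k) _) _
  intro u v
  have h₁ (a : TangentSpace 𝓘(ℝ, E8) x) :
      ∑ j, extD₁ (leeForm Φ) x a (onb x j) * Φ x ![a, onb x j, u, v]
        = ∑ j, extD₁ (leeForm Φ) x a (e j x) * Φ x ![a, e j x, u, v] :=
    F.trace_eq hx (B := fun b b' => extD₁ (leeForm Φ) x a b * Φ x ![a, b', u, v])
      (fun _ => isLinearMap_mul_const (L₁ a) _)
      (fun _ => isLinearMap_const_mul (isLinearMap_slot₁ _ _ _ _) _)
  have h₀ : ∑ i, ∑ j, extD₁ (leeForm Φ) x (onb x i) (e j x) * Φ x ![onb x i, e j x, u, v]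
      = ∑ i, ∑ j, extD₁ (leeForm Φ) x (e i x) (e j x) * Φ x ![e i x, e j x, u, v] :=
    F.trace_eq hx (B := fun b b' => ∑ j, extD₁ (leeForm Φ) x b (e j x) * Φ x ![b', e j x, u, v])
      (fun _ => isLinearMap_sum _ fun j => isLinearMap_mul_const (L₀ _) _)
      (fun _ => isLinearMap_sum _ fun j => isLinearMap_const_mul (isLinearMap_slot₀ _ _ _ _) _)
  have hΦ' (i j : Fin 8) : Φ x ![e i x, e j x, u, v]
      = ∑ k, ∑ l, comp e u k * comp e v l * phi i j k l := by
    rw [F.map_eq_sum hx (isLinearMap_slot₂ (Φ x) (e i x) (e j x) v) u]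
    refine Finset.sum_congr rfl fun k _ => ?_
    rw [F.map_eq_sum hx (isLinearMap_slot₃ (Φ x) (e i x) (e j x) (e k x)) v, Finset.mul_sum]
    exact Finset.sum_congr rfl fun l _ => by rw [F.form_frame hx]; ring
  rw [Finset.sum_congr rfl fun i _ => h₁ (onb x i), h₀, hβ', Finset.mul_sum]
  simp only [hβ', F.sum_comp_frame₂ hx, hΦ', Finset.mul_sum]
  rw [sum_pull₂]
  refine Finset.sum_congr rfl fun k _ => ?_
  rw [sum_pull₂]
  refine Finset.sum_congr rfl fun l _ => ?_
  have := hM k l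
  simp only [mul_left_comm (B _ _), ← Finset.mul_sum, this]
  ring

end Closed

/-! ### Sums over permutations -/

section Permutations

open Equiv

/-- The sign of a permutation, as a real number. -/
def sgn (σ : Perm (Fin 8)) : ℝ := ((Perm.sign σ : ℤ) : ℝ)

theorem sgn_mul_self (σ : Perm (Fin 8)) : sgn σ * sgn σ = 1 := by
  rw [sgn, ← Int.cast_mul, ← Units.val_mul, Int.units_mul_self]; simp

/-- The alternating sum of an array over all permutations. -/
def altSum (G : (Fin 8 → Fin 8) → ℝ) : ℝ := ∑ σ : Perm (Fin 8), sgn σ * G σ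

theorem altSum_comp (τ : Perm (Fin 8)) (G : (Fin 8 → Fin 8) → ℝ) :
    altSum (fun f => G (f ∘ τ)) = sgn τ * altSum G := by
  rw [altSum, altSum, ← Equiv.sum_comp (Equiv.mulRight τ) (fun σ : Perm (Fin 8) => sgn σ * G σ),
    Finset.mul_sum]
  refine Finset.sum_congr rfl fun σ _ => ?_
  have h : sgn (σ * τ) = sgn σ * sgn τ := by simp [sgn]
  rw [Equiv.coe_mulRight, h, Perm.coe_mul]
  linear_combination -sgn σ * G (σ ∘ τ) * sgn_mul_self τ

theorem altSum_add (G G' : (Fin 8 → Fin 8) → ℝ) :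
    altSum (fun f => G f + G' f) = altSum G + altSum G' := by
  simp only [altSum, mul_add, Finset.sum_add_distrib]

theorem altSum_sub (G G' : (Fin 8 → Fin 8) → ℝ) :
    altSum (fun f => G f - G' f) = altSum G - altSum G' := by
  simp only [altSum, mul_sub, Finset.sum_sub_distrib]

/-- An alternating sum of an array that is symmetric in two indices vanishes. -/
theorem altSum_eq_zero {a b : Fin 8} (hab : a ≠ b) {G : (Fin 8 → Fin 8) → ℝ}
    (h : ∀ f, G (f ∘ swap a b) = G f) : altSum G = 0 := by
  have := altSum_comp (swap a b) G
  simp only [h, sgn, Perm.sign_swap hab] at this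
  push_cast at this
  linarith

/-- `altSum` plays the role of the coefficient of a top-degree form, so a change of basis multiplies
it by the determinant. -/
theorem altSum_transform (P : Matrix (Fin 8) (Fin 8) ℝ) (G : (Fin 8 → Fin 8) → ℝ) :
    altSum (fun g => ∑ f : Fin 8 → Fin 8, (∏ k, P (g k) (f k)) * G f) = P.det * altSum G := by
  have h (f : Fin 8 → Fin 8) :
      ∑ σ : Perm (Fin 8), sgn σ * ∏ k, P (σ k) (f k) = (P.submatrix id f).det := by
    rw [Matrix.det_apply']
    rfl
  simp only [altSum, Finset.mul_sum, ← mul_assoc]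
  rw [Finset.sum_comm]
  simp only [← Finset.sum_mul, h]
  -- A non-injective choice of columns gives a determinant with two equal columns; the bijective
  -- ones give `± det P`.
  rw [← Finset.sum_subset (Finset.subset_univ (Finset.univ.filter Function.Bijective))]
  · refine (Finset.sum_bij (fun (σ : Perm (Fin 8)) _ => (σ : Fin 8 → Fin 8)) ?_ ?_ ?_ ?_).symm
    · intro σ _
      exact Finset.mem_filter.2 ⟨Finset.mem_univ _, σ.bijective⟩
    · intro σ _ τ _ h
      exact DFunLike.coe_injective h
    · intro f hf
      exact ⟨Equiv.ofBijective f (Finset.mem_filter.1 hf).2, Finset.mem_univ _, rfl⟩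
    · intro σ _
      rw [Matrix.det_permute', sgn]
      ring
  · intro f _ hf
    have hn : ¬ Function.Injective f := fun hi =>
      hf (Finset.mem_filter.2 ⟨Finset.mem_univ _, Finite.injective_iff_bijective.1 hi⟩)
    obtain ⟨i, j, hij, hne⟩ : ∃ i j, f i = f j ∧ i ≠ j := by
      simpa [Function.Injective] using hn
    rw [Matrix.det_zero_of_column_eq hne (fun k => by simp [hij]), zero_mul]

theorem sum_fin_four (F : Fin 8 → Fin 8 → Fin 8 → Fin 8 → ℝ) :
    ∑ J : Fin 4 → Fin 8, F (J 0) (J 1) (J 2) (J 3) = ∑ i, ∑ j, ∑ k, ∑ l, F i j k l := by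
  have h {n : ℕ} (G : (Fin (n + 1) → Fin 8) → ℝ) :
      ∑ J, G J = ∑ i, ∑ J : Fin n → Fin 8, G (Fin.cons i J) := by
    rw [← Fintype.sum_prod_type' (f := fun i J => G (Fin.cons i J))]
    exact (Equiv.sum_comp (Fin.consEquiv fun _ => Fin 8) G).symm
  simp only [h, Finset.univ_unique, Finset.sum_singleton]
  rfl

theorem altSum_transform₄ (P : Matrix (Fin 8) (Fin 8) ℝ)
    (A B : Fin 8 → Fin 8 → Fin 8 → Fin 8 → ℝ) :
    altSum (fun g => (∑ i, ∑ j, ∑ k, ∑ l,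
          P (g 0) i * P (g 1) j * P (g 2) k * P (g 3) l * A i j k l)
        * ∑ i, ∑ j, ∑ k, ∑ l, P (g 4) i * P (g 5) j * P (g 6) k * P (g 7) l * B i j k l)
      = P.det * altSum fun g => A (g 0) (g 1) (g 2) (g 3) * B (g 4) (g 5) (g 6) (g 7) := by
  rw [← altSum_transform]
  congr 1
  ext g
  rw [← sum_fin_four, ← sum_fin_four, Finset.sum_mul_sum, ← Fintype.sum_prod_type',
    ← Equiv.sum_comp (Fin.appendEquiv (α := Fin 8) 4 4)]
  refine Finset.sum_congr rfl fun J _ => ?_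
  rw [Fin.prod_univ_eight]
  have e₀ (r : Fin 4) : Fin.appendEquiv (α := Fin 8) 4 4 J (Fin.castAdd 4 r) = J.1 r :=
    Fin.append_left _ _ r
  have e₁ (r : Fin 4) : Fin.appendEquiv (α := Fin 8) 4 4 J (Fin.natAdd 4 r) = J.2 r :=
    Fin.append_right _ _ r
  rw [show Fin.appendEquiv (α := Fin 8) 4 4 J 0 = J.1 0 from e₀ 0,
    show Fin.appendEquiv (α := Fin 8) 4 4 J 1 = J.1 1 from e₀ 1,
    show Fin.appendEquiv (α := Fin 8) 4 4 J 2 = J.1 2 from e₀ 2,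
    show Fin.appendEquiv (α := Fin 8) 4 4 J 3 = J.1 3 from e₀ 3,
    show Fin.appendEquiv (α := Fin 8) 4 4 J 4 = J.2 0 from e₁ 0,
    show Fin.appendEquiv (α := Fin 8) 4 4 J 5 = J.2 1 from e₁ 1,
    show Fin.appendEquiv (α := Fin 8) 4 4 J 6 = J.2 2 from e₁ 2,
    show Fin.appendEquiv (α := Fin 8) 4 4 J 7 = J.2 3 from e₁ 3]
  ring

/-- The number of permutations of eight letters that fix the first four. -/
def fixCount : ℕ :=
  (Finset.univ.filter fun σ : Perm (Fin 8) => ∀ r : Fin 4, σ (Fin.castAdd 4 r) = Fin.castAdd 4 r).card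

theorem fixCount_pos : 0 < fixCount := Finset.card_pos.2 ⟨1, by simp⟩

/-- Permutations are grouped by their values on the first four letters. Every injective quadruple
occurs the same number of times, and the others contribute nothing by hypothesis. -/
theorem sum_perm_eq (A : Fin 8 → Fin 8 → Fin 8 → Fin 8 → ℝ)
    (h : ∀ J : Fin 4 → Fin 8, ¬ Function.Injective J → A (J 0) (J 1) (J 2) (J 3) = 0) :
    ∑ σ : Perm (Fin 8), A (σ 0) (σ 1) (σ 2) (σ 3)
      = fixCount * ∑ i, ∑ j, ∑ k, ∑ l, A i j k l := by
  rw [← sum_fin_four, Finset.mul_sum, ← Finset.sum_fiberwise Finset.univ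
    (fun (σ : Perm (Fin 8)) (r : Fin 4) => σ (Fin.castAdd 4 r))]
  refine Finset.sum_congr rfl fun J _ => ?_
  have hc (σ) (hσ : σ ∈ Finset.univ.filter fun σ : Perm (Fin 8) =>
      (fun r : Fin 4 => σ (Fin.castAdd 4 r)) = J) :
      A (σ 0) (σ 1) (σ 2) (σ 3) = A (J 0) (J 1) (J 2) (J 3) := by
    rw [← (Finset.mem_filter.1 hσ).2]
    rfl
  rw [Finset.sum_congr rfl hc, Finset.sum_const, nsmul_eq_mul]
  by_cases hJ : Function.Injective J
  · congr 2
    -- Left multiplication by an extension `τ` of `J` maps the stabilizer of the first four letters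
    -- onto the fibre over `J`.
    obtain ⟨τ, hτ⟩ : ∃ τ : Perm (Fin 8), ∀ r : Fin 4, τ (Fin.castAdd 4 r) = J r := by
      classical
      refine ⟨((Equiv.ofInjective _ (Fin.castAdd_injective 4 4)).symm.trans
        (Equiv.ofInjective J hJ)).extendSubtype, fun r => ?_⟩
      rw [extendSubtype_apply_of_mem _ _ ⟨r, rfl⟩]
      simp [Equiv.ofInjective_symm_apply]
    refine (Finset.card_bij (fun σ _ => τ * σ) ?_ ?_ ?_).symm
    · intro σ hσ
      simp only [Finset.mem_filter, Finset.mem_univ, true_and] at hσ ⊢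
      ext1 r
      rw [Perm.mul_apply, hσ, hτ]
    · intro σ _ σ' _ h
      exact mul_left_cancel h
    · intro σ hσ
      simp only [Finset.mem_filter, Finset.mem_univ, true_and] at hσ
      refine ⟨τ⁻¹ * σ, ?_, by simp⟩
      simp only [Finset.mem_filter, Finset.mem_univ, true_and]
      intro r
      rw [Perm.mul_apply, congrFun hσ r, ← hτ r, Perm.inv_def, symm_apply_apply]
  · rw [h J hJ, mul_zero, mul_zero]

/-- The alternating product of an array with a self-dual array is a full contraction. -/
theorem altSum_mul_selfDual (A : Fin 8 → Fin 8 → Fin 8 → Fin 8 → ℝ)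
    {H : Fin 8 → Fin 8 → Fin 8 → Fin 8 → ℝ} (h₀ : ∀ i j k l, H j i k l = -H i j k l)
    (h₁ : ∀ i j k l, H i k j l = -H i j k l) (h₂ : ∀ i j k l, H i j l k = -H i j k l)
    (hs : ∀ σ : Perm (Fin 8), H (σ 4) (σ 5) (σ 6) (σ 7) = sgn σ * H (σ 0) (σ 1) (σ 2) (σ 3)) :
    altSum (fun g => A (g 0) (g 1) (g 2) (g 3) * H (g 4) (g 5) (g 6) (g 7))
      = fixCount * ∑ i, ∑ j, ∑ k, ∑ l, A i j k l * H i j k l := by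
  rw [← sum_perm_eq fun i j k l => A i j k l * H i j k l]
  · refine Finset.sum_congr rfl fun σ _ => ?_
    beta_reduce
    rw [hs, mul_left_comm (A _ _ _ _), ← mul_assoc, sgn_mul_self, one_mul]
  · intro J hJ
    have z₀ (i k l) : H i i k l = 0 := by have := h₀ i i k l; linarith
    have z₁ (i j l) : H i j j l = 0 := by have := h₁ i j j l; linarith
    have z₂ (i j k) : H i j k k = 0 := by have := h₂ i j k k; linarith
    have z₃ (i j k) : H i j i k = 0 := by rw [h₁, z₀, neg_zero]
    have z₄ (i j k) : H i j k j = 0 := by rw [h₂, z₁, neg_zero]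
    have z₅ (i j k) : H i j k i = 0 := by rw [h₂, z₃, neg_zero]
    obtain ⟨a, b, hab, hne⟩ : ∃ a b, J a = J b ∧ a ≠ b := by
      simpa [Function.Injective] using hJ
    have : H (J 0) (J 1) (J 2) (J 3) = 0 := by
      fin_cases a <;> fin_cases b <;> first | exact absurd rfl hne | skip
      all_goals
        simp only [Fin.zero_eta, Fin.mk_one, Fin.reduceFinMk] at hab
        simp only [hab, z₀, z₁, z₂, z₃, z₄, z₅]
    rw [this, mul_zero]

/-- The exterior derivative of a 3-form in coordinates: `t' a b c d` stands for `∂_a t_{bcd}`. -/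
def coordD (t' : Fin 8 → Fin 8 → Fin 8 → Fin 8 → ℝ) (a b c d : Fin 8) : ℝ :=
  t' a b c d - t' b a c d + t' c a b d - t' d a b c

/-- The coordinate identity `d(t ∧ dt) = dt ∧ dt`. -/
theorem altSum_coordD (t : Fin 8 → Fin 8 → Fin 8 → ℝ) (t' : Fin 8 → Fin 8 → Fin 8 → Fin 8 → ℝ)
    (t'' : Fin 8 → Fin 8 → Fin 8 → Fin 8 → Fin 8 → ℝ)
    (hs : ∀ a b c d f, t'' a b c d f = t'' b a c d f) :
    altSum (fun g => t' (g 0) (g 1) (g 2) (g 3) * coordD t' (g 4) (g 5) (g 6) (g 7)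
        + t (g 1) (g 2) (g 3) * coordD (t'' (g 0)) (g 4) (g 5) (g 6) (g 7))
      = (1 / 4) * altSum fun g => coordD t' (g 0) (g 1) (g 2) (g 3)
        * coordD t' (g 4) (g 5) (g 6) (g 7) := by
  -- The four vanishing statements are `d(dt) = 0`: second partial derivatives are symmetric.
  have z₄ : altSum (fun g => t (g 1) (g 2) (g 3) * t'' (g 0) (g 4) (g 5) (g 6) (g 7)) = 0 :=
    altSum_eq_zero (a := 0) (b := 4) (by decide) fun f => by
      simp [swap_apply_def, hs (f 4) (f 0)]
  have z₅ : altSum (fun g => t (g 1) (g 2) (g 3) * t'' (g 0) (g 5) (g 4) (g 6) (g 7)) = 0 :=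
    altSum_eq_zero (a := 0) (b := 5) (by decide) fun f => by
      simp [swap_apply_def, hs (f 5) (f 0)]
  have z₆ : altSum (fun g => t (g 1) (g 2) (g 3) * t'' (g 0) (g 6) (g 4) (g 5) (g 7)) = 0 :=
    altSum_eq_zero (a := 0) (b := 6) (by decide) fun f => by
      simp [swap_apply_def, hs (f 6) (f 0)]
  have z₇ : altSum (fun g => t (g 1) (g 2) (g 3) * t'' (g 0) (g 7) (g 4) (g 5) (g 6)) = 0 :=
    altSum_eq_zero (a := 0) (b := 7) (by decide) fun f => by
      simp [swap_apply_def, hs (f 7) (f 0)]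
  set S := altSum fun g => t' (g 0) (g 1) (g 2) (g 3) * coordD t' (g 4) (g 5) (g 6) (g 7) with hS
  have n₁ : altSum (fun g => t' (g 1) (g 0) (g 2) (g 3) * coordD t' (g 4) (g 5) (g 6) (g 7)) = -S := by
    have := altSum_comp (swap 0 1)
      fun g => t' (g 0) (g 1) (g 2) (g 3) * coordD t' (g 4) (g 5) (g 6) (g 7)
    simp [swap_apply_def, sgn] at this
    exact this
  have n₂ : altSum (fun g => t' (g 2) (g 0) (g 1) (g 3) * coordD t' (g 4) (g 5) (g 6) (g 7)) = S := by
    have := altSum_comp (swap 0 1 * swap 0 2)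
      fun g => t' (g 0) (g 1) (g 2) (g 3) * coordD t' (g 4) (g 5) (g 6) (g 7)
    simp [swap_apply_def, sgn] at this
    exact this
  have n₃ : altSum (fun g => t' (g 3) (g 0) (g 1) (g 2) * coordD t' (g 4) (g 5) (g 6) (g 7)) = -S := by
    have := altSum_comp (swap 0 1 * swap 0 2 * swap 0 3)
      fun g => t' (g 0) (g 1) (g 2) (g 3) * coordD t' (g 4) (g 5) (g 6) (g 7)
    simp [swap_apply_def, sgn] at this
    exact this
  rw [altSum_add, ← hS]
  have e₁ : altSum (fun g => t (g 1) (g 2) (g 3) * coordD (t'' (g 0)) (g 4) (g 5) (g 6) (g 7))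
      = 0 := by
    simp only [coordD, mul_add, mul_sub, altSum_add, altSum_sub, z₄, z₅, z₆, z₇]
    norm_num
  -- Each of the four terms of `coordD`, with its sign, contributes the same sum `S` after permuting
  -- indices. This is the origin of the factor `1/4`.
  have e₂ : altSum (fun g => coordD t' (g 0) (g 1) (g 2) (g 3)
      * coordD t' (g 4) (g 5) (g 6) (g 7)) = 4 * S := by
    have h : altSum (fun g => coordD t' (g 0) (g 1) (g 2) (g 3)
        * coordD t' (g 4) (g 5) (g 6) (g 7)) = S - -S + S - -S := by
      conv_rhs => enter [2]; rw [← n₃]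
      conv_rhs => enter [1, 2]; rw [← n₂]
      conv_rhs => enter [1, 1, 2]; rw [← n₁]
      rw [hS, ← altSum_sub, ← altSum_add, ← altSum_sub]
      congr 1
      ext g
      rw [coordD]
      ring
    rw [h]
    ring
  rw [e₁, e₂]
  ring

end Permutations

/-! ### Coordinate vector fields -/

section Coordinates

open VectorField

variable {M : Type*} [TopologicalSpace M] [ChartedSpace E8 M]

/-- The standard basis of `ℝ⁸`. -/
abbrev stdVec (a : Fin 8) : E8 := EuclideanSpace.single a 1

/-- The constant vector fields on `ℝ⁸`. -/
def constField (a : Fin 8) : VF E8 := fun _ => stdVec a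

/-- The coordinate vector fields of the chart at `p`. -/
def coordField (p : M) (a : Fin 8) : VF M :=
  mpullback 𝓘(ℝ, E8) 𝓘(ℝ, E8) (chartAt E8 p) (constField a)

variable [IsManifold 𝓘(ℝ, E8) ∞ M] {p q x y : M} {a b : Fin 8}

/-- The derivative of a chart at a point of its source. -/
def chartDeriv (p : M) (hy : y ∈ (chartAt E8 p).source) : TangentSpace 𝓘(ℝ, E8) y ≃L[ℝ] E8 :=
  (mdifferentiable_chart (I := 𝓘(ℝ, E8)) p).mfderiv hy

theorem coordField_eq (hy : y ∈ (chartAt E8 p).source) :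
    coordField p a y = (chartDeriv p hy).symm (stdVec a) :=
  congrArg (fun L : E8 →L[ℝ] TangentSpace 𝓘(ℝ, E8) y => L (stdVec a))
    (ContinuousLinearMap.inverse_equiv (chartDeriv p hy))

theorem chartDeriv_coordField (hy : y ∈ (chartAt E8 p).source) :
    chartDeriv p hy (coordField p a y) = stdVec a := by
  rw [coordField_eq hy, ContinuousLinearEquiv.apply_symm_apply]

theorem coordField_eq_symm (hy : y ∈ (chartAt E8 p).source) :
    coordField p a y
      = (trivializationAt E8 (TangentSpace 𝓘(ℝ, E8) : M → Type _) p).symm y (stdVec a) := by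
  have hb : y ∈ (trivializationAt E8 (TangentSpace 𝓘(ℝ, E8) : M → Type _) p).baseSet := by
    rwa [TangentBundle.trivializationAt_baseSet]
  rw [coordField_eq hy, ContinuousLinearEquiv.symm_apply_eq]
  have h := TangentBundle.continuousLinearMapAt_trivializationAt (I := 𝓘(ℝ, E8)) hy
  have h' := Bundle.Trivialization.continuousLinearMapAt_symmL (R := ℝ)
    (trivializationAt E8 (TangentSpace 𝓘(ℝ, E8) : M → Type _) p) hb (stdVec a)
  have hE : (extChartAt 𝓘(ℝ, E8) p : M → E8) = chartAt E8 p := by ext1 z; simp [mfld_simps]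
  rw [h, Bundle.Trivialization.symmL_apply (hb := hb)] at h'
  refine h'.symm.trans ?_
  have := congrArg (β := TangentSpace 𝓘(ℝ, E8) y →L[ℝ] E8)
    (fun g : M → E8 => id (mfderiv 𝓘(ℝ, E8) 𝓘(ℝ, E8) g y)) hE
  exact congrArg (fun L : TangentSpace 𝓘(ℝ, E8) y →L[ℝ] E8 =>
    L ((trivializationAt E8 (TangentSpace 𝓘(ℝ, E8) : M → Type _) p).symm y (stdVec a))) this

theorem smoothVF_coordField (p : M) (a : Fin 8) :
    SmoothVF (coordField p a) (chartAt E8 p).source := by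
  set t := trivializationAt E8 (TangentSpace 𝓘(ℝ, E8) : M → Type _) p with ht
  have hb : t.baseSet = (chartAt E8 p).source := TangentBundle.trivializationAt_baseSet p
  intro y hy
  have h (z) (hz : z ∈ t.baseSet) : (t ⟨z, coordField p a z⟩).2 = stdVec a := by
    rw [coordField_eq_symm (hb ▸ hz)]
    simp [← ht, hz]
  rw [← hb] at hy ⊢
  rw [t.contMDiffWithinAt_section _ hy]
  exact (contMDiffWithinAt_const (c := stdVec a)).congr h (h y hy)

/-- Brackets commute with pullback, and constant fields on `ℝ⁸` commute. -/
theorem bracket_coordField (hy : y ∈ (chartAt E8 p).source) :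
    bracket (coordField p a) (coordField p b) y = 0 := by
  have hc : ContMDiffAt 𝓘(ℝ, E8) 𝓘(ℝ, E8) ∞ (chartAt E8 p) y :=
    (contMDiffOn_chart (I := 𝓘(ℝ, E8)) (n := ∞) (x := p)).contMDiffAt
      ((chartAt E8 p).open_source.mem_nhds hy)
  have hd (c : Fin 8) : DiffVF (constField c) (chartAt E8 p y) := by
    refine (contMDiff_vectorSpace_iff_contDiff.2 ?_ (chartAt E8 p y)).mdifferentiableAt one_ne_zero
    exact contDiff_const
  have : IsManifold 𝓘(ℝ, E8) (minSmoothness ℝ 3) M :=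
    IsManifold.of_le (n := ∞) (by simpa using three_le_infty)
  have h := mpullback_mlieBracket (hd a) (hd b) hc (by simpa using two_le_infty)
  have h₀ : mlieBracket 𝓘(ℝ, E8) (constField a) (constField b) (chartAt E8 p y) = 0 := by
    rw [← mlieBracketWithin_univ, mlieBracketWithin_eq_lieBracketWithin]
    exact show lieBracketWithin ℝ (fun _ : E8 => stdVec a) (fun _ => stdVec b) Set.univ
      (chartAt E8 p y) = 0 by simp [lieBracketWithin]
  rw [bracket]
  refine h.symm.trans ?_
  rw [mpullback_apply, h₀, map_zero]

theorem lieD_coordField {f : M → ℝ} (hf : DiffFn f y) (hy : y ∈ (chartAt E8 p).source) :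
    lieD (coordField p a) f y
      = fderiv ℝ (f ∘ (chartAt E8 p).symm) (chartAt E8 p y) (stdVec a) := by
  set φ := chartAt E8 p with hφ
  have hfφ : MDifferentiableAt 𝓘(ℝ, E8) 𝓘(ℝ, ℝ) (f ∘ φ.symm) (φ y) := by
    refine MDifferentiableAt.comp (φ y) (g := f) (I' := 𝓘(ℝ, E8)) ?_ ?_
    · rwa [φ.left_inv hy]
    · exact mdifferentiableAt_atlas_symm (chart_mem_atlas E8 p) (φ.map_source hy)
  have hφd : MDifferentiableAt 𝓘(ℝ, E8) 𝓘(ℝ, E8) φ y :=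
    mdifferentiableAt_atlas (chart_mem_atlas E8 p) hy
  have h : f =ᶠ[nhds y] (f ∘ φ.symm) ∘ φ := by
    filter_upwards [φ.open_source.mem_nhds hy] with z hz
    simp [φ.left_inv hz]
  rw [lieD_congr h]
  have hc := mfderiv_comp y hfφ hφd
  have hv := chartDeriv_coordField (p := p) (a := a) hy
  rw [← hv, ← mfderiv_eq_fderiv]
  exact congrArg (fun L : TangentSpace 𝓘(ℝ, E8) y →L[ℝ] ℝ => L (coordField p a y)) hc

/-- The Jacobian matrix of a change of charts. -/
def jacobian (p q : M) (y : M) : Matrix (Fin 8) (Fin 8) ℝ := fun a b =>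
  fderiv ℝ (chartAt E8 q ∘ (chartAt E8 p).symm) (chartAt E8 p y) (stdVec a) b

theorem coordField_change (hp : y ∈ (chartAt E8 p).source) (hq : y ∈ (chartAt E8 q).source) :
    coordField p a y = ∑ b, jacobian p q y a b • coordField q b y := by
  have hs := (chartAt E8 p).left_inv hp
  have hT : DifferentiableAt ℝ (chartAt E8 q ∘ (chartAt E8 p).symm) (chartAt E8 p y) := by
    rw [← mdifferentiableAt_iff_differentiableAt]
    refine MDifferentiableAt.comp (chartAt E8 p y) (g := chartAt E8 q) (I' := 𝓘(ℝ, E8)) ?_ ?_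
    · rw [hs]
      exact mdifferentiableAt_atlas (chart_mem_atlas E8 q) hq
    · exact mdifferentiableAt_atlas_symm (chart_mem_atlas E8 p) ((chartAt E8 p).map_source hp)
  have hc := mfderiv_comp y hT.mdifferentiableAt
    (mdifferentiableAt_atlas (I := 𝓘(ℝ, E8)) (chart_mem_atlas E8 p) hp)
  have h : (chartAt E8 q ∘ (chartAt E8 p).symm) ∘ chartAt E8 p =ᶠ[nhds y] chartAt E8 q := by
    filter_upwards [(chartAt E8 p).open_source.mem_nhds hp] with z hz
    simp [(chartAt E8 p).left_inv hz]
  rw [h.mfderiv_eq, mfderiv_eq_fderiv] at hc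
  have hv : chartDeriv q hq (coordField p a y)
      = fderiv ℝ (chartAt E8 q ∘ (chartAt E8 p).symm) (chartAt E8 p y) (stdVec a) := by
    rw [← chartDeriv_coordField (p := p) (a := a) hp]
    exact congrArg (fun L : TangentSpace 𝓘(ℝ, E8) y →L[ℝ] E8 => L (coordField p a y)) hc
  apply (chartDeriv q hq).injective
  simp only [hv, map_sum, map_smul, chartDeriv_coordField hq]
  ext c
  simp [jacobian, Pi.single_apply]

end Coordinates

/-! ### Integration by parts in coordinates -/

section Integration

open MeasureTheory

variable {O K : Set E8} {f r : E8 → ℝ} {z : E8}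

theorem contDiff_indicator (hO : IsOpen O) (hK : IsCompact K) (hKO : K ⊆ O)
    (hf : ContDiffOn ℝ ∞ f O) (h₀ : ∀ z ∈ O, z ∉ K → f z = 0) : ContDiff ℝ ∞ (O.indicator f) := by
  rw [contDiff_iff_contDiffAt]
  intro z
  by_cases hz : z ∈ O
  · refine (hf.contDiffAt (hO.mem_nhds hz)).congr_of_eventuallyEq ?_
    filter_upwards [hO.mem_nhds hz] with w hw using Set.indicator_of_mem hw f
  · refine (contDiffAt_const (c := (0 : ℝ))).congr_of_eventuallyEq ?_
    filter_upwards [hK.isClosed.isOpen_compl.mem_nhds fun h => hz (hKO h)] with w hw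
    by_cases hwO : w ∈ O
    · rw [Set.indicator_of_mem hwO, h₀ w hwO hw]
    · exact Set.indicator_of_notMem hwO f

theorem hasCompactSupport_indicator (hK : IsCompact K) (h₀ : ∀ z ∈ O, z ∉ K → f z = 0) :
    HasCompactSupport (O.indicator f) :=
  HasCompactSupport.intro hK fun z hz => by
    by_cases hzO : z ∈ O
    · rw [Set.indicator_of_mem hzO, h₀ z hzO hz]
    · exact Set.indicator_of_notMem hzO f

theorem integral_fderiv_eq_zero (hf : ContDiff ℝ ∞ f) (hc : HasCompactSupport f) (v : E8) :
    Integrable (fun z => fderiv ℝ f z v) ∧ ∫ z, fderiv ℝ f z v = 0 := by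
  have hd : Continuous fun z => fderiv ℝ f z v :=
    (hf.continuous_fderiv (by simp)).clm_apply continuous_const
  have hi : Integrable fun z => fderiv ℝ f z v :=
    hd.integrable_of_hasCompactSupport (hc.fderiv_apply (𝕜 := ℝ) v)
  refine ⟨hi, ?_⟩
  -- Integration by parts against the constant function 1.
  have := integral_mul_fderiv_eq_neg_fderiv_mul_of_integrable (μ := (volume : Measure E8))
    (f := fun _ => (1 : ℝ)) (g := f) (v := v) (by simp) (by simpa using hi)
    (by simpa using hf.continuous.integrable_of_hasCompactSupport hc)
    (fun _ _ => differentiableAt_const _) (fun z _ => hf.differentiable (by simp) z)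
  simpa using this

theorem setIntegral_fderiv_eq_zero (hO : IsOpen O) (hK : IsCompact K) (hKO : K ⊆ O)
    (hf : ContDiffOn ℝ ∞ f O) (h₀ : ∀ z ∈ O, z ∉ K → f z = 0) (v : E8) :
    IntegrableOn (fun z => fderiv ℝ f z v) O ∧ ∫ z in O, fderiv ℝ f z v = 0 := by
  have hd : ∀ z ∈ O, fderiv ℝ (O.indicator f) z v = fderiv ℝ f z v := fun z hz => by
    rw [Filter.EventuallyEq.fderiv_eq]
    filter_upwards [hO.mem_nhds hz] with w hw using Set.indicator_of_mem hw f
  obtain ⟨hi, h⟩ := integral_fderiv_eq_zero (contDiff_indicator hO hK hKO hf h₀)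
    (hasCompactSupport_indicator hK h₀) v
  refine ⟨(integrableOn_congr_fun hd hO.measurableSet).1 hi.integrableOn, ?_⟩
  rw [← setIntegral_congr_fun hO.measurableSet hd, setIntegral_eq_integral_of_forall_compl_eq_zero, h]
  intro z hz
  have : O.indicator f =ᶠ[nhds z] fun _ => 0 := by
    filter_upwards [hK.isClosed.isOpen_compl.mem_nhds fun h => hz (hKO h)] with w hw
    by_cases hwO : w ∈ O
    · rw [Set.indicator_of_mem hwO, h₀ w hwO hw]
    · exact Set.indicator_of_notMem hwO f
  rw [this.fderiv_eq]
  simp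

/-- The partial derivatives of a function on `ℝ⁸`. -/
def partialD (a : Fin 8) (f : E8 → ℝ) (z : E8) : ℝ := fderiv ℝ f z (stdVec a)

theorem contDiffOn_partialD (hO : IsOpen O) (hf : ContDiffOn ℝ ∞ f O) (a : Fin 8) :
    ContDiffOn ℝ ∞ (partialD a f) O :=
  (hf.fderiv_of_isOpen hO (m := ∞) (by simp)).clm_apply contDiffOn_const

theorem partialD_comm (hO : IsOpen O) (hf : ContDiffOn ℝ ∞ f O) (hz : z ∈ O) (a b : Fin 8) :
    partialD a (partialD b f) z = partialD b (partialD a f) z := by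
  have hs : IsSymmSndFDerivAt ℝ f z :=
    (hf.contDiffAt (hO.mem_nhds hz)).isSymmSndFDerivAt (by simpa using two_le_infty)
  have hd : DifferentiableAt ℝ (fderiv ℝ f) z :=
    ((hf.fderiv_of_isOpen hO (m := ∞) (by simp)).contDiffAt (hO.mem_nhds hz)).differentiableAt
      (by simp)
  have h (c d : Fin 8) : partialD c (partialD d f) z
      = fderiv ℝ (fderiv ℝ f) z (stdVec c) (stdVec d) := by
    have : partialD d f = fun w => fderiv ℝ f w (stdVec d) := rfl
    rw [partialD, this, fderiv_clm_apply hd (differentiableAt_const _)]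
    simp
  rw [h, h]
  exact hs _ _

theorem partialD_mul {g : E8 → ℝ} (hf : DifferentiableAt ℝ f z) (hg : DifferentiableAt ℝ g z)
    (a : Fin 8) :
    partialD a (fun w => f w * g w) z = f z * partialD a g z + g z * partialD a f z := by
  simp [partialD, fderiv_fun_mul hf hg]

theorem partialD_add {g : E8 → ℝ} (hf : DifferentiableAt ℝ f z) (hg : DifferentiableAt ℝ g z)
    (a : Fin 8) : partialD a (fun w => f w + g w) z = partialD a f z + partialD a g z := by
  simp [partialD, fderiv_fun_add hf hg]

theorem partialD_sub {g : E8 → ℝ} (hf : DifferentiableAt ℝ f z) (hg : DifferentiableAt ℝ g z)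
    (a : Fin 8) : partialD a (fun w => f w - g w) z = partialD a f z - partialD a g z := by
  simp [partialD, fderiv_fun_sub hf hg]

/-- Stokes' theorem for `d(r t ∧ dt)`, where `t` is a 3-form and `r` has compact support. -/
theorem integral_altSum_eq_zero (hO : IsOpen O) (hK : IsCompact K) (hKO : K ⊆ O)
    (hr : ContDiffOn ℝ ∞ r O) (h₀ : ∀ z ∈ O, z ∉ K → r z = 0)
    {t : Fin 8 → Fin 8 → Fin 8 → E8 → ℝ} (ht : ∀ a b c, ContDiffOn ℝ ∞ (t a b c) O)
    {h : Fin 8 → Fin 8 → Fin 8 → Fin 8 → E8 → ℝ}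
    (hh : ∀ a b c d z, h a b c d z = coordD (fun a b c d => partialD a (t b c d) z) a b c d) :
    ∫ z in O, (altSum (fun g => partialD (g 0) r z * t (g 1) (g 2) (g 3) z
          * h (g 4) (g 5) (g 6) (g 7) z)
        + (1 / 4) * r z * altSum fun g => h (g 0) (g 1) (g 2) (g 3) z
          * h (g 4) (g 5) (g 6) (g 7) z) = 0 := by
  have ht' (a b c d : Fin 8) := contDiffOn_partialD hO (ht b c d) a
  have hh' (a b c d : Fin 8) : ContDiffOn ℝ ∞ (h a b c d) O := by
    have : h a b c d = fun z => coordD (fun a b c d => partialD a (t b c d) z) a b c d :=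
      funext (hh a b c d)
    rw [this]
    exact ((((ht' a b c d).sub (ht' b a c d)).add (ht' c a b d)).sub (ht' d a b c))
  have hF (g : Fin 8 → Fin 8) : IntegrableOn (partialD (g 0)
        fun z => r z * (t (g 1) (g 2) (g 3) z * h (g 4) (g 5) (g 6) (g 7) z)) O
      ∧ ∫ z in O, partialD (g 0)
        (fun z => r z * (t (g 1) (g 2) (g 3) z * h (g 4) (g 5) (g 6) (g 7) z)) z = 0 :=
    setIntegral_fderiv_eq_zero hO hK hKO
    (hr.mul ((ht _ _ _).mul (hh' _ _ _ _))) (fun z hz hzK => by rw [h₀ z hz hzK, zero_mul])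
    (stdVec (g 0))
  have hsum : ∫ z in O, altSum (fun g => partialD (g 0)
      (fun z => r z * (t (g 1) (g 2) (g 3) z * h (g 4) (g 5) (g 6) (g 7) z)) z) = 0 := by
    simp only [altSum]
    rw [integral_finsetSum _ fun (σ : Equiv.Perm (Fin 8)) _ => (hF σ).1.const_mul (sgn σ)]
    refine Finset.sum_eq_zero fun σ _ => ?_
    rw [integral_const_mul, (hF σ).2, mul_zero]
  rw [← hsum]
  refine setIntegral_congr_fun hO.measurableSet fun z hz => ?_
  have D {f : E8 → ℝ} (hf : ContDiffOn ℝ ∞ f O) : DifferentiableAt ℝ f z :=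
    (hf.contDiffAt (hO.mem_nhds hz)).differentiableAt (by simp)
  have hdh (s a b c d : Fin 8) : partialD s (h a b c d) z
      = coordD (fun a b c d => partialD s (partialD a (t b c d)) z) a b c d := by
    have : h a b c d = fun z => coordD (fun a b c d => partialD a (t b c d) z) a b c d :=
      funext (hh a b c d)
    rw [this]
    simp only [coordD]
    rw [partialD_sub (((D (ht' a b c d)).fun_sub (D (ht' b a c d))).fun_add (D (ht' c a b d)))
        (D (ht' d a b c)), partialD_add ((D (ht' a b c d)).fun_sub (D (ht' b a c d))) (D (ht' c a b d)),
      partialD_sub (D (ht' a b c d)) (D (ht' b a c d))]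
  have hp (s a b c p q u v : Fin 8) :
      partialD s (fun z => r z * (t a b c z * h p q u v z)) z
        = partialD s r z * t a b c z * h p q u v z + r z * (partialD s (t a b c) z * h p q u v z
          + t a b c z * coordD (fun a b c d => partialD s (partialD a (t b c d)) z) p q u v) := by
    rw [partialD_mul (D hr) ((D (ht a b c)).fun_mul (D (hh' p q u v))),
      partialD_mul (D (ht a b c)) (D (hh' p q u v)), hdh]
    ring
  have key := altSum_coordD (fun a b c => t a b c z) (fun a b c d => partialD a (t b c d) z)
    (fun s a b c d => partialD s (partialD a (t b c d)) z)
    (fun s a b c d => partialD_comm hO (ht b c d) hz s a)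
  simp only [← hh] at key
  simp only [hp]
  have hm (G : (Fin 8 → Fin 8) → ℝ) : altSum (fun g => r z * G g) = r z * altSum G := by
    simp only [altSum, Finset.mul_sum, mul_left_comm]
  rw [altSum_add, hm, key]
  ring

end Integration

/-! ### The Riemannian density -/

section Density

variable {M : Type*} [TopologicalSpace M] [ChartedSpace E8 M] [IsManifold 𝓘(ℝ, E8) ∞ M]
  [Bundle.RiemannianBundle (fun x : M => TangentSpace 𝓘(ℝ, E8) x)]

variable {e : Fin 8 → VF M} {U V : Set M} {X Y Z W : VF M} {p q x y : M} {ρ : M → ℝ}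
  {Φ : Π x : M, TangentSpace 𝓘(ℝ, E8) x [⋀^Fin 4]→ₗ[ℝ] ℝ}

/-- The components of the coordinate fields in a frame. -/
def frameMat (e : Fin 8 → VF M) (p y : M) : Matrix (Fin 8) (Fin 8) ℝ :=
  fun a i => comp e (coordField p a y) i

/-- The Riemannian volume density in the chart at `p`. -/
def density (p y : M) : ℝ :=
  √(Matrix.det fun a b => inner ℝ (coordField p a y) (coordField p b y))

namespace OrthoFrame

/-- The Gram matrix of the coordinate fields is `P Pᵀ` with `P = frameMat e p y`. -/
theorem density_eq (F : OrthoFrame e U) (hy : y ∈ U) : density p y = |(frameMat e p y).det| := by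
  have h : (fun a b => inner ℝ (coordField p a y) (coordField p b y))
      = frameMat e p y * (frameMat e p y).transpose := by
    ext a b
    simp only [F.inner_eq hy, Matrix.mul_apply, Matrix.transpose_apply, frameMat]
  rw [density, h, Matrix.det_mul, Matrix.det_transpose, Real.sqrt_mul_self_eq_abs]

theorem det_frameMat_ne_zero (F : OrthoFrame e U) (hy : y ∈ U) (hp : y ∈ (chartAt E8 p).source) :
    (frameMat e p y).det ≠ 0 := by
  rw [Ne, ← Matrix.exists_vecMul_eq_zero_iff]
  rintro ⟨v, hv, h⟩
  refine hv ?_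
  have h₁ : ∑ a, v a • coordField p a y = 0 := by
    rw [F.sum_comp hy (∑ a, v a • coordField p a y)]
    refine Finset.sum_eq_zero fun i _ => ?_
    have : comp e (∑ a, v a • coordField p a y) i = 0 := by
      rw [comp_sum]
      simp only [comp_smul]
      exact congrFun h i
    rw [this, zero_smul]
  have h₂ := congrArg (chartDeriv p hp) h₁
  simp only [map_sum, map_smul, map_zero, chartDeriv_coordField hp] at h₂
  ext c
  have := congrArg (fun w : E8 => w c) h₂
  simpa [Pi.single_apply] using this

theorem density_pos (F : OrthoFrame e U) (hy : y ∈ U) (hp : y ∈ (chartAt E8 p).source) :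
    0 < density p y := by
  rw [F.density_eq hy]
  exact abs_pos.2 (F.det_frameMat_ne_zero hy hp)

theorem density_change (F : OrthoFrame e U) (hy : y ∈ U) (hp : y ∈ (chartAt E8 p).source)
    (hq : y ∈ (chartAt E8 q).source) :
    density p y = |(jacobian p q y).det| * density q y := by
  have h : frameMat e p y = jacobian p q y * frameMat e q y := by
    ext a i
    simp only [frameMat, Matrix.mul_apply, coordField_change hp hq (a := a), comp_sum, comp_smul]
  rw [F.density_eq hy, F.density_eq hy, h, Matrix.det_mul, abs_mul]

variable [IsContMDiffRiemannianBundle 𝓘(ℝ, E8) ∞ E8 (fun x : M => TangentSpace 𝓘(ℝ, E8) x)]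

theorem smoothFn_frameMat (F : OrthoFrame e U) (p : M) (a i : Fin 8) :
    SmoothFn (fun z => frameMat e p z a i) (U ∩ (chartAt E8 p).source) :=
  F.smoothFn_comp Set.inter_subset_left ((smoothVF_coordField p a).mono Set.inter_subset_right) i

theorem continuousOn_det_frameMat (F : OrthoFrame e U) (p : M) :
    ContinuousOn (fun z => (frameMat e p z).det) (U ∩ (chartAt E8 p).source) := by
  simp only [Matrix.det_apply]
  exact continuousOn_finsetSum _ fun σ _ => ContinuousOn.const_smul
    (continuousOn_finsetProd _ fun i _ => (F.smoothFn_frameMat p (σ i) i).continuousOn) _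

end OrthoFrame

/-! ### The energy of the exterior derivative of the torsion -/

/-- The squared norm of the exterior derivative of the torsion. -/
def energyFn (Φ : Π x : M, TangentSpace 𝓘(ℝ, E8) x [⋀^Fin 4]→ₗ[ℝ] ℝ) (y : M) : ℝ :=
  ∑ i, ∑ j, ∑ k, ∑ l, extD₃ (torsionForm Φ) y (onb y i) (onb y j) (onb y k) (onb y l)
    * extD₃ (torsionForm Φ) y (onb y i) (onb y j) (onb y k) (onb y l)

/-- The inner product of `dρ ∧ T` with `dT`. -/
def fluxFn (Φ : Π x : M, TangentSpace 𝓘(ℝ, E8) x [⋀^Fin 4]→ₗ[ℝ] ℝ) (ρ : M → ℝ) (y : M) : ℝ :=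
  ∑ i, ∑ j, ∑ k, ∑ l,
    mvfderiv 𝓘(ℝ, E8) ρ y (onb y i) * torsionForm Φ y (onb y j) (onb y k) (onb y l)
      * extD₃ (torsionForm Φ) y (onb y i) (onb y j) (onb y k) (onb y l)

/-- Full contractions may be computed in any orthonormal frame. -/
theorem OrthoFrame.trace₄_eq (F : OrthoFrame e U) (hy : y ∈ U)
    {A B : TangentSpace 𝓘(ℝ, E8) y → TangentSpace 𝓘(ℝ, E8) y → TangentSpace 𝓘(ℝ, E8) y →
      TangentSpace 𝓘(ℝ, E8) y → ℝ} {A' B' : Fin 8 → Fin 8 → Fin 8 → Fin 8 → ℝ}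
    (hA : ∀ u v w z, A u v w z = ∑ i, ∑ j, ∑ k, ∑ l,
      comp e u i * comp e v j * comp e w k * comp e z l * A' i j k l)
    (hB : ∀ u v w z, B u v w z = ∑ i, ∑ j, ∑ k, ∑ l,
      comp e u i * comp e v j * comp e w k * comp e z l * B' i j k l) :
    ∑ i, ∑ j, ∑ k, ∑ l, A (onb y i) (onb y j) (onb y k) (onb y l)
        * B (onb y i) (onb y j) (onb y k) (onb y l)
      = ∑ i, ∑ j, ∑ k, ∑ l, A' i j k l * B' i j k l := by
  have L {C : TangentSpace 𝓘(ℝ, E8) y → TangentSpace 𝓘(ℝ, E8) y → TangentSpace 𝓘(ℝ, E8) y →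
      TangentSpace 𝓘(ℝ, E8) y → ℝ} {C' : Fin 8 → Fin 8 → Fin 8 → Fin 8 → ℝ}
      (hC : ∀ u v w z, C u v w z = ∑ i, ∑ j, ∑ k, ∑ l,
        comp e u i * comp e v j * comp e w k * comp e z l * C' i j k l) :
      (∀ v w z, IsLinearMap ℝ fun u => C u v w z) ∧ (∀ u w z, IsLinearMap ℝ fun v => C u v w z) ∧
        (∀ u v z, IsLinearMap ℝ fun w => C u v w z) ∧ ∀ u v w, IsLinearMap ℝ fun z => C u v w z := by
    simp only [hC]
    refine ⟨fun v w z => ?_, fun u w z => ?_, fun u v z => ?_, fun u v w => ?_⟩ <;>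
      refine isLinearMap_sum _ fun i => isLinearMap_sum _ fun j => isLinearMap_sum _ fun k =>
        isLinearMap_sum _ fun l => isLinearMap_mul_const ?_ _
    · exact isLinearMap_mul_const (isLinearMap_mul_const (isLinearMap_mul_const
        (isLinearMap_compFn e y i) _) _) _
    · exact isLinearMap_mul_const (isLinearMap_mul_const (isLinearMap_const_mul
        (isLinearMap_compFn e y j) _) _) _
    · exact isLinearMap_mul_const (isLinearMap_const_mul (isLinearMap_compFn e y k) _) _
    · exact isLinearMap_const_mul (isLinearMap_compFn e y l) _
  obtain ⟨a₀, a₁, a₂, a₃⟩ := L hA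
  obtain ⟨b₀, b₁, b₂, b₃⟩ := L hB
  have h₃ (u v w) : ∑ l, A u v w (onb y l) * B u v w (onb y l)
      = ∑ l, A u v w (e l y) * B u v w (e l y) :=
    F.trace_eq hy (B := fun z z' => A u v w z * B u v w z')
      (fun _ => isLinearMap_mul_const (a₃ _ _ _) _) (fun _ => isLinearMap_const_mul (b₃ _ _ _) _)
  have h₂ (u v) : ∑ k, ∑ l, A u v (onb y k) (e l y) * B u v (onb y k) (e l y)
      = ∑ k, ∑ l, A u v (e k y) (e l y) * B u v (e k y) (e l y) :=
    F.trace_eq hy (B := fun z z' => ∑ l, A u v z (e l y) * B u v z' (e l y))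
      (fun _ => isLinearMap_sum _ fun _ => isLinearMap_mul_const (a₂ _ _ _) _)
      (fun _ => isLinearMap_sum _ fun _ => isLinearMap_const_mul (b₂ _ _ _) _)
  have h₁ (u) : ∑ j, ∑ k, ∑ l, A u (onb y j) (e k y) (e l y) * B u (onb y j) (e k y) (e l y)
      = ∑ j, ∑ k, ∑ l, A u (e j y) (e k y) (e l y) * B u (e j y) (e k y) (e l y) :=
    F.trace_eq hy (B := fun z z' => ∑ k, ∑ l, A u z (e k y) (e l y) * B u z' (e k y) (e l y))
      (fun _ => isLinearMap_sum _ fun _ => isLinearMap_sum _ fun _ =>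
        isLinearMap_mul_const (a₁ _ _ _) _)
      (fun _ => isLinearMap_sum _ fun _ => isLinearMap_sum _ fun _ =>
        isLinearMap_const_mul (b₁ _ _ _) _)
  have h₀ := F.trace_eq hy
    (B := fun z z' => ∑ j, ∑ k, ∑ l, A z (e j y) (e k y) (e l y) * B z' (e j y) (e k y) (e l y))
    (fun _ => isLinearMap_sum _ fun _ => isLinearMap_sum _ fun _ => isLinearMap_sum _ fun _ =>
      isLinearMap_mul_const (a₀ _ _ _) _)
    (fun _ => isLinearMap_sum _ fun _ => isLinearMap_sum _ fun _ => isLinearMap_sum _ fun _ =>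
      isLinearMap_const_mul (b₀ _ _ _) _)
  simp only [h₃, h₂, h₁, h₀]
  simp only [hA, hB, F.sum_comp_frame₄ hy]

namespace AdaptedFrame

variable [IsContMDiffRiemannianBundle 𝓘(ℝ, E8) ∞ E8 (fun x : M => TangentSpace 𝓘(ℝ, E8) x)]

theorem energyFn_eq (F : AdaptedFrame Φ e U) (hy : y ∈ U) :
    energyFn Φ y = ∑ i, ∑ j, ∑ k, ∑ l, extDFn e y i j k l * extDFn e y i j k l :=
  F.trace₄_eq hy (F.extD₃_eq hy) (F.extD₃_eq hy)

theorem mvfderiv_mul_torsionForm (F : AdaptedFrame Φ e U) (hy : y ∈ U)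
    (u v w z : TangentSpace 𝓘(ℝ, E8) y) :
    mvfderiv 𝓘(ℝ, E8) ρ y u * torsionForm Φ y v w z
      = ∑ i, ∑ j, ∑ k, ∑ l, comp e u i * comp e v j * comp e w k * comp e z l
        * (lieD (e i) ρ y * torsionFn e y j k l) := by
  rw [F.torsionForm_eq hy, F.map_eq_sum hy (f := fun u => mvfderiv 𝓘(ℝ, E8) ρ y u)
    ⟨map_add _, map_smul _⟩, Finset.sum_mul]
  refine Finset.sum_congr rfl fun i _ => ?_
  simp only [Finset.mul_sum]
  exact Finset.sum_congr rfl fun j _ => Finset.sum_congr rfl fun k _ =>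
    Finset.sum_congr rfl fun l _ => by rw [lieD]; ring

theorem fluxFn_eq (F : AdaptedFrame Φ e U) (hy : y ∈ U) :
    fluxFn Φ ρ y = ∑ i, ∑ j, ∑ k, ∑ l,
      lieD (e i) ρ y * torsionFn e y j k l * extDFn e y i j k l :=
  F.trace₄_eq hy
    (A := fun u v w z => mvfderiv 𝓘(ℝ, E8) ρ y u * torsionForm Φ y v w z)
    (A' := fun i j k l => lieD (e i) ρ y * torsionFn e y j k l)
    (B := extD₃ (torsionForm Φ) y) (B' := extDFn e y)
    (fun u v w z => F.mvfderiv_mul_torsionForm hy u v w z) (F.extD₃_eq hy)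

theorem extD₃_eq_zero_of_energyFn (F : AdaptedFrame Φ e U) (hy : y ∈ U) (h : energyFn Φ y = 0)
    (u v w z : TangentSpace 𝓘(ℝ, E8) y) : extD₃ (torsionForm Φ) y u v w z = 0 := by
  rw [F.energyFn_eq hy] at h
  have n (i j k l : Fin 8) := mul_self_nonneg (extDFn e y i j k l)
  have s₃ (i j k : Fin 8) := Finset.sum_nonneg fun l (_ : l ∈ Finset.univ) => n i j k l
  have s₂ (i j : Fin 8) := Finset.sum_nonneg fun k (_ : k ∈ Finset.univ) => s₃ i j k
  have s₁ (i : Fin 8) := Finset.sum_nonneg fun j (_ : j ∈ Finset.univ) => s₂ i j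
  have hz (i j k l : Fin 8) : extDFn e y i j k l = 0 := by
    have h₁ := (Finset.sum_eq_zero_iff_of_nonneg fun i _ => s₁ i).1 h i (Finset.mem_univ _)
    have h₂ := (Finset.sum_eq_zero_iff_of_nonneg fun j _ => s₂ i j).1 h₁ j (Finset.mem_univ _)
    have h₃ := (Finset.sum_eq_zero_iff_of_nonneg fun k _ => s₃ i j k).1 h₂ k (Finset.mem_univ _)
    have h₄ := (Finset.sum_eq_zero_iff_of_nonneg fun l _ => n i j k l).1 h₃ l (Finset.mem_univ _)
    exact mul_self_eq_zero.1 h₄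
  rw [F.extD₃_eq hy]
  refine Finset.sum_eq_zero fun i _ => Finset.sum_eq_zero fun j _ => Finset.sum_eq_zero fun k _ =>
    Finset.sum_eq_zero fun l _ => ?_
  have := hz i j k l
  rw [extDFn] at this
  rw [this, mul_zero]

theorem energyFn_nonneg (F : AdaptedFrame Φ e U) (hy : y ∈ U) : 0 ≤ energyFn Φ y :=
  Finset.sum_nonneg fun _ _ => Finset.sum_nonneg fun _ _ => Finset.sum_nonneg fun _ _ =>
    Finset.sum_nonneg fun _ _ => mul_self_nonneg _

theorem continuousOn_energyFn (F : AdaptedFrame Φ e U) : ContinuousOn (energyFn Φ) U := by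
  have h : SmoothFn (fun y => ∑ i, ∑ j, ∑ k, ∑ l, extDFn e y i j k l * extDFn e y i j k l) U :=
    SmoothFn.sum _ fun i _ => SmoothFn.sum _ fun j _ => SmoothFn.sum _ fun k _ =>
      SmoothFn.sum _ fun l _ => (F.smoothFn_extDFn i j k l).mul (F.smoothFn_extDFn i j k l)
  exact h.continuousOn.congr fun y hy => F.energyFn_eq hy

theorem continuousOn_fluxFn (F : AdaptedFrame Φ e U) (hρ : SmoothFn ρ U) :
    ContinuousOn (fluxFn Φ ρ) U := by
  have h : SmoothFn (fun y => ∑ i, ∑ j, ∑ k, ∑ l,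
      lieD (e i) ρ y * torsionFn e y j k l * extDFn e y i j k l) U :=
    SmoothFn.sum _ fun i _ => SmoothFn.sum _ fun j _ => SmoothFn.sum _ fun k _ =>
      SmoothFn.sum _ fun l _ => ((F.smoothFn_lieD F.isOpen subset_rfl (F.smooth i) hρ).mul
        (F.smoothFn_torsionFn j k l)).mul (F.smoothFn_extDFn i j k l)
  exact h.continuousOn.congr fun y hy => F.fluxFn_eq hy

/-- The components of the torsion and of its exterior derivative in coordinates. -/
theorem d₃_coordField (F : AdaptedFrame Φ e U) (hy : y ∈ U) (hp : y ∈ (chartAt E8 p).source)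
    (a b c d : Fin 8) :
    d₃ (torsionForm Φ) (coordField p a) (coordField p b) (coordField p c) (coordField p d) y
      = ∑ i, ∑ j, ∑ k, ∑ l, frameMat e p y a i * frameMat e p y b j * frameMat e p y c k
        * frameMat e p y d l * extDFn e y i j k l := by
  have D (a : Fin 8) : DiffVF (coordField p a) y :=
    (smoothVF_coordField p a).diffVF (chartAt E8 p).open_source hp
  exact F.d₃_eq_sum hy (D a) (D b) (D c) (D d)

theorem d₃_coordField_eq_coordD (F : AdaptedFrame Φ e U) (hy : y ∈ U)
    (hp : y ∈ (chartAt E8 p).source) (a b c d : Fin 8) :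
    d₃ (torsionForm Φ) (coordField p a) (coordField p b) (coordField p c) (coordField p d) y
      = coordD (fun a b c d => lieD (coordField p a) (fun z => torsionForm Φ z (coordField p b z)
        (coordField p c z) (coordField p d z)) y) a b c d := by
  have z (v w : TangentSpace 𝓘(ℝ, E8) y) : torsionForm Φ y 0 v w = 0 :=
    (F.isLinearMap_torsionForm₀ hy v w).map_zero
  simp only [d₃, bracket_coordField hp, z, coordD]
  ring

theorem selfDual_extDFn (F : AdaptedFrame Φ e U) (hy : y ∈ U)
    (h : ∀ u v : TangentSpace 𝓘(ℝ, E8) y, ricci Φ y u v = -(7 / 6) * nablaLee Φ y u v)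
    (σ : Equiv.Perm (Fin 8)) : extDFn e y (σ 4) (σ 5) (σ 6) (σ 7)
      = sgn σ * extDFn e y (σ 0) (σ 1) (σ 2) (σ 3) :=
  selfDual_of_contr₃_eq_zero (F.extDFn_swap₀₁ hy) (F.extDFn_swap₁₂ hy) (F.extDFn_swap₂₃ hy)
    (F.contr₃_extDFn_eq_zero hy h) σ

/-- In components, `dT ∧ dT` is a multiple of `|dT|²` times the volume form. Passing from
coordinates to the frame costs the determinant, and self-duality of `dT`, a consequence of the Ricci
equation, turns the wedge product into the norm. -/
theorem altSum_energy (F : AdaptedFrame Φ e U) (hy : y ∈ U) (hp : y ∈ (chartAt E8 p).source)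
    (h : ∀ u v : TangentSpace 𝓘(ℝ, E8) y, ricci Φ y u v = -(7 / 6) * nablaLee Φ y u v) :
    altSum (fun g => d₃ (torsionForm Φ) (coordField p (g 0)) (coordField p (g 1))
          (coordField p (g 2)) (coordField p (g 3)) y
        * d₃ (torsionForm Φ) (coordField p (g 4)) (coordField p (g 5)) (coordField p (g 6))
          (coordField p (g 7)) y)
      = (frameMat e p y).det * (fixCount * energyFn Φ y) := by
  simp only [F.d₃_coordField hy hp]
  rw [altSum_transform₄, altSum_mul_selfDual _ (F.extDFn_swap₀₁ hy) (F.extDFn_swap₁₂ hy)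
    (F.extDFn_swap₂₃ hy) (F.selfDual_extDFn hy h), F.energyFn_eq hy]

theorem altSum_flux (F : AdaptedFrame Φ e U) (hy : y ∈ U) (hp : y ∈ (chartAt E8 p).source)
    (h : ∀ u v : TangentSpace 𝓘(ℝ, E8) y, ricci Φ y u v = -(7 / 6) * nablaLee Φ y u v) :
    altSum (fun g => lieD (coordField p (g 0)) ρ y
        * torsionForm Φ y (coordField p (g 1) y) (coordField p (g 2) y) (coordField p (g 3) y)
        * d₃ (torsionForm Φ) (coordField p (g 4)) (coordField p (g 5)) (coordField p (g 6))
          (coordField p (g 7)) y)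
      = (frameMat e p y).det * (fixCount * fluxFn Φ ρ y) := by
  have hm (a b c d : Fin 8) : lieD (coordField p a) ρ y
      * torsionForm Φ y (coordField p b y) (coordField p c y) (coordField p d y)
      = ∑ i, ∑ j, ∑ k, ∑ l, frameMat e p y a i * frameMat e p y b j * frameMat e p y c k
        * frameMat e p y d l * (lieD (e i) ρ y * torsionFn e y j k l) :=
    F.mvfderiv_mul_torsionForm hy _ _ _ _
  simp only [F.d₃_coordField hy hp, hm]
  rw [altSum_transform₄, altSum_mul_selfDual (fun i j k l => lieD (e i) ρ y * torsionFn e y j k l)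
    (F.extDFn_swap₀₁ hy) (F.extDFn_swap₁₂ hy)
    (F.extDFn_swap₂₃ hy) (F.selfDual_extDFn hy h), F.fluxFn_eq hy]

end AdaptedFrame

end Density

/-! ### Integration on a compact manifold -/

section ChartIntegral

open MeasureTheory

variable {M : Type*} [TopologicalSpace M] [ChartedSpace E8 M] [IsManifold 𝓘(ℝ, E8) ∞ M]
  [Bundle.RiemannianBundle (fun x : M => TangentSpace 𝓘(ℝ, E8) x)]

variable {e : Fin 8 → VF M} {U V W : Set M} {p q x y : M} {ρ u : M → ℝ}
  {Φ : Π x : M, TangentSpace 𝓘(ℝ, E8) x [⋀^Fin 4]→ₗ[ℝ] ℝ}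

/-- The integral of a function, computed in the chart at `p`. -/
def chartIntegral (p : M) (u : M → ℝ) : ℝ :=
  ∫ z in (chartAt E8 p).target, u ((chartAt E8 p).symm z) * density p ((chartAt E8 p).symm z)

theorem chartIntegral_eq (hV : V ⊆ (chartAt E8 p).source) (hu : ∀ y ∉ V, u y = 0) :
    chartIntegral p u = ∫ z in (chartAt E8 p).target ∩ (chartAt E8 p).symm ⁻¹' V,
      u ((chartAt E8 p).symm z) * density p ((chartAt E8 p).symm z) := by
  refine (setIntegral_eq_of_subset_of_forall_sdiff_eq_zero (chartAt E8 p).open_target.measurableSet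
    Set.inter_subset_left fun z hz => ?_)
  rw [hu _ fun h => hz.2 ⟨hz.1, h⟩, zero_mul]

theorem det_jacobian (p q y : M) : (jacobian p q y).det
    = (fderiv ℝ (chartAt E8 q ∘ (chartAt E8 p).symm) (chartAt E8 p y)).det := by
  rw [ContinuousLinearMap.det, ← LinearMap.det_toMatrix (EuclideanSpace.basisFun (Fin 8) ℝ).toBasis,
    ← Matrix.det_transpose]
  congr 1

theorem fluxFn_eq_zero (hy : y ∉ tsupport ρ) : fluxFn Φ ρ y = 0 := by
  have h : ρ =ᶠ[nhds y] fun _ => 0 := by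
    filter_upwards [(isClosed_tsupport ρ).isOpen_compl.mem_nhds hy] with z hz
      using image_eq_zero_of_notMem_tsupport hz
  have h' (v : TangentSpace 𝓘(ℝ, E8) y) : mvfderiv 𝓘(ℝ, E8) ρ y v = 0 := by
    have := lieD_congr (X := ext v) h
    rw [lieD_const, lieD, ext_self] at this
    exact this
  simp only [fluxFn, h', zero_mul, Finset.sum_const_zero]

theorem contDiffOn_comp_chart_symm (hWo : IsOpen W) (hW : W ⊆ (chartAt E8 p).source)
    (hu : SmoothFn u W) :
    ContDiffOn ℝ ∞ (u ∘ (chartAt E8 p).symm)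
      ((chartAt E8 p).target ∩ (chartAt E8 p).symm ⁻¹' W) := by
  rw [← contMDiffOn_iff_contDiffOn]
  exact hu.comp ((contMDiffOn_chart_symm (I := 𝓘(ℝ, E8)) (n := ∞) (x := p)).mono
    Set.inter_subset_left) fun z hz => hz.2

variable [IsContMDiffRiemannianBundle 𝓘(ℝ, E8) ∞ E8 (fun x : M => TangentSpace 𝓘(ℝ, E8) x)]

theorem IsSpin7Structure.density_pos (hΦ : IsSpin7Structure Φ) (hy : y ∈ (chartAt E8 p).source) :
    0 < density p y := by
  obtain ⟨e, U, hU, F⟩ := hΦ.exists_adaptedFrame y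
  exact F.density_pos hU hy

theorem IsSpin7Structure.continuousOn_density (hΦ : IsSpin7Structure Φ) (p : M) :
    ContinuousOn (density p) (chartAt E8 p).source := by
  intro y hy
  obtain ⟨e, U, hU, F⟩ := hΦ.exists_adaptedFrame y
  have ho := F.isOpen.inter (chartAt E8 p).open_source
  have h := ((F.continuousOn_det_frameMat p).abs.congr fun z hz => F.density_eq hz.1).continuousAt
    (ho.mem_nhds ⟨hU, hy⟩)
  exact h.continuousWithinAt

/-- The density changes by the absolute value of the Jacobian determinant, which is the factor in
the change of variables formula. No orientation is involved. -/
theorem IsSpin7Structure.chartIntegral_change (hΦ : IsSpin7Structure Φ)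
    (hp : ∀ y ∉ (chartAt E8 p).source, u y = 0) (hq : ∀ y ∉ (chartAt E8 q).source, u y = 0) :
    chartIntegral p u = chartIntegral q u := by
  set φ := chartAt E8 p with hφ
  set ψ := chartAt E8 q with hψ
  have hu : ∀ y ∉ φ.source ∩ ψ.source, u y = 0 := fun y hy => by
    by_cases h : y ∈ φ.source
    · exact hq y fun h' => hy ⟨h, h'⟩
    · exact hp y h
  rw [chartIntegral_eq Set.inter_subset_left hu, chartIntegral_eq Set.inter_subset_right hu, ← hφ,
    ← hψ]
  set A := φ.target ∩ φ.symm ⁻¹' (φ.source ∩ ψ.source) with hA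
  have hAo : IsOpen A := φ.isOpen_inter_preimage_symm (φ.open_source.inter ψ.open_source)
  have himage : (ψ ∘ φ.symm) '' A = ψ.target ∩ ψ.symm ⁻¹' (φ.source ∩ ψ.source) := by
    ext w
    constructor
    · rintro ⟨z, ⟨hz, h₁, h₂⟩, rfl⟩
      refine ⟨ψ.map_source h₂, ?_⟩
      simp only [Function.comp_apply, Set.mem_preimage, ψ.left_inv h₂]
      exact ⟨h₁, h₂⟩
    · rintro ⟨hw, h₁, h₂⟩
      refine ⟨φ (ψ.symm w), ⟨φ.map_source h₁, ?_⟩, ?_⟩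
      · simp only [Set.mem_preimage, φ.left_inv h₁]
        exact ⟨h₁, h₂⟩
      · simp only [Function.comp_apply, φ.left_inv h₁, ψ.right_inv hw]
  have hinj : Set.InjOn (ψ ∘ φ.symm) A := fun z hz w hw h =>
    φ.symm.injOn hz.1 hw.1 (ψ.injOn hz.2.2 hw.2.2 h)
  have hd (z) (hz : z ∈ A) : HasFDerivWithinAt (ψ ∘ φ.symm)
      (fderiv ℝ (ψ ∘ φ.symm) z) A z := by
    have h : DifferentiableAt ℝ (ψ ∘ φ.symm) z := by
      rw [← mdifferentiableAt_iff_differentiableAt]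
      exact MDifferentiableAt.comp z (g := ψ) (I' := 𝓘(ℝ, E8))
        (mdifferentiableAt_atlas (chart_mem_atlas E8 q) hz.2.2)
        (mdifferentiableAt_atlas_symm (chart_mem_atlas E8 p) hz.1)
    exact h.hasFDerivAt.hasFDerivWithinAt
  rw [← himage, integral_image_eq_integral_abs_det_fderiv_smul volume hAo.measurableSet hd hinj]
  refine setIntegral_congr_fun hAo.measurableSet fun z hz => ?_
  obtain ⟨e, U, hU, F⟩ := hΦ.exists_adaptedFrame (φ.symm z)
  have hj := det_jacobian p q (φ.symm z)
  rw [← hφ, ← hψ, φ.right_inv hz.1] at hj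
  simp only [Function.comp_apply, smul_eq_mul, ψ.left_inv hz.2.2]
  rw [F.density_change hU hz.2.1 hz.2.2, hj]
  simp only [Function.comp_def]
  ring

variable [T2Space M] [CompactSpace M]

theorem isCompact_image_tsupport (hu : tsupport u ⊆ (chartAt E8 p).source) :
    IsCompact (chartAt E8 p '' tsupport u) :=
  (isClosed_tsupport u).isCompact.image_of_continuousOn ((chartAt E8 p).continuousOn.mono hu)

theorem IsSpin7Structure.integrableOn_chart (hΦ : IsSpin7Structure Φ) (hc : Continuous u)
    (hu : tsupport u ⊆ (chartAt E8 p).source) :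
    IntegrableOn (fun z => u ((chartAt E8 p).symm z) * density p ((chartAt E8 p).symm z))
      (chartAt E8 p).target := by
  set φ := chartAt E8 p with hφ
  have hK := isCompact_image_tsupport hu
  have hKt : φ '' tsupport u ⊆ φ.target := by
    rintro _ ⟨y, hy, rfl⟩
    exact φ.map_source (hu hy)
  have hcont : ContinuousOn (fun z => u (φ.symm z) * density p (φ.symm z)) φ.target :=
    (hc.comp_continuousOn φ.continuousOn_symm).mul ((hΦ.continuousOn_density p).comp
      φ.continuousOn_symm fun z hz => φ.map_target hz)
  refine IntegrableOn.of_forall_sdiff_eq_zero ((hcont.mono hKt).integrableOn_compact hK)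
    φ.open_target.measurableSet fun z hz => ?_
  rw [image_eq_zero_of_notMem_tsupport fun h => hz.2 ⟨_, h, φ.right_inv hz.1⟩, zero_mul]

/-- Stokes' theorem on a coordinate patch. -/
theorem AdaptedFrame.chartIntegral_flux (F : AdaptedFrame Φ e U) (hWo : IsOpen W) (hWU : W ⊆ U)
    (hW : W ⊆ (chartAt E8 p).source) {s : ℝ} (hs₀ : s ≠ 0)
    (hs : ∀ y ∈ W, (frameMat e p y).det = s * density p y)
    (h : ∀ (x : M) (u v : TangentSpace 𝓘(ℝ, E8) x),
      ricci Φ x u v = -(7 / 6) * nablaLee Φ x u v)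
    (hρ : SmoothFn ρ Set.univ) (hρW : tsupport ρ ⊆ W) :
    chartIntegral p (fun y => fluxFn Φ ρ y + (1 / 4) * ρ y * energyFn Φ y) = 0 := by
  have h0 : ∀ y ∉ W, fluxFn Φ ρ y + (1 / 4) * ρ y * energyFn Φ y = 0 := fun y hy => by
    have hy' : y ∉ tsupport ρ := fun h => hy (hρW h)
    rw [fluxFn_eq_zero hy', image_eq_zero_of_notMem_tsupport hy']
    ring
  rw [chartIntegral_eq hW h0]
  set φ := chartAt E8 p with hφ
  set O := φ.target ∩ φ.symm ⁻¹' W with hO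
  have hOo : IsOpen O := φ.isOpen_inter_preimage_symm hWo
  have hKO : φ '' tsupport ρ ⊆ O := by
    rintro _ ⟨y, hy, rfl⟩
    have hy' := hW (hρW hy)
    refine ⟨φ.map_source hy', ?_⟩
    rw [Set.mem_preimage, φ.left_inv hy']
    exact hρW hy
  have hT (a b c : Fin 8) : SmoothFn (fun z => torsionForm Φ z (coordField p a z)
      (coordField p b z) (coordField p c z)) W :=
    F.smoothFn_torsionForm hWU ((smoothVF_coordField p a).mono hW)
      ((smoothVF_coordField p b).mono hW) ((smoothVF_coordField p c).mono hW)
  have hl {f : M → ℝ} (hf : SmoothFn f W) (a : Fin 8) (z) (hz : z ∈ O) :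
      partialD a (f ∘ φ.symm) z = lieD (coordField p a) f (φ.symm z) := by
    rw [lieD_coordField (hf.diffFn hWo hz.2) (hW hz.2), ← hφ, φ.right_inv hz.1]
    rfl
  -- Stokes' theorem for `ρ T ∧ dT` in coordinates. The self-dual evaluation of both alternating
  -- sums then leaves the common factor `s * fixCount` times the density.
  have key := integral_altSum_eq_zero hOo (isCompact_image_tsupport (hρW.trans hW)) hKO
    (r := ρ ∘ φ.symm) (contDiffOn_comp_chart_symm hWo hW (hρ.mono (Set.subset_univ _)))
    (fun z hz hzK => show ρ (φ.symm z) = 0 from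
      image_eq_zero_of_notMem_tsupport fun h => hzK ⟨_, h, φ.right_inv hz.1⟩)
    (t := fun a b c => (fun z => torsionForm Φ z (coordField p a z)
      (coordField p b z) (coordField p c z)) ∘ φ.symm)
    (fun a b c => contDiffOn_comp_chart_symm hWo hW (hT a b c)) (fun _ _ _ _ _ => rfl)
  have hc : (s * fixCount : ℝ) ≠ 0 :=
    mul_ne_zero hs₀ (Nat.cast_ne_zero.2 fixCount_pos.ne')
  refine (mul_eq_zero.1 ?_).resolve_left hc
  rw [← integral_const_mul, ← key]
  refine setIntegral_congr_fun hOo.measurableSet fun z hz => ?_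
  have hzU := hWU hz.2
  have hzp := hW hz.2
  have hd (a b c d : Fin 8) : coordD (fun a b c d => partialD a ((fun z => torsionForm Φ z
      (coordField p b z) (coordField p c z) (coordField p d z)) ∘ φ.symm) z) a b c d
      = d₃ (torsionForm Φ) (coordField p a) (coordField p b) (coordField p c) (coordField p d)
        (φ.symm z) := by
    simp only [hl (hT _ _ _) _ z hz]
    exact (F.d₃_coordField_eq_coordD hzU hzp a b c d).symm
  simp only [hd, hl (hρ.mono (Set.subset_univ W)) _ z hz]
  have e₁ := F.altSum_energy (p := p) hzU hzp (h _)
  have e₂ := F.altSum_flux (p := p) (ρ := ρ) hzU hzp (h _)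
  simp only [Function.comp_apply]
  rw [e₁, e₂, hs _ hz.2]
  ring

end ChartIntegral

/-! ### The vanishing of the energy -/

section Energy

open MeasureTheory

variable {M : Type*} [TopologicalSpace M] [ChartedSpace E8 M] [IsManifold 𝓘(ℝ, E8) ∞ M]
  [Bundle.RiemannianBundle (fun x : M => TangentSpace 𝓘(ℝ, E8) x)]
  [IsContMDiffRiemannianBundle 𝓘(ℝ, E8) ∞ E8 (fun x : M => TangentSpace 𝓘(ℝ, E8) x)]

variable {p y : M} {ρ u : M → ℝ} {Φ : Π x : M, TangentSpace 𝓘(ℝ, E8) x [⋀^Fin 4]→ₗ[ℝ] ℝ}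

theorem tsupport_fluxFn_subset : tsupport (fluxFn Φ ρ) ⊆ tsupport ρ :=
  closure_minimal (fun _ hy => by_contra fun h => hy (fluxFn_eq_zero h)) (isClosed_tsupport ρ)

/-- The flux is linear in `dρ`, and the derivative of the constant function 1 vanishes. -/
theorem sum_fluxFn {ι : Type*} (S : Finset ι) {ρ : ι → M → ℝ}
    (hρ : ∀ i ∈ S, SmoothFn (ρ i) Set.univ) (h₁ : ∀ y, ∑ i ∈ S, ρ i y = 1) (y : M) :
    ∑ i ∈ S, fluxFn Φ (ρ i) y = 0 := by
  have h (v : TangentSpace 𝓘(ℝ, E8) y) : ∑ i ∈ S, mvfderiv 𝓘(ℝ, E8) (ρ i) y v = 0 := by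
    have := lieD_sum (X := ext v) (x := y) S
      fun i hi => (hρ i hi).diffFn isOpen_univ (Set.mem_univ y)
    simp only [h₁, lieD_const] at this
    simpa only [lieD, ext_self] using this.symm
  simp only [fluxFn, mul_assoc]
  rw [Finset.sum_comm]
  refine Finset.sum_eq_zero fun i _ => ?_
  rw [Finset.sum_comm]
  refine Finset.sum_eq_zero fun j _ => ?_
  rw [Finset.sum_comm]
  refine Finset.sum_eq_zero fun k _ => ?_
  rw [Finset.sum_comm]
  refine Finset.sum_eq_zero fun l _ => ?_
  rw [← Finset.sum_mul, h, zero_mul]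

namespace IsSpin7Structure

theorem continuous_energyFn (hΦ : IsSpin7Structure Φ) : Continuous (energyFn Φ) :=
  continuous_iff_continuousAt.2 fun y => by
    obtain ⟨e, U, hU, F⟩ := hΦ.exists_adaptedFrame y
    exact F.continuousOn_energyFn.continuousAt (F.isOpen.mem_nhds hU)

theorem continuous_fluxFn (hΦ : IsSpin7Structure Φ) (hρ : SmoothFn ρ Set.univ) :
    Continuous (fluxFn Φ ρ) :=
  continuous_iff_continuousAt.2 fun y => by
    obtain ⟨e, U, hU, F⟩ := hΦ.exists_adaptedFrame y
    exact (F.continuousOn_fluxFn (hρ.mono (Set.subset_univ U))).continuousAt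
      (F.isOpen.mem_nhds hU)

variable [T2Space M] [CompactSpace M]

theorem chartIntegral_sum (hΦ : IsSpin7Structure Φ) {ι : Type*} (S : Finset ι) {u : ι → M → ℝ}
    (hc : ∀ i ∈ S, Continuous (u i)) (hu : ∀ i ∈ S, tsupport (u i) ⊆ (chartAt E8 p).source) :
    chartIntegral p (fun y => ∑ i ∈ S, u i y) = ∑ i ∈ S, chartIntegral p (u i) := by
  simp only [chartIntegral, Finset.sum_mul]
  exact integral_finsetSum _ fun i hi => hΦ.integrableOn_chart (hc i hi) (hu i hi)

theorem chartIntegral_add (hΦ : IsSpin7Structure Φ) {u v : M → ℝ} (hu : Continuous u)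
    (hv : Continuous v) (hu' : tsupport u ⊆ (chartAt E8 p).source)
    (hv' : tsupport v ⊆ (chartAt E8 p).source) :
    chartIntegral p (fun y => u y + v y) = chartIntegral p u + chartIntegral p v := by
  simp only [chartIntegral, add_mul]
  exact integral_add (hΦ.integrableOn_chart hu hu') (hΦ.integrableOn_chart hv hv')

theorem chartIntegral_nonneg (hΦ : IsSpin7Structure Φ) (hu : ∀ y, 0 ≤ u y) :
    0 ≤ chartIntegral p u :=
  setIntegral_nonneg (chartAt E8 p).open_target.measurableSet fun z hz =>
    mul_nonneg (hu _) (hΦ.density_pos ((chartAt E8 p).map_target hz)).le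

theorem eq_zero_of_chartIntegral (hΦ : IsSpin7Structure Φ) (hc : Continuous u)
    (hu : tsupport u ⊆ (chartAt E8 p).source) (h₀ : ∀ y, 0 ≤ u y)
    (h : chartIntegral p u = 0) (y : M) : u y = 0 := by
  by_cases hy : y ∈ (chartAt E8 p).source
  · set φ := chartAt E8 p with hφ
    have hcont : ContinuousOn (fun z => u (φ.symm z) * density p (φ.symm z)) φ.target :=
      (hc.comp_continuousOn φ.continuousOn_symm).mul ((hΦ.continuousOn_density p).comp
        φ.continuousOn_symm fun z hz => φ.map_target hz)
    have hn : 0 ≤ᵐ[volume.restrict φ.target] fun z => u (φ.symm z) * density p (φ.symm z) := by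
      filter_upwards [ae_restrict_mem φ.open_target.measurableSet] with z hz
        using mul_nonneg (h₀ _) (hΦ.density_pos (φ.map_target hz)).le
    have hz := (setIntegral_eq_zero_iff_of_nonneg_ae hn (hΦ.integrableOn_chart hc hu)).1 h
    have := Measure.eqOn_open_of_ae_eq hz φ.open_target hcont continuousOn_const (φ.map_source hy)
    simp only [φ.left_inv hy, Pi.zero_apply] at this
    exact (mul_eq_zero.1 this).resolve_right (hΦ.density_pos hy).ne'
  · exact image_eq_zero_of_notMem_tsupport fun h => hy (hu h)

/-- The patch is cut down until the determinant of the frame against the coordinates keeps the sign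
it has at `p`. Determinant and density then differ by a constant sign, which can be taken out of the
integral. -/
theorem exists_patch (hΦ : IsSpin7Structure Φ)
    (h : ∀ (x : M) (u v : TangentSpace 𝓘(ℝ, E8) x),
      ricci Φ x u v = -(7 / 6) * nablaLee Φ x u v) (p : M) :
    ∃ W : Set M, IsOpen W ∧ p ∈ W ∧ W ⊆ (chartAt E8 p).source ∧
      ∀ ρ : M → ℝ, SmoothFn ρ Set.univ → tsupport ρ ⊆ W →
        chartIntegral p (fun y => fluxFn Φ ρ y + (1 / 4) * ρ y * energyFn Φ y) = 0 := by
  obtain ⟨e, U, hU, F⟩ := hΦ.exists_adaptedFrame p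
  have hp := mem_chart_source E8 p
  have ho := F.isOpen.inter (chartAt E8 p).open_source
  have hne := F.det_frameMat_ne_zero hU hp
  set c := (frameMat e p p).det with hc
  refine ⟨(U ∩ (chartAt E8 p).source) ∩ {y | 0 < c * (frameMat e p y).det}, ?_, ⟨⟨hU, hp⟩, ?_⟩,
    fun y hy => hy.1.2, fun ρ hρ hρW => ?_⟩
  · exact (continuousOn_const.mul (F.continuousOn_det_frameMat p)).isOpen_inter_preimage ho
      isOpen_Ioi
  · exact mul_self_pos.2 hne
  · refine F.chartIntegral_flux (s := c / |c|) ?_ (fun y hy => hy.1.1) (fun y hy => hy.1.2)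
      (div_ne_zero hne (abs_ne_zero.2 hne)) (fun y hy => ?_) h hρ hρW
    · exact (continuousOn_const.mul (F.continuousOn_det_frameMat p)).isOpen_inter_preimage ho
        isOpen_Ioi
    · have hy₂ : 0 < c * (frameMat e p y).det := hy.2
      rw [F.density_eq hy.1.1]
      rcases lt_or_gt_of_ne hne with hc | hc
      · have : (frameMat e p y).det < 0 := by nlinarith
        rw [abs_of_neg hc, abs_of_neg this]
        field_simp
      · have : 0 < (frameMat e p y).det := (pos_iff_pos_of_mul_pos hy₂).1 hc
        rw [abs_of_pos hc, abs_of_pos this]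
        field_simp

/-- On a compact manifold the identity for the Ricci tensor forces the torsion to be closed. -/
theorem energyFn_eq_zero (hΦ : IsSpin7Structure Φ)
    (h : ∀ (x : M) (u v : TangentSpace 𝓘(ℝ, E8) x),
      ricci Φ x u v = -(7 / 6) * nablaLee Φ x u v) (y : M) : energyFn Φ y = 0 := by
  choose W hWo hWp hWs hW using hΦ.exists_patch h
  obtain ⟨f, hf⟩ := SmoothPartitionOfUnity.exists_isSubordinate 𝓘(ℝ, E8) isClosed_univ W hWo
    fun x _ => Set.mem_iUnion.2 ⟨x, hWp x⟩
  -- Compactness makes only finitely many functions of the partition nonzero, so all sums below are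
  -- finite.
  have hfin := f.locallyFinite.finite_nonempty_of_compact
  set S := hfin.toFinset with hS
  have hone (y : M) : ∑ i ∈ S, f i y = 1 := by
    rw [← f.sum_eq_one (Set.mem_univ y)]
    refine (finsum_eq_sum_of_support_subset _ fun i hi => ?_).symm
    simp only [hS, Set.Finite.coe_toFinset, Set.mem_ofPred_eq]
    exact ⟨y, hi⟩
  have hsm (i : M) : SmoothFn (f i) Set.univ := (f i).contMDiff.contMDiffOn
  have hcf (i : M) : Continuous (f i) := (f i).contMDiff.continuous
  have hE := hΦ.continuous_energyFn
  have hF (i : M) := hΦ.continuous_fluxFn (hsm i)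
  have hsub (i : M) : tsupport (f i) ⊆ (chartAt E8 i).source := (hf i).trans (hWs i)
  have hsubF (i : M) : tsupport (fluxFn Φ (f i)) ⊆ (chartAt E8 i).source :=
    tsupport_fluxFn_subset.trans (hsub i)
  have hfE (i : M) : tsupport (fun y => (1 / 4) * f i y * energyFn Φ y)
      ⊆ (chartAt E8 i).source := by
    refine (closure_mono fun z hz => ?_).trans (hsub i)
    exact fun h0 => hz (by simp [h0])
  have hcE (i : M) : Continuous fun y => (1 / 4) * f i y * energyFn Φ y :=
    (continuous_const.mul (hcf i)).mul hE
  have hnn (i y : M) : 0 ≤ (1 / 4) * f i y * energyFn Φ y := by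
    obtain ⟨e, U, hU, F⟩ := hΦ.exists_adaptedFrame y
    exact mul_nonneg (mul_nonneg (by norm_num) (f.nonneg i y)) (F.energyFn_nonneg hU)
  have hlocal (i : M) : chartIntegral i (fluxFn Φ (f i))
      + chartIntegral i (fun y => (1 / 4) * f i y * energyFn Φ y) = 0 := by
    rw [← hΦ.chartIntegral_add (hF i) (hcE i) (hsubF i) (hfE i)]
    exact hW i (f i) (hsm i) (hf i)
  have hmul (i j : M) : tsupport (fun y => f i y * fluxFn Φ (f j) y) ⊆ (chartAt E8 i).source ∧
      tsupport (fun y => f i y * fluxFn Φ (f j) y) ⊆ (chartAt E8 j).source :=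
    ⟨(tsupport_mul_subset_left (f := f i)).trans (hsub i),
      (tsupport_mul_subset_right (f := f i)).trans (hsubF j)⟩
  have hcm (i j : M) : Continuous fun y => f i y * fluxFn Φ (f j) y := (hcf i).mul (hF j)
  have hzero {i : M} {u : M → ℝ} (hu : tsupport u ⊆ (chartAt E8 i).source) :
      ∀ y ∉ (chartAt E8 i).source, u y = 0 :=
    fun y hy => image_eq_zero_of_notMem_tsupport fun h => hy (hu h)
  -- The flux of each `f j` is integrated in its own chart. Splitting it once more with the
  -- partition of unity lets every piece `f i * fluxFn Φ (f j)` be moved to chart `i`, where the sum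
  -- over `j` vanishes pointwise.
  have hflux : ∑ j ∈ S, chartIntegral j (fluxFn Φ (f j)) = 0 := by
    have h₁ (j : M) : chartIntegral j (fluxFn Φ (f j))
        = ∑ i ∈ S, chartIntegral i (fun y => f i y * fluxFn Φ (f j) y) := by
      have : fluxFn Φ (f j) = fun y => ∑ i ∈ S, f i y * fluxFn Φ (f j) y := by
        ext y
        rw [← Finset.sum_mul, hone, one_mul]
      conv_lhs => rw [this]
      rw [hΦ.chartIntegral_sum S (fun i _ => hcm i j) (fun i _ => (hmul i j).2)]
      exact Finset.sum_congr rfl fun i _ =>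
        hΦ.chartIntegral_change (hzero (hmul i j).2) (hzero (hmul i j).1)
    rw [Finset.sum_congr rfl fun j _ => h₁ j, Finset.sum_comm]
    refine Finset.sum_eq_zero fun i _ => ?_
    rw [← hΦ.chartIntegral_sum S (fun j _ => hcm i j) (fun j _ => (hmul i j).1)]
    have : (fun y => ∑ j ∈ S, f i y * fluxFn Φ (f j) y) = fun _ => 0 := by
      ext y
      rw [← Finset.mul_sum, sum_fluxFn S (fun j _ => hsm j) hone, mul_zero]
    rw [this, chartIntegral]
    simp
  have hsum : ∑ i ∈ S, chartIntegral i (fun y => (1 / 4) * f i y * energyFn Φ y) = 0 := by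
    have := Finset.sum_congr rfl fun i (_ : i ∈ S) => hlocal i
    rw [Finset.sum_add_distrib, hflux, zero_add, Finset.sum_const_zero] at this
    exact this
  -- A vanishing sum of nonnegative integrals forces each one to vanish, and a nonnegative
  -- continuous integrand with vanishing integral is zero. Summing over the partition then gives
  -- `energyFn Φ y = 0`.
  have hi (i : M) (hi : i ∈ S) : (1 / 4) * f i y * energyFn Φ y = 0 :=
    hΦ.eq_zero_of_chartIntegral (hcE i) (hfE i) (hnn i)
      ((Finset.sum_eq_zero_iff_of_nonneg fun i _ => hΦ.chartIntegral_nonneg (hnn i)).1 hsum i hi) y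
  have := Finset.sum_eq_zero hi
  rw [← Finset.sum_mul, ← Finset.mul_sum, hone] at this
  linarith

theorem closed_of_ricci_eq (hΦ : IsSpin7Structure Φ)
    (h : ∀ (x : M) (u v : TangentSpace 𝓘(ℝ, E8) x),
      ricci Φ x u v = -(7 / 6) * nablaLee Φ x u v) (y : M)
    (u v w z : TangentSpace 𝓘(ℝ, E8) y) : extD₃ (torsionForm Φ) y u v w z = 0 := by
  obtain ⟨e, U, hU, F⟩ := hΦ.exists_adaptedFrame y
  exact F.extD₃_eq_zero_of_energyFn hU (hΦ.energyFn_eq_zero h y) u v w z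

end IsSpin7Structure

end Energy

end Spin7

end

theorem mainTheorem2 {M : Type*} [TopologicalSpace M] [T2Space M] [CompactSpace M]
    [ChartedSpace Spin7.E8 M] [IsManifold 𝓘(ℝ, Spin7.E8) ∞ M]
    [Bundle.RiemannianBundle (fun x : M => TangentSpace 𝓘(ℝ, Spin7.E8) x)]
    [IsContMDiffRiemannianBundle 𝓘(ℝ, Spin7.E8) ∞ Spin7.E8
      (fun x : M => TangentSpace 𝓘(ℝ, Spin7.E8) x)]
    (Φ : Π x : M, TangentSpace 𝓘(ℝ, Spin7.E8) x [⋀^Fin 4]→ₗ[ℝ] ℝ)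
    (hΦ : Spin7.IsSpin7Structure Φ) :
    ((∀ (x : M) (u v w z : TangentSpace 𝓘(ℝ, Spin7.E8) x),
        Spin7.extD₃ (Spin7.torsionForm Φ) x u v w z = 0) ↔
      ∀ (x : M) (u v : TangentSpace 𝓘(ℝ, Spin7.E8) x),
        Spin7.ricci Φ x u v = -(7 / 6) * Spin7.nablaLee Φ x u v) ∧
    ((∀ (x : M) (u v w z : TangentSpace 𝓘(ℝ, Spin7.E8) x),
        Spin7.extD₃ (Spin7.torsionForm Φ) x u v w z = 0) →
      ∀ x : M, Spin7.MemLambda21 Φ x (Spin7.extD₁ (Spin7.leeForm Φ) x)) := by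
  exact ⟨⟨fun h x => hΦ.ricci_eq_of_closed (h x), hΦ.closed_of_ricci_eq⟩,
    fun h x => hΦ.memLambda21_of_closed (h x)⟩
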